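/- Let $n,k,q$ be non-negative integers. For a non-negative integer $m$ let $L_m$ be the set of all locally square integrable functions $u:[0,\infty)\to\mathbb R^m$, and $L^2_m\subset L_m$ the set of square integrable ones, with $\|u\|^2=\int_0^\infty|u(t)|^2dt$. (Elements are functions, not equivalence classes, so that $u(0)$ makes sense; $|\cdot|$ is the Euclidean norm, and $M'$ is the Hermitian conjugate of $M$.) Let $A\in\mathbb R^{n\times n}$ be Hurwitz (i.e. $sI-A$ is nonsingular for all $s\in\mathbb C$ with $\mathrm{Re}\,s\ge 0$), let $B_1\in\mathbb R^{n\times k}$, $B_2\in\mathbb R^{n\times q}$, $Q\in\mathbb R^{(n+k+q)\times(n+k+q)}$, let $X_0\subset\mathbb R^n$, and set $$\sigma(x,v,w)=\begin{bmatrix}x\\v\\w\end{bmatrix}'Q\begin{bmatrix}x\\v\\w\end{bmatrix}.$$ For $v\in L_k$, $w\in L_q$, $x_0\in\mathbb R^n$ let $x\in L_n$ denote the solution of $\dot x=Ax+B_1v+B_2w$, $x(0)=x_0$, i.e. $$x(t)=x_0+\int_0^t\bigl[Ax(\tau)+B_1v(\tau)+B_2w(\tau)\bigr]d\tau\qquad(t\ge0).$$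 Let $\Delta\subset L_k\times L_q$ be a system that has the following two properties. 1. $\Delta$ is weakly causally stable: for every $T\ge0$, every $(v,w)\in\Delta$ and every $v_*\in L^2_k$ with $v(t)=v_*(t)$ for all $t\le T$, there is a sequence $(v_i,w_i)\in\Delta\cap(L^2_k\times L^2_q)$ such that $v_i(t)=v(t)$ and $w_i(t)=w(t)$ for all $t\le T$ and all $i$, and $\|v_i-v_*\|\to0$ as $i\to\infty$. 2. $\Delta$ satisfies the conditional integral quadratic constraint (IQC) defined by $A,B_1,B_2,Q,X_0$: there is a continuous function $\kappa:\mathbb R^n\times\mathbb R^k\times\mathbb R^q\to\mathbb R$ such that $$\int_0^\infty\sigma(x(t),v(t),w(t))\,dt\ \ge\ -\kappa(x_0,v(0),w(0))$$ for all $(v,w)\in\Delta\cap(L^2_k\times L^2_q)$ and $x_0\in X_0$, where $x$ is the solution corresponding to $v,w,x_0$. Assume also the following. (a) With $B=[B_1,\ B_2]$ and $$\Pi(s)=\begin{bmatrix}(sI-A)^{-1}B\\ I\end{bmatrix}'Q\begin{bmatrix}(sI-A)^{-1}B\\ I\end{bmatrix}=\begin{bmatrix}\Pi_{11}(s)&\Pi_{12}(s)\\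 \Pi_{21}(s)&\Pi_{22}(s)\end{bmatrix},\qquad \Pi_{11}(s)\in\mathbb C^{k\times k},\ \Pi_{22}(s)\in\mathbb C^{q\times q},$$ there exist $\varepsilon>0$ and $s_0\in j\mathbb R$ such that $$\begin{bmatrix}\Pi_{11}(s)&\varepsilon\Pi_{12}(s)\\ \varepsilon\Pi_{21}(s)&-\Pi_{22}(s)\end{bmatrix}\ge0\quad\text{for all }s\in j\mathbb R,\qquad \Pi_{11}(s_0)>0,\qquad \Pi_{22}(s_0)<0,$$ where the inequalities are meant in the sense of (Hermitian) positive semidefiniteness, positive definiteness and negative definiteness. (b) There exist real matrices $C\in\mathbb R^{k\times n}$, $D_1\in\mathbb R^{k\times k}$, $D_2\in\mathbb R^{k\times q}$ such that $$\sigma(x,v,w)\le|Cx+D_1v+D_2w|^2\qquad\text{for all }x\in\mathbb R^n,\ v\in\mathbb R^k,\ w\in\mathbb R^q,$$ and $$\det\begin{bmatrix}A-sI&B_1\\ C&D_1\end{bmatrix}\ne0\qquad\text{for all }s\in\mathbb C\text{ with }\mathrm{Re}\,s>0.$$ Then $\Delta$ satisfies the complete IQC defined by $A,B_1,B_2,Q,X_0$: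 there is a continuous function $\kappa:\mathbb R^n\times\mathbb R^k\times\mathbb R^q\to\mathbb R$ such that $$\int_0^T\sigma(x(t),v(t),w(t))\,dt\ \ge\ -\kappa(x_0,v(0),w(0))\qquad\text{for all }T\ge0,$$ for all $(v,w)\in\Delta$ and $x_0\in X_0$, where $x$ is the solution corresponding to $v,w,x_0$. -/

import Mathlib

open MeasureTheory Filter Topology
open scoped NNReal ENNReal Matrix ComplexOrder

noncomputable section

namespace CTIQC

/-- `ℝᵐ` with the Euclidean norm. -/
abbrev Vec (m : ℕ) : Type := EuclideanSpace ℝ (Fin m)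

/-- `m`-dimensional signals on the time axis `[0, ∞)`. They are honest functions (not classes
modulo almost everywhere equality), so that their values at time `0` make sense. -/
abbrev Signal (m : ℕ) : Type := ℝ≥0 → Vec m

/-- Lebesgue measure on the time axis `[0, ∞)`. -/
def leb : Measure ℝ≥0 := Measure.comap ((↑) : ℝ≥0 → ℝ) volume

/-- `L_m`: the locally square integrable functions `[0, ∞) → ℝᵐ`. -/
def LLoc (m : ℕ) : Set (Signal m) :=
  {u | ∀ T : ℝ≥0, MemLp u 2 (leb.restrict (Set.Iic T))}

/-- `L²_m`: the square integrable functions `[0, ∞) → ℝᵐ`. -/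
def LTwo (m : ℕ) : Set (Signal m) :=
  {u | MemLp u 2 leb}

/-- A real matrix regarded as a complex one. -/
abbrev toC {ι κ : Type} (M : Matrix ι κ ℝ) : Matrix ι κ ℂ := M.map (fun r : ℝ => (r : ℂ))

/-- The product of a real matrix and a vector. -/
abbrev mv {m p : ℕ} (M : Matrix (Fin p) (Fin m) ℝ) (x : Vec m) : Vec p :=
  WithLp.toLp 2 (M *ᵥ x.ofLp)

/-- `A` is Hurwitz: `sI - A` is not singular for `Re s ≥ 0`. -/
def Hurwitz {n : ℕ} (A : Matrix (Fin n) (Fin n) ℝ) : Prop :=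
  ∀ s : ℂ, 0 ≤ s.re → IsUnit (s • (1 : Matrix (Fin n) (Fin n) ℂ) - toC A)

/-- The quadratic form `σ(x, v, w) = [x; v; w]' Q [x; v; w]`. -/
def quadForm {n k q : ℕ} (Q : Matrix (Fin n ⊕ (Fin k ⊕ Fin q)) (Fin n ⊕ (Fin k ⊕ Fin q)) ℝ)
    (x : Vec n) (v : Vec k) (w : Vec q) : ℝ :=
  Sum.elim x.ofLp (Sum.elim v.ofLp w.ofLp) ⬝ᵥ
    (Q *ᵥ Sum.elim x.ofLp (Sum.elim v.ofLp w.ofLp))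

/-- The column `[(sI - A)⁻¹ B; I]` with `B = [B₁, B₂]`. -/
def freqColumn {n k q : ℕ} (A : Matrix (Fin n) (Fin n) ℝ) (B₁ : Matrix (Fin n) (Fin k) ℝ)
    (B₂ : Matrix (Fin n) (Fin q) ℝ) (s : ℂ) :
    Matrix (Fin n ⊕ (Fin k ⊕ Fin q)) (Fin k ⊕ Fin q) ℂ :=
  Matrix.fromRows
    ((s • (1 : Matrix (Fin n) (Fin n) ℂ) - toC A)⁻¹ * toC (Matrix.fromCols B₁ B₂)) 1

/-- `Π(s) = [(sI - A)⁻¹ B; I]' Q [(sI - A)⁻¹ B; I]` with `B = [B₁, B₂]`; its blocks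
`Π₁₁, Π₁₂, Π₂₁, Π₂₂` are obtained by `Matrix.toBlocks₁₁` and so on. -/
def freqMatrix {n k q : ℕ} (A : Matrix (Fin n) (Fin n) ℝ) (B₁ : Matrix (Fin n) (Fin k) ℝ)
    (B₂ : Matrix (Fin n) (Fin q) ℝ)
    (Q : Matrix (Fin n ⊕ (Fin k ⊕ Fin q)) (Fin n ⊕ (Fin k ⊕ Fin q)) ℝ) (s : ℂ) :
    Matrix (Fin k ⊕ Fin q) (Fin k ⊕ Fin q) ℂ :=
  (freqColumn A B₁ B₂ s)ᴴ * toC Q * freqColumn A B₁ B₂ s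

/-- The minimax frequency condition: for some `ε > 0`, the matrix
`[Π₁₁(s), ε Π₁₂(s); ε Π₂₁(s), -Π₂₂(s)]` is positive semidefinite for all `s` on the imaginary
axis, and `Π₁₁(s₀) > 0`, `Π₂₂(s₀) < 0` at some point `s₀` of the imaginary axis. -/
def MinimaxFrequencyCondition {n k q : ℕ} (A : Matrix (Fin n) (Fin n) ℝ)
    (B₁ : Matrix (Fin n) (Fin k) ℝ) (B₂ : Matrix (Fin n) (Fin q) ℝ)
    (Q : Matrix (Fin n ⊕ (Fin k ⊕ Fin q)) (Fin n ⊕ (Fin k ⊕ Fin q)) ℝ) : Prop :=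
  ∃ ε : ℝ, 0 < ε ∧ ∃ s₀ : ℂ, s₀.re = 0 ∧
    (∀ s : ℂ, s.re = 0 →
      (Matrix.fromBlocks
        (freqMatrix A B₁ B₂ Q s).toBlocks₁₁
        ((ε : ℂ) • (freqMatrix A B₁ B₂ Q s).toBlocks₁₂)
        ((ε : ℂ) • (freqMatrix A B₁ B₂ Q s).toBlocks₂₁)
        (-(freqMatrix A B₁ B₂ Q s).toBlocks₂₂)).PosSemidef) ∧
    (freqMatrix A B₁ B₂ Q s₀).toBlocks₁₁.PosDef ∧
    (-(freqMatrix A B₁ B₂ Q s₀).toBlocks₂₂).PosDef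

/-- `x` is the solution of `ẋ = A x + B₁ v + B₂ w`, `x(0) = x₀`, in the integrated sense. Local
square integrability of `x` makes the right-hand side a genuine integral. -/
def IsTrajectory {n k q : ℕ} (A : Matrix (Fin n) (Fin n) ℝ) (B₁ : Matrix (Fin n) (Fin k) ℝ)
    (B₂ : Matrix (Fin n) (Fin q) ℝ) (x₀ : Vec n) (v : Signal k) (w : Signal q)
    (x : Signal n) : Prop :=
  x ∈ LLoc n ∧
    ∀ t : ℝ≥0, x t = x₀ + ∫ τ in Set.Iic t, (mv A (x τ) + mv B₁ (v τ) + mv B₂ (w τ)) ∂leb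

/-- Weak causal stability of a system `Δ`. -/
def WeaklyCausallyStable {k q : ℕ} (Δ : Set (Signal k × Signal q)) : Prop :=
  ∀ (T : ℝ≥0) (v : Signal k) (w : Signal q) (vs : Signal k),
    (v, w) ∈ Δ → vs ∈ LTwo k → (∀ t ≤ T, v t = vs t) →
    ∃ (vi : ℕ → Signal k) (wi : ℕ → Signal q),
      (∀ i, (vi i, wi i) ∈ Δ ∧ vi i ∈ LTwo k ∧ wi i ∈ LTwo q ∧
        ∀ t ≤ T, vi i t = v t ∧ wi i t = w t) ∧
      Tendsto (fun i => eLpNorm (fun t => vi i t - vs t) 2 leb) atTop (𝓝 0)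

/-- The conditional integral quadratic constraint defined by `A, B₁, B₂, Q, X₀`. -/
def ConditionalIQC {n k q : ℕ} (Δ : Set (Signal k × Signal q))
    (A : Matrix (Fin n) (Fin n) ℝ) (B₁ : Matrix (Fin n) (Fin k) ℝ)
    (B₂ : Matrix (Fin n) (Fin q) ℝ)
    (Q : Matrix (Fin n ⊕ (Fin k ⊕ Fin q)) (Fin n ⊕ (Fin k ⊕ Fin q)) ℝ)
    (X₀ : Set (Vec n)) : Prop :=
  ∃ κ : Vec n × Vec k × Vec q → ℝ, Continuous κ ∧
    ∀ (v : Signal k) (w : Signal q), (v, w) ∈ Δ → v ∈ LTwo k → w ∈ LTwo q →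
    ∀ x₀ ∈ X₀, ∀ x : Signal n, IsTrajectory A B₁ B₂ x₀ v w x →
      -κ (x₀, v 0, w 0) ≤ ∫ t, quadForm Q (x t) (v t) (w t) ∂leb

/-- The complete integral quadratic constraint defined by `A, B₁, B₂, Q, X₀`. -/
def CompleteIQC {n k q : ℕ} (Δ : Set (Signal k × Signal q))
    (A : Matrix (Fin n) (Fin n) ℝ) (B₁ : Matrix (Fin n) (Fin k) ℝ)
    (B₂ : Matrix (Fin n) (Fin q) ℝ)
    (Q : Matrix (Fin n ⊕ (Fin k ⊕ Fin q)) (Fin n ⊕ (Fin k ⊕ Fin q)) ℝ)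
    (X₀ : Set (Vec n)) : Prop :=
  ∃ κ : Vec n × Vec k × Vec q → ℝ, Continuous κ ∧
    ∀ (v : Signal k) (w : Signal q), (v, w) ∈ Δ →
    ∀ x₀ ∈ X₀, ∀ x : Signal n, IsTrajectory A B₁ B₂ x₀ v w x →
    ∀ T : ℝ≥0, -κ (x₀, v 0, w 0) ≤ ∫ t in Set.Iic T, quadForm Q (x t) (v t) (w t) ∂leb

end CTIQC

end

/-! Fix `(v, w)` in `Δ`, a time `T` and `δ > 0`. From the state `x(T)` there is a square integrable
continuation `u` of the first input such that every future first input close to `u` in `L²` keeps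
the future integral of `σ` at most `δ`, whatever the square integrable second input does
(`exists_future`). Weak causal stability, applied to `v` continued by `u`, yields a square
integrable pair in `Δ` that agrees with `(v, w)` up to `T` and whose first component is that close
to the continuation. The conditional IQC for this pair, with its future part bounded by `δ`, is the
complete IQC up to the error `δ`, with the same `κ`.

The existence of `u` is a minimax problem. The future integral is a quadratic functional of the
inputs, convex in `v` and concave in `w` by the frequency condition. For a fixed `w` its infimum
over `v` is at most `0`: the integrand is bounded by `|Cx + D₁v + D₂w|²`, and a system without zeros
in the open right half-plane can approximate any output (`exists_output_approx`). But one `v` has to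
serve all `w`. `quadratic_minimax` exchanges the quantifiers without coercivity, provided that all
cross terms are bounded in the seminorms of the two diagonal forms. For the term in `v` and `w` this
is what `ε > 0` gives. For the linear terms caused by the initial state it is `exists_cross_bound`:
the free response spans a finite-dimensional space invariant under `V*`; the diagonal form dominates
`‖d(V)u‖²` for a scalar polynomial `d` without roots in the open unit disc; `d(V)*` is injective,
hence onto on that space, so the linear term factors through `d(V)u`.

No Fourier transform is needed. The Cayley variable `c = (s - 1)/(s + 1)` becomes an isometry `V` of
`L²(0, ∞)` without eigenvectors, `f ↦ f - 2 lag f`. Transfer functions become polynomials in `V`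
once the determinant of the pencil is cleared, which is invertible at `V` because `A` is Hurwitz.
Matrix inequalities on the unit circle pass to forms in `V` by averaging over approximate
eigenvectors (`tendsto_average_symbol`, `re_sum_nonneg_of_symbol`). -/

namespace CTIQC

/-! ### Polynomials in an isometry without eigenvectors. -/

section Isometry

open Polynomial ContinuousLinearMap

theorem polynomial_root_induction {P : ℂ[X] → Prop} (hC : ∀ a : ℂ, a ≠ 0 → P (C a))
    (hX : ∀ (r : ℂ) (p : ℂ[X]), p ≠ 0 → P p → P ((X - C r) * p)) (d : ℂ[X]) (hd : d ≠ 0) :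
    P d := by
  induction hn : d.natDegree using Nat.strong_induction_on generalizing d with
  | _ m ih =>
    by_cases h0 : d.natDegree = 0
    · obtain ⟨a, rfl⟩ := natDegree_eq_zero.mp h0
      exact hC a (by simpa using hd)
    · obtain ⟨r, hr⟩ := Complex.exists_root (f := d) (natDegree_pos_iff_degree_pos.mp (by omega))
      obtain ⟨p, rfl⟩ := dvd_iff_isRoot.mpr hr
      have hp : p ≠ 0 := right_ne_zero_of_mul hd
      refine hX r p hp (ih _ ?_ p hp rfl)
      rw [← hn, natDegree_mul (X_sub_C_ne_zero r) hp, natDegree_X_sub_C]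
      omega

variable {H : Type*} [NormedAddCommGroup H] [InnerProductSpace ℂ H] [CompleteSpace H]

/-- Expanding the square gives `‖V g - r g‖² = (1 - |r|²)‖g‖² ≤ 0`, so `g` would be an eigenvector
of `V` itself. -/
theorem eq_zero_of_adjoint_eigenvector {V : H →L[ℂ] H} (hV : ∀ f, ‖V f‖ = ‖f‖)
    (hev : ∀ (c : ℂ) f, V f = c • f → f = 0) {r : ℂ} (hr : 1 ≤ ‖r‖) {g : H}
    (hg : adjoint V g = star r • g) : g = 0 := by
  have h1 : inner ℂ (V g) g = star r * (‖g‖ : ℂ) ^ 2 := by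
    rw [← adjoint_inner_right, hg, inner_smul_right, inner_self_eq_norm_sq_to_K]
    rfl
  apply hev r
  rw [← sub_eq_zero, ← norm_eq_zero, ← sq_eq_zero_iff]
  have h2 : ‖V g - r • g‖ ^ 2 = ‖g‖ ^ 2 - ‖r‖ ^ 2 * ‖g‖ ^ 2 := by
    rw [@norm_sub_sq ℂ, hV, inner_smul_right, h1, norm_smul]
    have : r * (star r * (‖g‖ : ℂ) ^ 2) = ((‖r‖ ^ 2 * ‖g‖ ^ 2 : ℝ) : ℂ) := by
      rw [← mul_assoc, Complex.star_def, Complex.mul_conj, Complex.normSq_eq_norm_sq]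
      push_cast; ring
    rw [this]
    simp only [RCLike.re_to_complex, Complex.ofReal_re]
    ring
  have h3 : 1 ≤ ‖r‖ ^ 2 := by nlinarith
  nlinarith [sq_nonneg ‖V g - r • g‖, sq_nonneg ‖g‖]

omit [CompleteSpace H] in
theorem aeval_X_sub_C_mul (V : H →L[ℂ] H) (r : ℂ) (p : ℂ[X]) :
    aeval V ((X - C r) * p) = (V - r • 1) * aeval V p := by
  simp [Algebra.smul_def]

/-- If no root of `d` lies in the open unit disc, then `d(V)*` is injective for an isometry `V`
without eigenvectors. -/
theorem adjoint_aeval_injective {V : H →L[ℂ] H} (hV : ∀ f, ‖V f‖ = ‖f‖)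
    (hev : ∀ (c : ℂ) f, V f = c • f → f = 0) {d : ℂ[X]} (hd : d ≠ 0)
    (hroot : ∀ r, d.IsRoot r → 1 ≤ ‖r‖) {g : H} (hg : adjoint (aeval V d) g = 0) : g = 0 := by
  revert hroot
  suffices (∀ r, d.IsRoot r → 1 ≤ ‖r‖) → ∀ g : H, adjoint (aeval V d) g = 0 → g = 0 from
    fun h => this h g hg
  clear hg g
  refine polynomial_root_induction (P := fun d => (∀ r, d.IsRoot r → 1 ≤ ‖r‖) → ∀ g : H,
    adjoint (aeval V d) g = 0 → g = 0) (fun a ha _ g hg => ?_) (fun r p hp ih hroot g hg => ?_) d hd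
  · rw [aeval_C, Algebra.algebraMap_eq_smul_one, map_smulₛₗ] at hg
    simpa [ha, ← star_eq_adjoint] using hg
  · have hr : 1 ≤ ‖r‖ := hroot r (by simp)
    have hp' := ih fun s hs => hroot s (by simp [IsRoot.def.mp hs])
    rw [aeval_X_sub_C_mul, mul_def, adjoint_comp] at hg
    have h0 := hp' _ hg
    apply eq_zero_of_adjoint_eigenvector hV hev hr
    have h1 : star V g - star r • g = 0 := by
      simpa [← star_eq_adjoint] using h0
    exact sub_eq_zero.mp h1

theorem dense_range_of_adjoint_injective {T : H →L[ℂ] H} (hT : ∀ g, adjoint T g = 0 → g = 0)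
    (y : H) {δ : ℝ} (hδ : 0 < δ) : ∃ x, ‖T x - y‖ < δ := by
  have h1 : (LinearMap.range (T : H →ₗ[ℂ] H))ᗮ = ⊥ := by
    rw [Submodule.eq_bot_iff]
    intro g hg
    apply hT
    refine ext_inner_left ℂ fun x => ?_
    rw [adjoint_inner_right, inner_zero_right]
    exact (Submodule.mem_orthogonal _ _).mp hg _ ⟨x, rfl⟩
  have h2 := (Submodule.topologicalClosure_eq_top_iff).mpr h1
  have h3 : y ∈ closure (Set.range T) := by
    have : y ∈ (LinearMap.range (T : H →ₗ[ℂ] H)).topologicalClosure := h2 ▸ Submodule.mem_top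
    exact this
  obtain ⟨_, ⟨x, rfl⟩, hx⟩ := Metric.mem_closure_iff.mp h3 δ hδ
  exact ⟨x, by rwa [← dist_eq_norm, dist_comm]⟩

/-- Each factor is `V - r = -r (1 - r⁻¹ V)` with `‖r⁻¹ V‖ < 1`, invertible by the Neumann series.
Roots on the circle are excluded here, whereas injectivity of the adjoint tolerates them. -/
theorem isUnit_aeval {V : H →L[ℂ] H} (hV : ∀ f, ‖V f‖ = ‖f‖) {d : ℂ[X]} (hd : d ≠ 0)
    (hroot : ∀ r, d.IsRoot r → 1 < ‖r‖) : IsUnit (aeval V d) := by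
  revert hroot
  refine polynomial_root_induction (P := fun d => (∀ r, d.IsRoot r → 1 < ‖r‖) →
    IsUnit (aeval V d)) (fun a ha _ => ?_) (fun r p hp ih hroot => ?_) d hd
  · rw [aeval_C]
    exact (IsUnit.mk0 a ha).map _
  · rw [aeval_X_sub_C_mul]
    refine IsUnit.mul ?_ (ih fun s hs => hroot s (by simp [IsRoot.def.mp hs]))
    have hr : 1 < ‖r‖ := hroot r (by simp)
    have hVn : ‖V‖ ≤ 1 := opNorm_le_bound _ zero_le_one fun f => by simp [hV]
    have h0 : ‖r⁻¹ • V‖ < 1 := by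
      rw [norm_smul, norm_inv]
      calc ‖r‖⁻¹ * ‖V‖ ≤ ‖r‖⁻¹ * 1 := by gcongr
        _ < 1 := by rw [mul_one]; exact inv_lt_one_of_one_lt₀ hr
    have hr0 : r ≠ 0 := by rintro rfl; simp at hr; linarith
    have h1 : V - r • 1 = (-r) • (1 - r⁻¹ • V) := by
      rw [smul_sub, smul_smul]
      simp [hr0, neg_smul]; abel
    rw [h1]
    exact (isUnit_one_sub_of_norm_lt_one h0).smul (Units.mk0 (-r) (by simpa using hr0))

end Isometry

/-! ### Approximate eigenvectors of an isometry. -/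

section Averaging

open Polynomial ContinuousLinearMap

variable {H : Type*} [NormedAddCommGroup H] [InnerProductSpace ℂ H]

/-- The `j`-th of the `N` complex `N`-th roots of `-1`. -/
noncomputable def negRoot (N j : ℕ) : ℂ :=
  Complex.exp ((((2 * j + 1 : ℝ) * Real.pi / N : ℝ) : ℂ) * Complex.I)

theorem norm_negRoot (N j : ℕ) : ‖negRoot N j‖ = 1 := Complex.norm_exp_ofReal_mul_I _

theorem negRoot_pow {N : ℕ} (hN : N ≠ 0) (j : ℕ) : negRoot N j ^ N = -1 := by
  have hN' : (N : ℂ) ≠ 0 := by exact_mod_cast hN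
  rw [negRoot, ← Complex.exp_nat_mul, ← Complex.exp_pi_mul_I,
    Complex.exp_eq_exp_iff_exists_int]
  refine ⟨j, ?_⟩
  push_cast
  field_simp
  ring

/-- The reason for using roots of `-1`, not of `1`: the point `c = 1` corresponds to `s = ∞`, where
the frequency condition says nothing directly. -/
theorem negRoot_ne_one {N : ℕ} (hN : N ≠ 0) (j : ℕ) : negRoot N j ≠ 1 := by
  intro h
  have := negRoot_pow hN j
  rw [h, one_pow] at this
  norm_num at this

theorem star_mul_self_of_norm_eq_one {c : ℂ} (hc : ‖c‖ = 1) : star c * c = 1 := by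
  rw [Complex.star_def, mul_comm, Complex.mul_conj, Complex.normSq_eq_norm_sq, hc]; simp

theorem sum_negRoot {N : ℕ} (a b : ℕ) (ha : a < N) (hb : b < N) :
    ∑ j ∈ Finset.range N, negRoot N j ^ a * star (negRoot N j) ^ b
        = if a = b then (N : ℂ) else 0 := by
  split_ifs with h
  · subst h
    simp_rw [← mul_pow, mul_comm _ (star _), star_mul_self_of_norm_eq_one (norm_negRoot _ _)]
    simp
  · have hN : (N : ℂ) ≠ 0 := by exact_mod_cast (by omega : N ≠ 0)
    -- The summands form a geometric progression with ratio `ρ`; `ρ ^ N = 1`, and `ρ ≠ 1` because `0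
    -- < |a - b| < N`.
    set ρ : ℂ := Complex.exp (2 * Real.pi * Complex.I * (((a - b : ℤ) : ℂ) / N)) with hρ
    have key : ∀ j, negRoot N j ^ a * star (negRoot N j) ^ b
        = (negRoot N 0 ^ a * star (negRoot N 0) ^ b) * ρ ^ j := by
      intro j
      rw [hρ]
      unfold negRoot
      rw [Complex.star_def, ← Complex.exp_conj, ← Complex.exp_conj]
      repeat rw [← Complex.exp_nat_mul]
      repeat rw [← Complex.exp_add]
      congr 1
      simp only [map_mul, Complex.conj_ofReal, Complex.conj_I]
      push_cast
      simp only [div_eq_mul_inv]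
      ring
    rw [Finset.sum_congr rfl fun j _ => key j, ← Finset.mul_sum]
    have h1 : ρ ≠ 1 := by
      rw [hρ, Ne, Complex.exp_eq_one_iff]
      rintro ⟨m, hm⟩
      have h2 : (((a - b : ℤ) : ℂ) / N) = m := by
        have : (2 * Real.pi * Complex.I : ℂ) ≠ 0 := Complex.two_pi_I_ne_zero
        exact mul_left_cancel₀ this (by rw [hm]; ring)
      rw [div_eq_iff hN] at h2
      have h3 : (a - b : ℤ) = m * N := by exact_mod_cast h2
      have h4 : |(a - b : ℤ)| < N := by rw [abs_lt]; omega
      have h5 : m = 0 := by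
        by_contra hm0
        have : 1 ≤ |m| := Int.one_le_abs hm0
        rw [h3, abs_mul, Nat.abs_cast] at h4
        nlinarith
      rw [h5] at h3
      omega
    have h2 : ρ ^ N = 1 := by
      rw [hρ, ← Complex.exp_nat_mul, Complex.exp_eq_one_iff]
      exact ⟨a - b, by push_cast; field_simp⟩
    rw [geom_sum_eq h1, h2]
    simp

/-- A truncated eigenvector expansion: `modulate V N c f` is nearly an eigenvector of `V` with
eigenvalue `c` when `V` is an isometry, `|c| = 1` and `N` is large. -/
noncomputable def modulate (V : H →L[ℂ] H) (N : ℕ) (c : ℂ) : H →L[ℂ] H :=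
  ∑ m ∈ Finset.range N, star c ^ m • V ^ m

theorem inner_pow_isometry {V : H →L[ℂ] H} (hV : ∀ f g, inner ℂ (V f) (V g) = inner ℂ f g)
    (m : ℕ) (f g : H) : inner ℂ ((V ^ m) f) ((V ^ m) g) = inner ℂ f g := by
  induction m generalizing f g with
  | zero => simp
  | succ m ih => rw [pow_succ, mul_apply_eq_comp, mul_apply_eq_comp, ih, hV]

/-- A discrete Parseval identity: orthogonality of the characters kills the terms `⟨V^a f, V^b g⟩`
with `a ≠ b`, and each of the `N` diagonal ones equals `⟨f, g⟩`. -/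
theorem sum_inner_modulate {V : H →L[ℂ] H} (hV : ∀ f g, inner ℂ (V f) (V g) = inner ℂ f g)
    (N : ℕ) (f g : H) :
    ∑ j ∈ Finset.range N, inner ℂ (modulate V N (negRoot N j) f) (modulate V N (negRoot N j) g)
      = (N : ℂ) ^ 2 * inner ℂ f g := by
  have h1 : ∀ j, inner ℂ (modulate V N (negRoot N j) f) (modulate V N (negRoot N j) g)
      = ∑ a ∈ Finset.range N, ∑ b ∈ Finset.range N,
        (negRoot N j ^ a * star (negRoot N j) ^ b) * inner ℂ ((V ^ a) f) ((V ^ b) g) := by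
    intro j
    simp only [modulate, sum_apply, smul_apply, sum_inner, inner_sum, inner_smul_left,
      inner_smul_right, map_pow, Complex.star_def, Complex.conj_conj]
    simp_rw [Finset.mul_sum]
    rw [Finset.sum_comm]
    refine Finset.sum_congr rfl fun a _ => Finset.sum_congr rfl fun b _ => by ring
  simp_rw [h1]
  rw [Finset.sum_comm]
  have h2 : ∀ a ∈ Finset.range N, ∑ j ∈ Finset.range N, ∑ b ∈ Finset.range N,
      (negRoot N j ^ a * star (negRoot N j) ^ b) * inner ℂ ((V ^ a) f) ((V ^ b) g)
      = N * inner ℂ f g := by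
    intro a ha
    rw [Finset.sum_comm]
    have h3 : ∀ b ∈ Finset.range N, ∑ j ∈ Finset.range N,
        (negRoot N j ^ a * star (negRoot N j) ^ b) * inner ℂ ((V ^ a) f) ((V ^ b) g)
        = if a = b then N * inner ℂ f g else 0 := by
      intro b hb
      rw [← Finset.sum_mul, sum_negRoot a b (by simpa using ha) (by simpa using hb)]
      split_ifs with h
      · rw [h, inner_pow_isometry hV]
      · simp
    rw [Finset.sum_congr rfl h3, Finset.sum_ite_eq, if_pos ha]
  rw [Finset.sum_congr rfl h2]
  simp; ring

theorem modulate_commute (V : H →L[ℂ] H) (N : ℕ) (c : ℂ) (p : ℂ[X]) (f : H) :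
    modulate V N c (aeval V p f) = aeval V p (modulate V N c f) := by
  have h : Commute (modulate V N c) (aeval V p) := by
    refine Commute.sum_left _ _ _ fun m _ => Commute.smul_left ?_ _
    rw [← aeval_X_pow (R := ℂ) V, Commute, SemiconjBy, ← map_mul, mul_comm, map_mul]
  exact DFunLike.congr_fun h.eq f

/-- The sum telescopes to two boundary terms. The bound does not grow with `N`, while the vectors
`modulate V N c f` have size `√N ‖f‖` in quadratic mean over the roots `c`. -/
theorem norm_map_modulate_sub {V : H →L[ℂ] H} (hV : ∀ f, ‖V f‖ = ‖f‖) (N : ℕ) {c : ℂ}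
    (hc : ‖c‖ = 1) (f : H) :
    ‖V (modulate V N c f) - c • modulate V N c f‖ ≤ 2 * ‖f‖ := by
  have hcc := star_mul_self_of_norm_eq_one hc
  have h1 : V (modulate V N c f) - c • modulate V N c f
      = c • (star c ^ N • (V ^ N) f - f) := by
    have := Finset.sum_range_sub (fun m => star c ^ m • (V ^ m) f) N
    simp only [pow_zero, one_smul, one_apply_eq_self] at this
    rw [← this, modulate, sum_apply, map_sum, Finset.smul_sum, Finset.smul_sum,
      ← Finset.sum_sub_distrib]
    refine Finset.sum_congr rfl fun m _ => ?_
    rw [smul_sub, smul_apply, map_smul, smul_smul c, pow_succ (star c), smul_smul c,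
      mul_left_comm, mul_comm c (star c), hcc, mul_one, pow_succ', mul_apply_eq_comp]
  have h2 : ∀ m, ‖(V ^ m) f‖ = ‖f‖ := by
    intro m
    induction m with
    | zero => simp
    | succ m ih => rw [pow_succ', mul_apply_eq_comp, hV, ih]
  rw [h1, norm_smul, hc, one_mul]
  refine (norm_sub_le _ _).trans ?_
  rw [norm_smul, norm_pow, norm_star, hc, one_pow, h2]
  linarith

theorem norm_aeval_modulate_sub {V : H →L[ℂ] H} (hV : ∀ f, ‖V f‖ = ‖f‖) (p : ℂ[X]) :
    ∃ K, 0 ≤ K ∧ ∀ (N : ℕ) (c : ℂ) (f : H), ‖c‖ = 1 →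
      ‖aeval V p (modulate V N c f) - p.eval c • modulate V N c f‖ ≤ K * ‖f‖ := by
  induction p using Polynomial.induction_on' with
  | add p q hp hq =>
    obtain ⟨K, hK, h⟩ := hp
    obtain ⟨L, hL, h'⟩ := hq
    refine ⟨K + L, by positivity, fun N c f hc => ?_⟩
    rw [map_add, add_apply, eval_add, add_smul, add_sub_add_comm, add_mul]
    exact (norm_add_le _ _).trans (add_le_add (h N c f hc) (h' N c f hc))
  | monomial n a =>
    induction n with
    | zero => exact ⟨0, le_rfl, fun N c f _ => by simp [Algebra.algebraMap_eq_smul_one]⟩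
    | succ n ih =>
      obtain ⟨K, hK, h⟩ := ih
      refine ⟨K + ‖a‖ * 2, by positivity, fun N c f hc => ?_⟩
      have e1 : aeval V (monomial (n + 1) a) (modulate V N c f) -
          (monomial (n + 1) a).eval c • modulate V N c f
          = V (aeval V (monomial n a) (modulate V N c f) - (monomial n a).eval c •
            modulate V N c f) + (a * c ^ n) • (V (modulate V N c f) - c • modulate V N c f) := by
        simp only [aeval_monomial, eval_monomial, mul_apply_eq_comp, pow_succ', map_sub, map_smul,
          Algebra.algebraMap_eq_smul_one, smul_apply, one_apply_eq_self, smul_sub, smul_smul]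
        rw [show a * (c * c ^ n) = a * c ^ n * c by ring]
        abel
      rw [e1, add_mul]
      refine (norm_add_le _ _).trans (add_le_add ?_ ?_)
      · rw [hV]; exact h N c f hc
      · rw [norm_smul, norm_mul, norm_pow, hc, one_pow, mul_one, mul_assoc]
        gcongr
        exact norm_map_modulate_sub hV N hc f

end Averaging

/-! ### Laurent polynomials and determinants on the unit circle. -/

section Circle

open Polynomial

/-- Functions that agree on the unit circle with a Laurent polynomial. -/
def laurentOnCircle : Subalgebra ℂ (ℂ → ℂ) where
  carrier := {f | ∃ (L : ℕ) (p : ℂ[X]), ∀ c : ℂ, ‖c‖ = 1 → c ^ L * f c = p.eval c}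
  mul_mem' := by
    rintro f g ⟨L, p, hp⟩ ⟨M, q, hq⟩
    refine ⟨L + M, p * q, fun c hc => ?_⟩
    rw [eval_mul, ← hp c hc, ← hq c hc, Pi.mul_apply]; ring
  add_mem' := by
    rintro f g ⟨L, p, hp⟩ ⟨M, q, hq⟩
    refine ⟨L + M, X ^ M * p + X ^ L * q, fun c hc => ?_⟩
    simp only [eval_add, eval_mul, eval_pow, eval_X, ← hp c hc, ← hq c hc, Pi.add_apply]; ring
  algebraMap_mem' a := ⟨0, C a, fun c _ => by simp⟩

theorem eval_mem_laurentOnCircle (p : ℂ[X]) : (fun c => p.eval c) ∈ laurentOnCircle :=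
    ⟨0, p, fun c _ => by simp⟩

theorem conj_mem_laurentOnCircle : (fun c => star c) ∈ laurentOnCircle := ⟨1, 1, fun c hc => by
  rw [pow_one, Complex.star_def, Complex.mul_conj, Complex.normSq_eq_norm_sq, hc]; simp⟩

theorem conj_eval_mem_laurentOnCircle (p : ℂ[X]) :
    (fun c => star (p.eval c)) ∈ laurentOnCircle := by
  induction p using Polynomial.induction_on' with
  | add p q hp hq =>
    convert add_mem hp hq using 1
    ext c; simp
  | monomial n a =>
    convert mul_mem (laurentOnCircle.algebraMap_mem (star a))
        (pow_mem conj_mem_laurentOnCircle n) using 1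
    ext c; simp

theorem det_mem_laurentOnCircle {m : Type*} [Fintype m] [DecidableEq m] (F : ℂ → Matrix m m ℂ)
    (hF : ∀ i j, (fun c => F c i j) ∈ laurentOnCircle) :
        (fun c => (F c).det) ∈ laurentOnCircle := by
  have : (fun c => (F c).det) =
      ∑ σ : Equiv.Perm m, (Equiv.Perm.sign σ : ℤ) • ∏ i, (fun c => F c (σ i) i) := by
    ext c
    simp [Matrix.det_apply, Finset.sum_apply, Finset.prod_apply, Units.smul_def]
  rw [this]
  exact sum_mem fun σ _ => zsmul_mem (prod_mem fun i _ => hF _ _) _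

open Matrix in
-- All eigenvalues are at most the trace, so the determinant is at most a power of `t` times any one
-- of them; `1 ≤ t` allows the crude exponent. This bounds the least eigenvalue below by the
-- determinant, which, unlike the eigenvalue, is a Laurent polynomial on the circle.
theorem posSemidef_pow_smul_sub_det {m : Type*} [Fintype m] [DecidableEq m] {M : Matrix m m ℂ}
    (hM : M.PosSemidef)
    {t : ℝ} (ht : 1 ≤ t) (htr : M.trace.re ≤ t) :
    (((t ^ (Fintype.card m) : ℝ) : ℂ) • M - M.det • (1 : Matrix m m ℂ)).PosSemidef := by
  have h0 := hM.eigenvalues_nonneg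
  have h1 : ∀ i, hM.1.eigenvalues i ≤ t := by
    intro i
    refine le_trans ?_ htr
    rw [hM.1.trace_eq_sum_eigenvalues, Complex.re_sum]
    exact Finset.single_le_sum (f := fun i => hM.1.eigenvalues i) (fun i _ => h0 i)
        (Finset.mem_univ i)
  have h2 : ∀ i, ∏ j, hM.1.eigenvalues j ≤ t ^ (Fintype.card m) * hM.1.eigenvalues i := by
    intro i
    rw [← Finset.mul_prod_erase _ _ (Finset.mem_univ i), mul_comm]
    refine mul_le_mul_of_nonneg_right ?_ (h0 i)
    calc _ ≤ ∏ j ∈ Finset.univ.erase i, t := Finset.prod_le_prod (fun j _ => h0 j) fun j _ => h1 j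
      _ = t ^ (Finset.univ.erase i).card := by simp
      _ ≤ _ := pow_le_pow_right₀ ht (Finset.card_le_univ _)
  set D := hM.1.eigenvalues with hD
  have h3 := hM.1.spectral_theorem
  rw [Unitary.conjStarAlgAut_apply] at h3
  set U : Matrix m m ℂ := ↑hM.1.eigenvectorUnitary with hU
  have hUU : U * star U = 1 := Unitary.coe_mul_star_self _
  have h4 : ((t ^ (Fintype.card m) : ℝ) : ℂ) • M - M.det • (1 : Matrix m m ℂ)
    = U * Matrix.diagonal (fun i => ((t ^ (Fintype.card m) * D i - ∏ j, D j : ℝ) : ℂ))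
        * star U := by
    have : Matrix.diagonal (fun i => ((t ^ (Fintype.card m) * D i - ∏ j, D j : ℝ) : ℂ)) =
      ((t ^ (Fintype.card m) : ℝ) : ℂ) • diagonal (RCLike.ofReal ∘ D) - M.det • 1 := by
      ext i j
      rw [hM.1.det_eq_prod_eigenvalues]
      by_cases hij : i = j
      · subst hij; simp [hD]
      · simp [hij]
    rw [this, mul_sub, sub_mul, Matrix.mul_smul, Matrix.smul_mul, Matrix.mul_smul,
        Matrix.smul_mul, mul_one, hUU]
    congr 2
  rw [h4]
  refine PosSemidef.mul_mul_conjTranspose_same (PosSemidef.diagonal fun i => ?_) U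
  exact Complex.zero_le_real.mpr (by linarith [h2 i])

/-- A root `r` in the open disc may simply be dropped, since `|c - r| ≥ 1 - |r| > 0` on the circle;
the other roots are kept. -/
theorem exists_polynomial_dominated (p : ℂ[X]) (hp : p ≠ 0) :
    ∃ d : ℂ[X], d ≠ 0 ∧ (∀ r, d.IsRoot r → 1 ≤ ‖r‖) ∧
      ∃ K : ℝ, 0 ≤ K ∧ ∀ c : ℂ, ‖c‖ = 1 → ‖d.eval c‖ ≤ K * ‖p.eval c‖ := by
  induction hn : p.natDegree using Nat.strong_induction_on generalizing p with
  | _ m ih =>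
    by_cases h0 : p.natDegree = 0
    · refine ⟨p, hp, fun r hr => ?_, 1, by simp, by simp⟩
      obtain ⟨a, rfl⟩ := natDegree_eq_zero.mp h0
      simp at hr hp; contradiction
    · obtain ⟨r, hr⟩ := Complex.exists_root (f := p) (natDegree_pos_iff_degree_pos.mp (by omega))
      obtain ⟨q, rfl⟩ := dvd_iff_isRoot.mpr hr
      have hq : q ≠ 0 := right_ne_zero_of_mul hp
      obtain ⟨d, hd, hroot, K, hK, h⟩ := ih q.natDegree (by
        rw [← hn, natDegree_mul (X_sub_C_ne_zero r) hq, natDegree_X_sub_C]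
        omega) q hq rfl
      by_cases h1 : 1 ≤ ‖r‖
      · refine ⟨(X - C r) * d, mul_ne_zero (X_sub_C_ne_zero r) hd, fun s hs => ?_, K, hK,
          fun c hc => ?_⟩
        · rcases root_mul.mp hs with h | h
          · rw [root_X_sub_C] at h; rwa [← h]
          · exact hroot s h
        · rw [eval_mul, eval_mul, norm_mul, norm_mul, mul_left_comm]
          exact mul_le_mul_of_nonneg_left (h c hc) (norm_nonneg _)
      · push Not at h1
        refine ⟨d, hd, hroot, K / (1 - ‖r‖), div_nonneg hK (by linarith), fun c hc => ?_⟩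
        refine (h c hc).trans ?_
        have h2 : 1 - ‖r‖ ≤ ‖c - r‖ := by
          rw [← hc]; exact norm_sub_norm_le c r
        rw [eval_mul, norm_mul, eval_sub, eval_X, eval_C, div_mul_eq_mul_div,
            le_div_iff₀ (by linarith),
          mul_assoc, mul_comm ‖eval c q‖]
        gcongr

end Circle

/-! ### From symbols on the circle to quadratic forms in the isometry. -/

section Averaging
open Polynomial ContinuousLinearMap
variable {H : Type*} [NormedAddCommGroup H] [InnerProductSpace ℂ H]

theorem sum_norm_modulate_le {V : H →L[ℂ] H} (hV : ∀ f g, inner ℂ (V f) (V g) = inner ℂ f g)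
    (N : ℕ) (f : H) :
    ∑ j ∈ Finset.range N, ‖modulate V N (negRoot N j) f‖ ≤ N * √N * ‖f‖ := by
  have h1 : ∑ j ∈ Finset.range N, ‖modulate V N (negRoot N j) f‖ ^ 2 = N ^ 2 * ‖f‖ ^ 2 := by
    have := sum_inner_modulate hV N f f
    simp only [inner_self_eq_norm_sq_to_K, Complex.coe_algebraMap] at this
    exact_mod_cast this
  refine (pow_le_pow_iff_left₀ (Finset.sum_nonneg fun _ _ => norm_nonneg _) (by positivity)
    two_ne_zero).mp ?_
  refine sq_sum_le_card_mul_sum_sq.trans ?_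
  rw [h1, mul_pow, mul_pow, Real.sq_sqrt (by positivity), Finset.card_range]
  apply le_of_eq; ring

/-- The average of `conj α(c) β(c) ⟨f_c, g_c⟩` over the `N`-th roots of `-1` tends to
`⟨α(V) f, β(V) g⟩`. -/
theorem tendsto_average_symbol {V : H →L[ℂ] H}
    (hV : ∀ f g, inner ℂ (V f) (V g) = inner ℂ f g) (α β : ℂ[X]) (f g : H) :
    Tendsto (fun N : ℕ => ((N : ℂ) ^ 2)⁻¹ * ∑ j ∈ Finset.range N,
      star (α.eval (negRoot N j)) * β.eval (negRoot N j) *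
        inner ℂ (modulate V N (negRoot N j) f) (modulate V N (negRoot N j) g)) atTop
      (𝓝 (inner ℂ (aeval V α f) (aeval V β g))) := by
  have hVn : ∀ f, ‖V f‖ = ‖f‖ := fun f => by
    rw [@norm_eq_sqrt_re_inner ℂ, @norm_eq_sqrt_re_inner ℂ, hV]
  obtain ⟨Kα, hKα, hα⟩ := norm_aeval_modulate_sub hVn α
  obtain ⟨Kβ, hKβ, hβ⟩ := norm_aeval_modulate_sub hVn β
  obtain ⟨a, ha⟩ := (isCompact_sphere (0 : ℂ) 1).exists_bound_of_continuousOn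
    (f := fun c => α.eval c) (by fun_prop)
  have ha0 : 0 ≤ a := (norm_nonneg _).trans (ha 1 (by simp))
  set b := ‖aeval V β‖
  rw [tendsto_iff_norm_sub_tendsto_zero]
  -- The error per root is bounded by a constant times the norms of the modulated vectors. Their sum
  -- is `O(N √N)`, against the normalization `N²`.
  have hlim : Tendsto (fun N : ℕ => (Kα * b + a * Kβ) * ‖f‖ * ‖g‖ * (√N)⁻¹) atTop (𝓝 0) := by
    have : Tendsto (fun N : ℕ => (√(N : ℝ))⁻¹) atTop (𝓝 0) :=
      tendsto_inv_atTop_zero.comp (Real.tendsto_sqrt_atTop.comp tendsto_natCast_atTop_atTop)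
    simpa using this.const_mul ((Kα * b + a * Kβ) * ‖f‖ * ‖g‖)
  refine squeeze_zero' (Eventually.of_forall fun _ => norm_nonneg _) ?_ hlim
  filter_upwards [eventually_ge_atTop 1] with N hN
  have hN0 : (N : ℂ) ^ 2 ≠ 0 := by
    have : (N : ℂ) ≠ 0 := by exact_mod_cast (by omega : N ≠ 0)
    positivity
  have hN1 : (0 : ℝ) < N := by exact_mod_cast hN
  have h1 : inner ℂ (aeval V α f) (aeval V β g) = ((N : ℂ) ^ 2)⁻¹ * ∑ j ∈ Finset.range N,
      inner ℂ (aeval V α (modulate V N (negRoot N j) f))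
        (aeval V β (modulate V N (negRoot N j) g)) := by
    simp_rw [← modulate_commute]
    rw [sum_inner_modulate hV, inv_mul_cancel_left₀ hN0]
  rw [h1, ← mul_sub, ← Finset.sum_sub_distrib, norm_mul]
  have h2 : ∀ j ∈ Finset.range N, ‖star (α.eval (negRoot N j)) * β.eval (negRoot N j) *
        inner ℂ (modulate V N (negRoot N j) f) (modulate V N (negRoot N j) g) -
      inner ℂ (aeval V α (modulate V N (negRoot N j) f))
        (aeval V β (modulate V N (negRoot N j) g))‖ ≤
      Kα * ‖f‖ * b * ‖modulate V N (negRoot N j) g‖ +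
        a * Kβ * ‖g‖ * ‖modulate V N (negRoot N j) f‖ := by
    intro j _
    set c := negRoot N j
    have hc : ‖c‖ = 1 := norm_negRoot N j
    set F := modulate V N c f
    set G := modulate V N c g
    have e1 : star (α.eval c) * β.eval c * inner ℂ F G - inner ℂ (aeval V α F) (aeval V β G)
        = - inner ℂ (aeval V α F - α.eval c • F) (aeval V β G)
          - star (α.eval c) * inner ℂ F (aeval V β G - β.eval c • G) := by
      simp only [inner_sub_left, inner_sub_right, inner_smul_left, inner_smul_right,
        Complex.star_def]
      ring
    rw [e1]
    refine (norm_sub_le _ _).trans (add_le_add ?_ ?_)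
    · rw [norm_neg]
      refine (norm_inner_le_norm _ _).trans ?_
      rw [mul_assoc]
      exact mul_le_mul (hα N c f hc) (le_opNorm _ _) (norm_nonneg _) (by positivity)
    · rw [norm_mul, norm_star]
      have h3 := (norm_inner_le_norm (𝕜 := ℂ) F (aeval V β G - β.eval c • G)).trans
        (mul_le_mul_of_nonneg_left (hβ N c g hc) (norm_nonneg F))
      calc _ ≤ a * (‖F‖ * (Kβ * ‖g‖)) :=
            mul_le_mul (ha c (by simpa using hc)) h3 (norm_nonneg _) ha0
        _ = _ := by ring
  have h3 := (norm_sum_le _ _).trans (Finset.sum_le_sum h2)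
  rw [Finset.sum_add_distrib, ← Finset.mul_sum, ← Finset.mul_sum] at h3
  have h4 := sum_norm_modulate_le hV N f
  have h5 := sum_norm_modulate_le hV N g
  have hs : (0 : ℝ) < √N := Real.sqrt_pos.mpr hN1
  rw [norm_inv, norm_pow, Complex.norm_natCast, inv_mul_le_iff₀ (by positivity)]
  refine h3.trans ?_
  have h6 : (N : ℝ) ^ 2 * ((Kα * b + a * Kβ) * ‖f‖ * ‖g‖ * (√N)⁻¹)
      = Kα * ‖f‖ * b * (N * √N * ‖g‖) + a * Kβ * ‖g‖ * (N * √N * ‖f‖) := by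
    have : (N : ℝ) = √N * √N := (Real.mul_self_sqrt hN1.le).symm
    field_simp
    rw [show √(N:ℝ) ^ 2 = N from Real.sq_sqrt hN1.le]
    ring
  rw [h6]
  gcongr

open Matrix in
-- With `M = Bᴴ B` the double sum becomes a sum of squared norms in `H`.
theorem posSemidef_sum_inner_nonneg {m : Type*} [Fintype m] {M : Matrix m m ℂ}
    (hM : M.PosSemidef) (f : m → H) : 0 ≤ (∑ i, ∑ j, M i j * inner ℂ (f i) (f j)).re := by
  classical
  obtain ⟨B, rfl⟩ : ∃ B : Matrix m m ℂ, M = Bᴴ * B := by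
    open scoped MatrixOrder in
    exact CStarAlgebra.nonneg_iff_eq_star_mul_self.mp hM.nonneg
  have h1 : ∑ i, ∑ j, (Bᴴ * B) i j * inner ℂ (f i) (f j)
      = ∑ l, inner ℂ (∑ i, B l i • f i) (∑ j, B l j • f j) := by
    simp only [Matrix.mul_apply, conjTranspose_apply, sum_inner, inner_sum, inner_smul_left,
      inner_smul_right, Finset.sum_mul, Finset.mul_sum, Complex.star_def]
    rw [Finset.sum_congr rfl fun i _ => Finset.sum_comm, Finset.sum_comm]
    refine Finset.sum_congr rfl fun l _ => ?_
    rw [Finset.sum_comm]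
    refine Finset.sum_congr rfl fun i _ => Finset.sum_congr rfl fun j _ => by ring
  rw [h1, Complex.re_sum]
  exact Finset.sum_nonneg fun l _ => inner_self_nonneg (𝕜 := ℂ)

/-- If the matrix `Ψ(c)` is positive semidefinite on the unit circle (away from `1`), then so is
the form that it is the symbol of. -/
theorem re_sum_nonneg_of_symbol {V : H →L[ℂ] H} {m : Type*} [Fintype m]
    {Ψ : ℂ → Matrix m m ℂ} (hΨ : ∀ c, ‖c‖ = 1 → c ≠ 1 → (Ψ c).PosSemidef) (f : m → H)
    {θ : m → m → ℂ}
    (hθ : ∀ i j, Tendsto (fun N : ℕ => ((N : ℂ) ^ 2)⁻¹ * ∑ l ∈ Finset.range N,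
      Ψ (negRoot N l) i j * inner ℂ (modulate V N (negRoot N l) (f i))
        (modulate V N (negRoot N l) (f j))) atTop (𝓝 (θ i j))) :
    0 ≤ (∑ i, ∑ j, θ i j).re := by
  have h1 := tendsto_finsetSum Finset.univ fun i _ =>
    tendsto_finsetSum Finset.univ fun j _ => hθ i j
  have h2 := (Complex.continuous_re.tendsto _).comp h1
  refine ge_of_tendsto h2 ?_
  filter_upwards [eventually_ge_atTop 1] with N hN
  have h3 : ∑ i, ∑ j, ((N : ℂ) ^ 2)⁻¹ * ∑ l ∈ Finset.range N,
      Ψ (negRoot N l) i j * inner ℂ (modulate V N (negRoot N l) (f i))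
        (modulate V N (negRoot N l) (f j))
      = (((N : ℝ) ^ 2)⁻¹ : ℝ) * ∑ l ∈ Finset.range N, ∑ i, ∑ j, 
      Ψ (negRoot N l) i j * inner ℂ (modulate V N (negRoot N l) (f i))
        (modulate V N (negRoot N l) (f j)) := by
    simp_rw [← Finset.mul_sum]
    push_cast
    congr 1
    rw [Finset.sum_congr rfl fun i _ => Finset.sum_comm, Finset.sum_comm]
  rw [Function.comp_apply, h3, Complex.re_ofReal_mul, Complex.re_sum]
  refine mul_nonneg (by positivity) (Finset.sum_nonneg fun l _ => ?_)
  exact posSemidef_sum_inner_nonneg (hΨ _ (norm_negRoot N l) (negRoot_ne_one (by omega) l)) _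

end Averaging

/-! ### A minimax theorem for quadratic functionals without coercivity. -/

section Minimax

universe u

/-- A positive semidefinite bilinear form is the pullback of the inner product of a Hilbert
space along a linear map with dense range. -/
theorem exists_hilbert_of_psd {U : Type u} [AddCommGroup U] [Module ℝ U]
    (p : U →ₗ[ℝ] U →ₗ[ℝ] ℝ) (hsymm : ∀ u v, p u v = p v u) (hpos : ∀ u, 0 ≤ p u u) :
    ∃ (E : Type u) (_ : NormedAddCommGroup E) (_ : InnerProductSpace ℝ E) (_ : CompleteSpace E)
      (i : U →ₗ[ℝ] E), DenseRange i ∧ ∀ u v, inner ℝ (i u) (i v) = p u v := by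
  let core : PreInnerProductSpace.Core ℝ U :=
    { inner := fun u v => p u v
      conj_inner_symm := fun u v => by simpa using hsymm v u
      re_inner_nonneg := fun u => by simpa using hpos u
      add_left := fun u v w => by simp
      smul_left := fun u v r => by simp }
  let _ : SeminormedAddCommGroup U :=
    @InnerProductSpace.Core.toSeminormedAddCommGroup ℝ U _ _ _ core
  let _ : InnerProductSpace ℝ U := InnerProductSpace.ofCore core
  refine ⟨UniformSpace.Completion U, inferInstance, inferInstance, inferInstance,
    (UniformSpace.Completion.toComplL (𝕜 := ℝ) (E := U)).toLinearMap, ?_, fun u v => ?_⟩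
  · exact UniformSpace.Completion.denseRange_coe
  · exact UniformSpace.Completion.inner_coe u v

/-- A functional bounded by `‖i w‖` extends from the dense range of `i` to the Hilbert space, where
the Riesz theorem applies. In the minimax proof it replaces cross terms by vectors. -/
theorem exists_riesz {W F : Type*} [AddCommGroup W] [Module ℝ W] [NormedAddCommGroup F]
    [InnerProductSpace ℝ F] [CompleteSpace F] {i : W →ₗ[ℝ] F} (hi : DenseRange i)
    (f : W →ₗ[ℝ] ℝ) {K : ℝ} (hK : 0 ≤ K) (hf : ∀ w, |f w| ≤ K * ‖i w‖) :
    ∃ y : F, ‖y‖ ≤ K ∧ ∀ w, inner ℝ y (i w) = f w := by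
  have hb : ∀ w, ‖f w‖ ≤ K * ‖i w‖ := hf
  refine ⟨(InnerProductSpace.toDual ℝ F).symm (f.extendOfNorm i), ?_, fun w => ?_⟩
  · rw [LinearIsometryEquiv.norm_map]
    exact ContinuousLinearMap.opNorm_le_bound _ hK
      (LinearMap.norm_extendOfNorm_apply_le hi K hb)
  · rw [InnerProductSpace.toDual_symm_apply, LinearMap.extendOfNorm_eq hi ⟨K, hb⟩]

set_option maxHeartbeats 1000000 in
/-- Let `J(u, w) = p(u) + 2 b(u, w) - r(w) + 2 l₁(u) + 2 l₂(w) + c` where all the cross terms are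
bounded with respect to the seminorms `p` and `r`. If `inf_u J(u, w) ≤ 0` for all `w`, then
`sup_w J(u, w)` is as small as one likes on some ball of `u`. -/
theorem quadratic_minimax {U W : Type*} [SeminormedAddCommGroup U] [NormedSpace ℝ U]
    [AddCommGroup W] [Module ℝ W] (p : U →ₗ[ℝ] U →ₗ[ℝ] ℝ) (r : W →ₗ[ℝ] W →ₗ[ℝ] ℝ)
    (b : U →ₗ[ℝ] W →ₗ[ℝ] ℝ) (l₁ : U →ₗ[ℝ] ℝ) (l₂ : W →ₗ[ℝ] ℝ) (c : ℝ) {K : ℝ} (hK : 0 ≤ K)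
    (hpsymm : ∀ u v, p u v = p v u) (hppos : ∀ u, 0 ≤ p u u)
    (hrsymm : ∀ u v, r u v = r v u) (hrpos : ∀ u, 0 ≤ r u u)
    (hpK : ∀ u, p u u ≤ K * ‖u‖ ^ 2)
    (hb : ∀ u w, |b u w| ≤ K * √(p u u) * √(r w w))
    (hl₁ : ∀ u, |l₁ u| ≤ K * √(p u u)) (hl₂ : ∀ w, |l₂ w| ≤ K * √(r w w))
    (hinf : ∀ w, ∀ δ > 0, ∃ u, p u u + 2 * b u w - r w w + 2 * l₁ u + 2 * l₂ w + c ≤ δ)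
    {δ : ℝ} (hδ : 0 < δ) :
    ∃ (u : U) (ρ : ℝ), 0 < ρ ∧ ∀ u', ‖u' - u‖ ≤ ρ →
      ∀ w, p u' u' + 2 * b u' w - r w w + 2 * l₁ u' + 2 * l₂ w + c ≤ δ := by
  obtain ⟨F, _, _, _, j, hj, hjr⟩ := exists_hilbert_of_psd r hrsymm hrpos
  have hjn : ∀ w, ‖j w‖ = √(r w w) := fun w => by
    rw [norm_eq_sqrt_real_inner, hjr]
  have hB : ∀ u, ∃ y : F, ‖y‖ ≤ K * √(p u u) ∧ ∀ w, inner ℝ y (j w) = b u w := fun u =>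
    exists_riesz hj (b u) (by positivity) fun w => by rw [hjn]; exact hb u w
  choose B₀ hB₀ hB₁ using hB
  have hext : ∀ y y' : F, (∀ w, inner ℝ y (j w) = inner ℝ y' (j w)) → y = y' := by
    intro y y' h
    refine hj.eq_of_inner_left (𝕜 := ℝ) ?_
    exact h
  let B : U →ₗ[ℝ] F :=
    { toFun := B₀
      map_add' := fun u v => hext _ _ fun w => by simp [inner_add_left, hB₁]
      map_smul' := fun a u => hext _ _ fun w => by simp [inner_smul_left, hB₁] }
  have hBn : ∀ u, ‖B u‖ ≤ K * √(p u u) := hB₀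
  have hBi : ∀ u w, inner ℝ (B u) (j w) = b u w := hB₁
  obtain ⟨f, hf, hfi⟩ := exists_riesz hj l₂ hK fun w => by rw [hjn]; exact hl₂ w
  have hq : ∀ u, 0 ≤ p u u + inner ℝ (B u) (B u) := fun u =>
    add_nonneg (hppos u) real_inner_self_nonneg
  -- After maximization over `w` the quadratic part in `u` is `p(u, u) + ‖B u‖²`, so this is the
  -- Hilbert space to complete to. Its norm is equivalent to `√(p u u)` because `‖B u‖ ≤ K √(p u
  -- u)`.
  obtain ⟨E, _, _, _, i, hi, hip⟩ := exists_hilbert_of_psd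
    (p + (innerₗ F).compl₁₂ B B) (fun u v => by
      change p u v + inner ℝ (B u) (B v) = p v u + inner ℝ (B v) (B u)
      rw [hpsymm u v, real_inner_comm]) hq
  replace hip : ∀ u v, inner ℝ (i u) (i v) = p u v + inner ℝ (B u) (B v) := hip
  have hin : ∀ u, ‖i u‖ ^ 2 = p u u + ‖B u‖ ^ 2 := fun u => by
    rw [← real_inner_self_eq_norm_sq, hip, real_inner_self_eq_norm_sq]
  have hs : ∀ u, √(p u u) ^ 2 = p u u := fun u => Real.sq_sqrt (hppos u)
  have hip_le : ∀ u, √(p u u) ≤ ‖i u‖ := fun u => by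
    refine (pow_le_pow_iff_left₀ (by positivity) (by positivity) two_ne_zero).mp ?_
    rw [hs, hin]; nlinarith [sq_nonneg ‖B u‖]
  have hi_le : ∀ u, ‖i u‖ ≤ (1 + K) * √(p u u) := fun u => by
    refine (pow_le_pow_iff_left₀ (by positivity) (by positivity) two_ne_zero).mp ?_
    have := pow_le_pow_left₀ (norm_nonneg _) (hBn u) 2
    rw [hin, mul_pow, hs]
    rw [mul_pow, hs] at this
    nlinarith [mul_nonneg hK (hppos u)]
  obtain ⟨e, -, he⟩ := exists_riesz hi (l₁ + (innerₗ F f).comp B)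
    (K := K + K * K) (by positivity) fun u => by
      have h1 := abs_real_inner_le_norm f (B u)
      have h2 : ‖f‖ * ‖B u‖ ≤ K * (K * ‖i u‖) :=
        mul_le_mul hf ((hBn u).trans (by gcongr; exact hip_le u)) (norm_nonneg _) hK
      have h3 : K * √(p u u) ≤ K * ‖i u‖ := by gcongr; exact hip_le u
      calc |l₁ u + inner ℝ f (B u)| ≤ |l₁ u| + |inner ℝ f (B u)| := abs_add_le _ _
        _ ≤ (K + K * K) * ‖i u‖ := by linarith [hl₁ u]
  replace he : ∀ u, inner ℝ e (i u) = l₁ u + inner ℝ f (B u) := he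
  set G : U → ℝ := fun u => p u u + 2 * l₁ u + c + ‖B u + f‖ ^ 2 with hG
  -- Completing the square in `w`: the range of `j` is dense, so `G u` is the supremum of the
  -- functional over `w`.
  have hJ : ∀ u w, p u u + 2 * b u w - r w w + 2 * l₁ u + 2 * l₂ w + c
      = G u - ‖j w - B u - f‖ ^ 2 := by
    intro u w
    rw [← hBi, ← hfi, ← hjr, real_inner_self_eq_norm_sq, hG, sub_sub, norm_sub_sq_real (j w),
      inner_add_right, real_inner_comm (B u), real_inner_comm f]
    ring
  have hGadd : ∀ u h, G (u + h) = G u + 2 * inner ℝ (i u + e) (i h) + ‖i h‖ ^ 2 := by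
    intro u h
    have h1 : B u + B h + f = (B u + f) + B h := by abel
    simp only [hG, map_add, LinearMap.add_apply, inner_add_left, hip, he, hin]
    rw [h1, norm_add_sq_real (B u + f), inner_add_left, hpsymm h u]
    ring
  -- The constant collects the errors in the bound on `G u₀`: `2 η²` directly, and `(1 + 2K)² η²`
  -- from absorbing a term linear in `√(p h h)` into `p h h`.
  set κ := 2 + (1 + 2 * K) ^ 2 with hκ
  have hκ0 : 0 < κ := by positivity
  obtain ⟨η, hη, hηδ⟩ : ∃ η : ℝ, 0 < η ∧ η ^ 2 * κ = δ / 2 :=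
    ⟨√(δ / 2 / κ), by positivity, by rw [Real.sq_sqrt (by positivity)]; field_simp⟩
  -- By `hGadd` the gradient of `G` at `u` is represented by `2 (i u + e)`, so `u₀` is nearly
  -- stationary; next, `w₀` nearly attains the supremum at `u₀`. This is an approximate saddle
  -- point.
  obtain ⟨u₀, hu₀⟩ : ∃ u₀, ‖i u₀ + e‖ ≤ η := by
    obtain ⟨u₀, hu⟩ := hi.exists_dist_lt (-e) hη
    refine ⟨u₀, ?_⟩
    rw [dist_comm, dist_eq_norm, sub_neg_eq_add] at hu
    exact hu.le
  obtain ⟨w₀, hw₀⟩ : ∃ w₀, ‖j w₀ - B u₀ - f‖ ≤ η := by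
    obtain ⟨w₀, hw⟩ := hj.exists_dist_lt (B u₀ + f) hη
    refine ⟨w₀, ?_⟩
    rw [dist_comm, dist_eq_norm, ← sub_sub] at hw
    exact hw.le
  -- The hypothesis on the infimum is used only at `w₀`. It gives `h` with the functional at `(u₀ +
  -- h, w₀)` at most `η²`; there `‖B h‖²` cancels and `p h h` remains, which controls all terms
  -- linear in `h`.
  have hGu₀ : G u₀ ≤ δ / 2 := by
    obtain ⟨u, hu⟩ := hinf w₀ (η ^ 2) (by positivity)
    obtain ⟨h, rfl⟩ : ∃ h, u = u₀ + h := ⟨u - u₀, by abel⟩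
    rw [hJ, hGadd] at hu
    set ξ := j w₀ - B u₀ - f with hξ
    have h1 : j w₀ - B (u₀ + h) - f = ξ - B h := by rw [hξ, map_add]; abel
    rw [h1, norm_sub_sq_real, hin] at hu
    have h2 : -(η * ((1 + K) * √(p h h))) ≤ inner ℝ (i u₀ + e) (i h) := by
      have h3 := abs_real_inner_le_norm (i u₀ + e) (i h)
      have h4 : ‖i u₀ + e‖ * ‖i h‖ ≤ η * ((1 + K) * √(p h h)) :=
        mul_le_mul hu₀ (hi_le h) (norm_nonneg _) hη.le
      linarith [neg_abs_le (inner ℝ (i u₀ + e) (i h))]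
    have h3 : -(η * (K * √(p h h))) ≤ inner ℝ ξ (B h) := by
      have h3 := abs_real_inner_le_norm ξ (B h)
      have h4 : ‖ξ‖ * ‖B h‖ ≤ η * (K * √(p h h)) :=
        mul_le_mul hw₀ (hBn h) (norm_nonneg _) hη.le
      linarith [neg_abs_le (inner ℝ ξ (B h))]
    have h4 : ‖ξ‖ ^ 2 ≤ η ^ 2 := pow_le_pow_left₀ (norm_nonneg _) hw₀ 2
    rw [← hηδ, hκ]
    nlinarith [sq_nonneg (√(p h h) - η * (1 + 2 * K)), hs h]
  set L := (1 + K) * √K with hL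
  have hL0 : 0 ≤ L := by positivity
  have hiL : ∀ h, ‖i h‖ ≤ L * ‖h‖ := fun h => by
    refine (hi_le h).trans ?_
    rw [hL, mul_assoc]
    gcongr
    rw [← Real.sqrt_sq (norm_nonneg h), ← Real.sqrt_mul hK]
    exact Real.sqrt_le_sqrt (hpK h)
  -- On the ball `‖i h‖ ≤ t ≤ 1`, so `G` grows by at most `2 η t + t`, and this choice makes that at
  -- most `δ / 2`.
  set t := min 1 (δ / (2 * (2 * η + 1))) with ht
  have ht0 : 0 < t := by positivity
  refine ⟨u₀, t / (L + 1), by positivity, fun u hu w => ?_⟩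
  obtain ⟨h, rfl⟩ : ∃ h, u = u₀ + h := ⟨u - u₀, by abel⟩
  rw [add_sub_cancel_left] at hu
  have hit : ‖i h‖ ≤ t := by
    refine (hiL h).trans ?_
    rw [le_div_iff₀ (by positivity)] at hu
    nlinarith [norm_nonneg h]
  have h1 : inner ℝ (i u₀ + e) (i h) ≤ η * t :=
    (real_inner_le_norm _ _).trans (mul_le_mul hu₀ hit (norm_nonneg _) hη.le)
  have h2 : ‖i h‖ ^ 2 ≤ t * 1 := by
    rw [sq]; exact mul_le_mul hit (hit.trans (min_le_left _ _)) (norm_nonneg _) ht0.le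
  have h3 : t * (2 * (2 * η + 1)) ≤ δ := by
    rw [← le_div_iff₀ (by positivity)]; exact min_le_right _ _
  rw [hJ, hGadd]
  nlinarith [sq_nonneg ‖j w - B (u₀ + h) - f‖]

end Minimax

/-! ### Polynomial matrices acting on vectors over a Hilbert space. -/

section PolynomialAction

open Polynomial ContinuousLinearMap

variable {H : Type*} [NormedAddCommGroup H] [InnerProductSpace ℂ H]

/-- The action of a polynomial matrix, evaluated at the operator `V`, on vectors over `H`. -/
noncomputable def act {a b : Type*} [Fintype b] (V : H →L[ℂ] H) (P : Matrix a b ℂ[X]) :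
    (b → H) →L[ℂ] (a → H) :=
  ContinuousLinearMap.pi fun i => ∑ j, aeval V (P i j) ∘L proj j

theorem act_apply {a b : Type*} [Fintype b] (V : H →L[ℂ] H) (P : Matrix a b ℂ[X]) (u : b → H)
    (i : a) : act V P u i = ∑ j, aeval V (P i j) (u j) := by
  simp [act]

theorem act_mul {a b c : Type*} [Fintype b] [Fintype c] (V : H →L[ℂ] H) (P : Matrix a b ℂ[X])
    (R : Matrix b c ℂ[X]) (u : c → H) : act V (P * R) u = act V P (act V R u) := by
  ext i
  simp only [act_apply, Matrix.mul_apply, map_sum, map_mul, sum_apply, mul_apply_eq_comp]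
  rw [Finset.sum_comm]

theorem act_smul_one {a : Type*} [Fintype a] [DecidableEq a] (V : H →L[ℂ] H) (p : ℂ[X])
    (u : a → H) (i : a) : act V (p • (1 : Matrix a a ℂ[X])) u i = aeval V p (u i) := by
  simp [act_apply, Matrix.one_apply, apply_ite, ite_apply]

variable (H) in
/-- The real part of the sesquilinear form with real matrix `Q`. -/
noncomputable def realForm {ι : Type*} [Fintype ι] (Q : Matrix ι ι ℝ) :
    (ι → H) →ₗ[ℝ] (ι → H) →ₗ[ℝ] ℝ :=
  LinearMap.mk₂ ℝ (fun z z' => ∑ i, ∑ j, Q i j * (inner ℂ (z i) (z' j)).re)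
    (fun z₁ z₂ z => by simp [mul_add, Finset.sum_add_distrib])
    (fun a z₁ z₂ => by
      simp only [← Complex.coe_smul, Pi.smul_apply, inner_smul_left, Finset.mul_sum,
        Complex.conj_ofReal, Complex.re_ofReal_mul, smul_eq_mul, mul_left_comm])
    (fun z₁ z₂ z => by simp [mul_add, Finset.sum_add_distrib])
    (fun a z₁ z₂ => by
      simp only [← Complex.coe_smul, Pi.smul_apply, inner_smul_right, Finset.mul_sum,
        Complex.re_ofReal_mul, smul_eq_mul, mul_left_comm])

theorem realForm_apply {ι : Type*} [Fintype ι] (Q : Matrix ι ι ℝ) (z z' : ι → H) :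
    realForm H Q z z' = ∑ i, ∑ j, Q i j * (inner ℂ (z i) (z' j)).re := rfl

theorem realForm_symm {ι : Type*} [Fintype ι] {Q : Matrix ι ι ℝ} (hQ : Q.IsSymm) (z z' : ι → H) :
    realForm H Q z z' = realForm H Q z' z := by
  rw [realForm_apply, realForm_apply, Finset.sum_comm]
  refine Finset.sum_congr rfl fun i _ => Finset.sum_congr rfl fun j _ => ?_
  rw [hQ.apply i j, ← inner_conj_symm, Complex.conj_re]

theorem abs_realForm_le {ι : Type*} [Fintype ι] (Q : Matrix ι ι ℝ) (z z' : ι → H) :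
    |realForm H Q z z'| ≤ (∑ i, ∑ j, |Q i j|) * (‖z‖ * ‖z'‖) := by
  rw [realForm_apply, Finset.sum_mul]
  refine (Finset.abs_sum_le_sum_abs _ _).trans (Finset.sum_le_sum fun i _ => ?_)
  rw [Finset.sum_mul]
  refine (Finset.abs_sum_le_sum_abs _ _).trans (Finset.sum_le_sum fun j _ => ?_)
  rw [abs_mul]
  refine mul_le_mul_of_nonneg_left ?_ (abs_nonneg _)
  refine (Complex.abs_re_le_norm _).trans ((norm_inner_le_norm _ _).trans ?_)
  exact mul_le_mul (norm_le_pi_norm z i) (norm_le_pi_norm z' j) (norm_nonneg _) (norm_nonneg _)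

/-- The value of a polynomial matrix at a point. -/
noncomputable def evalMat {a b : Type*} (M : Matrix a b ℂ[X]) (c : ℂ) : Matrix a b ℂ :=
  M.map (eval c)

/-- The symbol `M(c)' Q M(c)`. -/
noncomputable def symbol {ι m : Type*} [Fintype ι] (Q : Matrix ι ι ℝ) (M : Matrix ι m ℂ[X])
    (c : ℂ) : Matrix m m ℂ :=
  (evalMat M c)ᴴ * Q.map (fun r : ℝ => (r : ℂ)) * evalMat M c

theorem symbol_apply {ι m : Type*} [Fintype ι] (Q : Matrix ι ι ℝ) (M : Matrix ι m ℂ[X])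
    (c : ℂ) (i j : m) : symbol Q M c i j =
      ∑ a, ∑ b, (Q a b : ℂ) * (star ((M a i).eval c) * (M b j).eval c) := by
  simp only [symbol, evalMat, Matrix.mul_apply, Finset.sum_mul, Matrix.conjTranspose_apply,
    Matrix.map_apply]
  rw [Finset.sum_comm]
  refine Finset.sum_congr rfl fun a _ => Finset.sum_congr rfl fun b _ => by ring

/-- Transfers a matrix inequality on the circle to `V`. The weights `E` make room for the factor `ε`
and the sign change in the minimax condition, and `d` for a scalar lower bound; `d = 0` gives plain
nonnegativity. -/
theorem weighted_form_ge_of_symbol {V : H →L[ℂ] H}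
    (hV : ∀ f g, inner ℂ (V f) (V g) = inner ℂ f g) {ι m : Type*} [Fintype ι] [Fintype m]
    [DecidableEq m] (Q : Matrix ι ι ℝ) (M : Matrix ι m ℂ[X]) (E : m → m → ℝ) (d : ℂ[X])
    (hpsd : ∀ c, ‖c‖ = 1 → c ≠ 1 →
      (Matrix.of (fun i j => (E i j : ℂ) * symbol Q M c i j) -
        (star (d.eval c) * d.eval c) • (1 : Matrix m m ℂ)).PosSemidef) (u : m → H) :
    ∑ i, ‖aeval V d (u i)‖ ^ 2 ≤ ∑ i, ∑ j, E i j * ∑ a, ∑ b, Q a b *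
      (inner ℂ (aeval V (M a i) (u i)) (aeval V (M b j) (u j))).re := by
  have h := re_sum_nonneg_of_symbol (V := V) hpsd u
    (θ := fun i j => (E i j : ℂ) * ∑ a, ∑ b, (Q a b : ℂ) *
      inner ℂ (aeval V (M a i) (u i)) (aeval V (M b j) (u j)) -
      (if i = j then 1 else 0) * inner ℂ (aeval V d (u i)) (aeval V d (u j))) ?_
  · simp only [Finset.sum_sub_distrib, Complex.sub_re] at h
    have h1 : (∑ i, ∑ j, (if i = j then (1 : ℂ) else 0) *
        inner ℂ (aeval V d (u i)) (aeval V d (u j))).re = ∑ i, ‖aeval V d (u i)‖ ^ 2 := by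
      simp only [ite_mul, one_mul, zero_mul, Finset.sum_ite_eq, Finset.mem_univ, if_true,
        inner_self_eq_norm_sq_to_K, Complex.re_sum]
      refine Finset.sum_congr rfl fun i _ => ?_
      simp [← Complex.ofReal_pow]
    have h2 : (∑ i, ∑ j, (E i j : ℂ) * ∑ a, ∑ b, (Q a b : ℂ) *
        inner ℂ (aeval V (M a i) (u i)) (aeval V (M b j) (u j))).re =
        ∑ i, ∑ j, E i j * ∑ a, ∑ b, Q a b *
          (inner ℂ (aeval V (M a i) (u i)) (aeval V (M b j) (u j))).re := by
      simp only [Complex.re_sum, Complex.re_ofReal_mul]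
    rw [h1, h2] at h
    linarith
  · intro i j
    have t1 := fun a b => tendsto_average_symbol hV (M a i) (M b j) (u i) (u j)
    have t2 := tendsto_average_symbol hV d d (u i) (u j)
    have t3 := ((tendsto_finsetSum Finset.univ fun a _ => tendsto_finsetSum Finset.univ
      fun b _ => (t1 a b).const_mul (Q a b : ℂ)).const_mul (E i j : ℂ)).sub
        (t2.const_mul (if i = j then 1 else 0))
    refine t3.congr fun N => ?_
    simp only [Matrix.sub_apply, Matrix.of_apply, Matrix.smul_apply, Matrix.one_apply,
      symbol_apply, smul_eq_mul, Finset.mul_sum, Finset.sum_mul, sub_mul,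
      Finset.sum_sub_distrib, mul_sub]
    congr 1
    · rw [Finset.sum_congr rfl fun a _ => Finset.sum_comm, Finset.sum_comm]
      refine Finset.sum_congr rfl fun l _ => Finset.sum_congr rfl fun a _ =>
        Finset.sum_congr rfl fun b _ => by ring
    · refine Finset.sum_congr rfl fun l _ => by split_ifs <;> ring

theorem realForm_act {V : H →L[ℂ] H} {ι m m' : Type*} [Fintype ι] [Fintype m] [Fintype m']
    (Q : Matrix ι ι ℝ) (M : Matrix ι m ℂ[X]) (M' : Matrix ι m' ℂ[X]) (u : m → H) (u' : m' → H) :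
    realForm H Q (act V M u) (act V M' u') = ∑ i, ∑ j, ∑ a, ∑ b, Q a b *
      (inner ℂ (aeval V (M a i) (u i)) (aeval V (M' b j) (u' j))).re := by
  have h : ∀ F : m → m' → ι → ι → ℝ, ∑ i, ∑ j, ∑ a, ∑ b, F i j a b
      = ∑ a, ∑ b, ∑ i, ∑ j, F i j a b := by
    intro F
    rw [Finset.sum_congr rfl fun i _ => Finset.sum_comm, Finset.sum_comm]
    refine Finset.sum_congr rfl fun a _ => ?_
    rw [Finset.sum_congr rfl fun i _ => Finset.sum_comm, Finset.sum_comm]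
  rw [h]
  simp only [realForm_apply, act_apply, sum_inner, inner_sum, Complex.re_sum, Finset.mul_sum]
  refine Finset.sum_congr rfl fun a _ => Finset.sum_congr rfl fun b _ => Finset.sum_comm

end PolynomialAction

/-! ### Cross terms with the free response. -/

section CrossTerm

open Polynomial ContinuousLinearMap

variable {H : Type*} [NormedAddCommGroup H] [InnerProductSpace ℂ H]

theorem exists_bound_of_mem_laurentOnCircle {f : ℂ → ℂ} (hf : f ∈ laurentOnCircle) :
    ∃ K : ℝ, ∀ c, ‖c‖ = 1 → ‖f c‖ ≤ K := by
  obtain ⟨L, p, hp⟩ := hf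
  obtain ⟨K, hK⟩ := (isCompact_sphere (0 : ℂ) 1).exists_bound_of_continuousOn
    (f := fun c => p.eval c) (by fun_prop)
  refine ⟨K, fun c hc => ?_⟩
  have h := hK c (by simpa using hc)
  rwa [← hp c hc, norm_mul, norm_pow, hc, one_pow, one_mul] at h

theorem symbol_mem_laurentOnCircle {ι m : Type*} [Fintype ι] (Q : Matrix ι ι ℝ)
    (M : Matrix ι m ℂ[X]) (i j : m) : (fun c => symbol Q M c i j) ∈ laurentOnCircle := by
  have : (fun c => symbol Q M c i j) = ∑ a, ∑ b, (Q a b : ℂ) •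
      ((fun c => star ((M a i).eval c)) * fun c => (M b j).eval c) := by
    ext c
    simp [symbol_apply, Finset.sum_apply]
  rw [this]
  exact sum_mem fun a _ => sum_mem fun b _ => Subalgebra.smul_mem _
    (mul_mem (conj_eval_mem_laurentOnCircle _) (eval_mem_laurentOnCircle _)) _

/-- A symbol that is positive semidefinite on the circle and positive definite somewhere dominates
the square of a scalar polynomial without roots in the open unit disc. -/
theorem exists_scalar_minorant {ι m : Type*} [Fintype ι] [Fintype m] [DecidableEq m]
    (Q : Matrix ι ι ℝ) (M : Matrix ι m ℂ[X])
    (hpsd : ∀ c, ‖c‖ = 1 → c ≠ 1 → (symbol Q M c).PosSemidef)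
    {c₀ : ℂ} (hc₀ : ‖c₀‖ = 1) (hpd : (symbol Q M c₀).PosDef) :
    ∃ (d : ℂ[X]) (K : ℝ), d ≠ 0 ∧ (∀ r, d.IsRoot r → 1 ≤ ‖r‖) ∧ 0 ≤ K ∧
      ∀ c, ‖c‖ = 1 → c ≠ 1 → (((K : ℝ) : ℂ) • symbol Q M c -
        (star (d.eval c) * d.eval c) • (1 : Matrix m m ℂ)).PosSemidef := by
  have hdet := det_mem_laurentOnCircle (symbol Q M) (symbol_mem_laurentOnCircle Q M)
  obtain ⟨K₂, hK₂⟩ := exists_bound_of_mem_laurentOnCircle hdet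
  have htr : (fun c => (symbol Q M c).trace) ∈ laurentOnCircle := by
    have : (fun c => (symbol Q M c).trace) = ∑ i, fun c => symbol Q M c i i := by
      ext c; simp [Matrix.trace, Finset.sum_apply]
    rw [this]
    exact sum_mem fun i _ => symbol_mem_laurentOnCircle Q M i i
  obtain ⟨t, ht⟩ := exists_bound_of_mem_laurentOnCircle htr
  obtain ⟨L, p, hp⟩ := hdet
  -- Definiteness at the single point `c₀` serves only to make the determinant a nonzero Laurent
  -- polynomial.
  have hp0 : p ≠ 0 := by
    rintro rfl
    have h1 := hp c₀ hc₀
    have h2 : c₀ ≠ 0 := by rintro rfl; simp at hc₀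
    have h3 : (symbol Q M c₀).det ≠ 0 := hpd.det_pos.ne'
    simp [h2, h3] at h1
  obtain ⟨d, hd, hroot, K₁, hK₁, hdp⟩ := exists_polynomial_dominated p hp0
  have hK₂0 : 0 ≤ K₂ := (norm_nonneg _).trans (hK₂ c₀ hc₀)
  set T := max t 1
  have hT : 1 ≤ T := le_max_right _ _
  refine ⟨d, K₁ ^ 2 * K₂ * T ^ Fintype.card m, hd, hroot, by positivity, fun c hc hc1 => ?_⟩
  have hP := hpsd c hc hc1
  have h1 := posSemidef_pow_smul_sub_det hP hT
    ((Complex.re_le_norm _).trans ((ht c hc).trans (le_max_left _ _)))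
  obtain ⟨δ, hδ0, hδ⟩ : ∃ δ : ℝ, 0 ≤ δ ∧ (symbol Q M c).det = δ := by
    have hdet0 := Complex.nonneg_iff.mp hP.det_nonneg
    exact ⟨(symbol Q M c).det.re, hdet0.1, Complex.ext rfl (by simpa using hdet0.2.symm)⟩
  have hnorm : ‖(symbol Q M c).det‖ = δ := by
    rw [hδ, Complex.norm_real, Real.norm_of_nonneg hδ0]
  have h2 : ‖p.eval c‖ = δ := by
    rw [← hp c hc, norm_mul, norm_pow, hc, one_pow, one_mul, ← hnorm]
  -- `|d|²` is dominated by the square of the determinant; one of the two factors is estimated by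
  -- its maximum `K₂` on the circle.
  have h3 : ‖d.eval c‖ ^ 2 ≤ K₁ ^ 2 * K₂ * δ := by
    have h4 := pow_le_pow_left₀ (norm_nonneg _) (hdp c hc) 2
    have h5 : δ ≤ K₂ := hnorm ▸ hK₂ c hc
    rw [h2, mul_pow] at h4
    calc _ ≤ K₁ ^ 2 * δ ^ 2 := h4
      _ ≤ K₁ ^ 2 * (K₂ * δ) := by rw [sq δ]; gcongr
      _ = _ := by ring
  have h4 : (star (d.eval c) * d.eval c) = ((‖d.eval c‖ ^ 2 : ℝ) : ℂ) := by
    rw [Complex.star_def, mul_comm, Complex.mul_conj, Complex.normSq_eq_norm_sq]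
  have h6 : (((K₁ ^ 2 * K₂ * T ^ Fintype.card m : ℝ) : ℂ) • symbol Q M c -
        (star (d.eval c) * d.eval c) • (1 : Matrix m m ℂ))
      = ((K₁ ^ 2 * K₂ : ℝ) : ℂ) • (((T ^ Fintype.card m : ℝ) : ℂ) • symbol Q M c -
          (symbol Q M c).det • (1 : Matrix m m ℂ)) +
        ((K₁ ^ 2 * K₂ * δ - ‖d.eval c‖ ^ 2 : ℝ) : ℂ) • (1 : Matrix m m ℂ) := by
    rw [h4, hδ, smul_sub, smul_smul, smul_smul, Complex.ofReal_sub, sub_smul,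
      ← Complex.ofReal_mul, ← Complex.ofReal_mul]
    abel
  rw [h6]
  exact (h1.smul (Complex.zero_le_real.mpr (by positivity))).add
    (Matrix.PosSemidef.one.smul (Complex.zero_le_real.mpr (by linarith)))

variable [CompleteSpace H]

theorem adjoint_aeval_mem {V : H →L[ℂ] H} {F : Submodule ℂ H}
    (hF : ∀ x ∈ F, adjoint V x ∈ F) (p : ℂ[X]) : ∀ x ∈ F, adjoint (aeval V p) x ∈ F := by
  induction p using Polynomial.induction_on' with
  | add p q hp hq =>
    intro x hx
    rw [map_add, map_add]
    exact F.add_mem (hp x hx) (hq x hx)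
  | monomial n a =>
    induction n with
    | zero =>
      intro x hx
      have h1 : adjoint (aeval V (monomial 0 a)) x = star a • x := by
        rw [monomial_zero_left, aeval_C, Algebra.algebraMap_eq_smul_one, map_smulₛₗ,
          ← star_eq_adjoint, star_one]
        rfl
      rw [h1]
      exact F.smul_mem _ hx
    | succ n ih =>
      intro x hx
      have h1 : aeval V (monomial (n + 1) a) = V * aeval V (monomial n a) := by
        rw [← X_mul_monomial, map_mul, aeval_X]
      rw [h1, mul_def, adjoint_comp]
      exact ih _ (hF x hx)

/-- Free responses have cross terms that are bounded in the seminorm of the form. -/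
theorem exists_cross_bound {V : H →L[ℂ] H} (hV : ∀ f g, inner ℂ (V f) (V g) = inner ℂ f g)
    (hev : ∀ (c : ℂ) f, V f = c • f → f = 0) {ι m : Type*} [Fintype ι] [Fintype m]
    [DecidableEq m] (Q : Matrix ι ι ℝ) (M : Matrix ι m ℂ[X])
    (hpsd : ∀ c, ‖c‖ = 1 → c ≠ 1 → (symbol Q M c).PosSemidef)
    {c₀ : ℂ} (hc₀ : ‖c₀‖ = 1) (hpd : (symbol Q M c₀).PosDef)
    {F : Submodule ℂ H} [FiniteDimensional ℂ F] (hF : ∀ x ∈ F, adjoint V x ∈ F)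
    (z : ι → H) (hz : ∀ a, z a ∈ F) :
    ∃ K : ℝ, 0 ≤ K ∧ ∀ u : m → H,
      |realForm H Q z (act V M u)| ≤ K * √(realForm H Q (act V M u) (act V M u)) := by
  have hVn : ∀ f, ‖V f‖ = ‖f‖ := fun f => by
    rw [@norm_eq_sqrt_re_inner ℂ, @norm_eq_sqrt_re_inner ℂ, hV]
  obtain ⟨d, K, hd, hroot, hK, hdom⟩ := exists_scalar_minorant Q M hpsd hc₀ hpd
  have hlow : ∀ u : m → H, ∑ i, ‖aeval V d (u i)‖ ^ 2 ≤
      K * realForm H Q (act V M u) (act V M u) := by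
    intro u
    have h := weighted_form_ge_of_symbol hV Q M (fun _ _ => K) d (fun c hc hc1 => by
      convert hdom c hc hc1 using 2
      ext i j
      rfl) u
    rw [realForm_act]
    simpa only [Finset.mul_sum] using h
  -- The vectors representing the linear functional `u ↦ realForm H Q z (act V M u)`; they lie in
  -- `F` because `F` is invariant under `V*`.
  set g : m → H := fun j => ∑ a, ∑ b, (Q a b : ℂ) • adjoint (aeval V (M b j)) (z a) with hg
  have hgF : ∀ j, g j ∈ F := fun j => F.sum_mem fun a _ => F.sum_mem fun b _ =>
    F.smul_mem _ (adjoint_aeval_mem hF _ _ (hz a))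
  have hcross : ∀ u : m → H, realForm H Q z (act V M u) = ∑ j, (inner ℂ (g j) (u j)).re := by
    intro u
    simp only [realForm_apply, act_apply, hg, sum_inner, inner_sum, inner_smul_left,
      adjoint_inner_left, Complex.re_sum, Complex.conj_ofReal, Complex.re_ofReal_mul,
      Finset.mul_sum]
    symm
    rw [Finset.sum_comm]
    exact Finset.sum_congr rfl fun a _ => Finset.sum_comm
  -- On the finite-dimensional invariant space `F`, injectivity of `d(V)*` forces surjectivity. Thus
  -- `g = d(V)* h`, and `⟨g, u⟩ = ⟨h, d(V) u⟩` is controlled by the form.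
  have hsurj : ∀ y ∈ F, ∃ x, adjoint (aeval V d) x = y := by
    let D : F →ₗ[ℂ] F := ((adjoint (aeval V d) : H →L[ℂ] H) : H →ₗ[ℂ] H).restrict
      (adjoint_aeval_mem hF d)
    have hD : Function.Injective D := by
      rw [injective_iff_map_eq_zero]
      intro x hx
      have h1 : adjoint (aeval V d) (x : H) = 0 := congrArg Subtype.val hx
      exact Subtype.ext (adjoint_aeval_injective hVn hev hd hroot h1)
    intro y hy
    obtain ⟨x, hx⟩ := LinearMap.injective_iff_surjective.mp hD ⟨y, hy⟩
    exact ⟨x, congrArg Subtype.val hx⟩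
  choose h hh using fun j => hsurj (g j) (hgF j)
  refine ⟨√(∑ j, ‖h j‖ ^ 2) * √K, by positivity, fun u => ?_⟩
  rw [hcross]
  calc |∑ j, (inner ℂ (g j) (u j)).re| ≤ ∑ j, ‖h j‖ * ‖aeval V d (u j)‖ := by
        refine (Finset.abs_sum_le_sum_abs _ _).trans (Finset.sum_le_sum fun j _ => ?_)
        rw [← hh, adjoint_inner_left]
        exact (Complex.abs_re_le_norm _).trans (norm_inner_le_norm _ _)
    _ ≤ √(∑ j, ‖h j‖ ^ 2) * √(∑ j, ‖aeval V d (u j)‖ ^ 2) := Real.sum_mul_le_sqrt_mul_sqrt _ _ _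
    _ ≤ √(∑ j, ‖h j‖ ^ 2) * √(K * realForm H Q (act V M u) (act V M u)) := by
        gcongr; exact hlow u
    _ = _ := by rw [Real.sqrt_mul hK, mul_assoc]

end CrossTerm

/-! ### The Cayley transform of the state equation. -/

section Pencil

open Polynomial ContinuousLinearMap

variable {H : Type*} [NormedAddCommGroup H] [InnerProductSpace ℂ H] {n : ℕ} {m : Type}

/-- `(1 - A) + (1 + A) X`, which is `(1 - c) (s I - A)` at `X = c` for `s = (1 + c) / (1 - c)`. -/
noncomputable def pencil (A : Matrix (Fin n) (Fin n) ℝ) : Matrix (Fin n) (Fin n) ℂ[X] :=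
  (1 - toC A).map C + (X : ℂ[X]) • (1 + toC A).map C

/-- `(1 - X) B`. -/
noncomputable def inputMat (B : Matrix (Fin n) m ℝ) : Matrix (Fin n) m ℂ[X] :=
  (1 - X : ℂ[X]) • (toC B).map C

/-- `det(pencil) • [(s I - A)⁻¹ B; I]` as a polynomial matrix. -/
noncomputable def fullMat [DecidableEq m] (A : Matrix (Fin n) (Fin n) ℝ)
    (B : Matrix (Fin n) m ℝ) : Matrix (Fin n ⊕ m) m ℂ[X] :=
  Matrix.fromRows ((pencil A).adjugate * inputMat B) ((pencil A).det • 1)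

theorem act_pencil_apply (V : H →L[ℂ] H) (A : Matrix (Fin n) (Fin n) ℝ) (x : Fin n → H)
    (i : Fin n) : act V (pencil A) x i =
      x i + V (x i) - ∑ j, A i j • (x j - V (x j)) := by
  have h : ∀ j, aeval V (pencil A i j) (x j) =
      ((if i = j then x j + V (x j) else 0) - A i j • (x j - V (x j))) := by
    intro j
    by_cases hij : i = j
    · subst hij
      simp [pencil, Algebra.algebraMap_eq_smul_one, smul_sub]
      abel
    · simp [pencil, hij, Algebra.algebraMap_eq_smul_one, smul_sub]
      abel
  simp [act_apply, h, Finset.sum_sub_distrib]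

theorem act_inputMat_apply [Fintype m] (V : H →L[ℂ] H) (B : Matrix (Fin n) m ℝ) (u : m → H)
    (i : Fin n) : act V (inputMat B) u i = ∑ j, B i j • (u j - V (u j)) := by
  simp [act_apply, inputMat, Algebra.algebraMap_eq_smul_one, smul_sub]

theorem evalMat_mul {a b c : Type*} [Fintype b] (P : Matrix a b ℂ[X]) (R : Matrix b c ℂ[X])
    (z : ℂ) : evalMat (P * R) z = evalMat P z * evalMat R z :=
  Matrix.map_mul (f := evalRingHom z)

theorem det_evalMat {a : Type*} [Fintype a] [DecidableEq a] (P : Matrix a a ℂ[X]) (z : ℂ) :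
    (evalMat P z).det = P.det.eval z :=
  ((evalRingHom z).map_det P).symm

theorem evalMat_adjugate {a : Type*} [Fintype a] [DecidableEq a] (P : Matrix a a ℂ[X]) (z : ℂ) :
    evalMat P.adjugate z = (evalMat P z).adjugate :=
  (evalRingHom z).map_adjugate P

theorem evalMat_pencil (A : Matrix (Fin n) (Fin n) ℝ) {c : ℂ} (hc : c ≠ 1) :
    evalMat (pencil A) c =
      (1 - c) • (((1 + c) / (1 - c)) • (1 : Matrix (Fin n) (Fin n) ℂ) - toC A) := by
  have h : 1 - c ≠ 0 := sub_ne_zero.mpr hc.symm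
  rw [smul_sub, smul_smul, mul_div_cancel₀ _ h]
  ext i j
  by_cases hij : i = j
  · subst hij
    simp [evalMat, pencil]; ring
  · simp [evalMat, pencil, hij]; ring

theorem evalMat_inputMat (B : Matrix (Fin n) m ℝ) (c : ℂ) :
    evalMat (inputMat B) c = (1 - c) • toC B := by
  ext i j
  simp [evalMat, inputMat]

theorem cayley_re (c : ℂ) : ((1 + c) / (1 - c)).re = (1 - ‖c‖ ^ 2) / Complex.normSq (1 - c) := by
  rw [Complex.div_re, ← Complex.normSq_eq_norm_sq, Complex.normSq_apply c, ← add_div]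
  simp
  ring_nf

/-- The closed disc without `1` is mapped into the closed right half-plane, where `sI - A` is
nonsingular; at `c = 1`, the point at infinity, the pencil is `2 I`. -/
theorem det_pencil_eval_ne_zero {A : Matrix (Fin n) (Fin n) ℝ} (hA : Hurwitz A) {c : ℂ}
    (hc : ‖c‖ ≤ 1) : (pencil A).det.eval c ≠ 0 := by
  rw [← det_evalMat]
  by_cases h1 : c = 1
  · have : evalMat (pencil A) c = (2 : ℂ) • 1 := by
      subst h1
      ext i j
      by_cases hij : i = j
      · subst hij
        simp [evalMat, pencil]; ring
      · simp [evalMat, pencil, hij]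
    rw [this, Matrix.det_smul]
    simp
  · rw [evalMat_pencil A h1, Matrix.det_smul]
    refine mul_ne_zero (pow_ne_zero _ (sub_ne_zero.mpr (Ne.symm h1))) ?_
    refine ((Matrix.isUnit_iff_isUnit_det _).mp (hA _ ?_)).ne_zero
    rw [cayley_re]
    exact div_nonneg (by nlinarith [norm_nonneg c]) (Complex.normSq_nonneg _)

theorem evalMat_fullMat {k q : ℕ} {A : Matrix (Fin n) (Fin n) ℝ} (hA : Hurwitz A)
    (B₁ : Matrix (Fin n) (Fin k) ℝ) (B₂ : Matrix (Fin n) (Fin q) ℝ) {c : ℂ} (hc : ‖c‖ ≤ 1)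
    (hc1 : c ≠ 1) : evalMat (fullMat A (Matrix.fromCols B₁ B₂)) c =
      (pencil A).det.eval c • freqColumn A B₁ B₂ ((1 + c) / (1 - c)) := by
  have hsub : 1 - c ≠ 0 := sub_ne_zero.mpr (Ne.symm hc1)
  have h1 : evalMat (fullMat A (Matrix.fromCols B₁ B₂)) c = Matrix.fromRows
      (evalMat ((pencil A).adjugate * inputMat (Matrix.fromCols B₁ B₂)) c)
      (evalMat ((pencil A).det • 1) c) := by
    ext (i | i) j <;> rfl
  have h2 : (evalMat (pencil A) c).adjugate =
      (pencil A).det.eval c • (evalMat (pencil A) c)⁻¹ := by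
    rw [Matrix.inv_def, det_evalMat, Ring.inverse_eq_inv', smul_smul,
      mul_inv_cancel₀ (det_pencil_eval_ne_zero hA hc), one_smul]
  have h3 : (evalMat (pencil A) c)⁻¹ =
      (1 - c)⁻¹ • (((1 + c) / (1 - c)) • (1 : Matrix (Fin n) (Fin n) ℂ) - toC A)⁻¹ := by
    rw [evalMat_pencil A hc1]
    refine Matrix.inv_eq_left_inv ?_
    have hu := (Matrix.isUnit_iff_isUnit_det _).mp (hA ((1 + c) / (1 - c)) (by
      rw [cayley_re]
      exact div_nonneg (by nlinarith [norm_nonneg c]) (Complex.normSq_nonneg _)))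
    rw [Matrix.smul_mul, Matrix.mul_smul, smul_smul, inv_mul_cancel₀ hsub, one_smul,
      Matrix.nonsing_inv_mul _ hu]
  rw [h1, evalMat_mul, evalMat_adjugate, h2, h3, evalMat_inputMat, freqColumn]
  ext (i | i) j
  · simp only [Matrix.fromRows_apply_inl, Matrix.smul_mul, Matrix.mul_smul, Matrix.smul_apply,
      smul_eq_mul]
    field_simp
  · by_cases hij : i = j
    · simp [evalMat, hij]
    · simp [evalMat, hij]

theorem symbol_fullMat {k q : ℕ} {A : Matrix (Fin n) (Fin n) ℝ} (hA : Hurwitz A)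
    (B₁ : Matrix (Fin n) (Fin k) ℝ) (B₂ : Matrix (Fin n) (Fin q) ℝ)
    (Q : Matrix (Fin n ⊕ (Fin k ⊕ Fin q)) (Fin n ⊕ (Fin k ⊕ Fin q)) ℝ) {c : ℂ} (hc : ‖c‖ ≤ 1)
    (hc1 : c ≠ 1) : symbol Q (fullMat A (Matrix.fromCols B₁ B₂)) c =
      ((‖(pencil A).det.eval c‖ ^ 2 : ℝ) : ℂ) •
        freqMatrix A B₁ B₂ Q ((1 + c) / (1 - c)) := by
  rw [symbol, evalMat_fullMat hA B₁ B₂ hc hc1, freqMatrix, Matrix.conjTranspose_smul,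
    Matrix.smul_mul, Matrix.smul_mul, Matrix.mul_smul, smul_smul, ← Complex.normSq_eq_norm_sq,
    Complex.normSq_eq_conj_mul_self]
  rfl

theorem symbol_submatrix {ι m m' : Type*} [Fintype ι] (Q : Matrix ι ι ℝ) (M : Matrix ι m ℂ[X])
    (f : m' → m) (c : ℂ) : symbol Q (M.submatrix id f) c = (symbol Q M c).submatrix f f := by
  ext i j
  simp [symbol_apply]

end Pencil

/-- An isometry `V` without eigenvectors, a vector `e` orthogonal to its range and a conjugation
`conj` compatible with both. In the model `V` is multiplication of Laplace transforms by
`(s - 1) / (s + 1)` and `e(t) = exp (-t)`. -/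
structure ShiftModel (H : Type*) [NormedAddCommGroup H] [InnerProductSpace ℂ H] where
  V : H →L[ℂ] H
  e : H
  conj : H →ₗ[ℝ] H
  inner_V : ∀ f g, inner ℂ (V f) (V g) = inner ℂ f g
  eigen : ∀ (c : ℂ) f, V f = c • f → f = 0
  inner_e_V : ∀ f, inner ℂ e (V f) = 0
  conj_conj : ∀ f, conj (conj f) = f
  conj_V : ∀ f, conj (V f) = V (conj f)
  conj_e : conj e = e
  inner_conj : ∀ f g, (inner ℂ (conj f) (conj g)).re = (inner ℂ f g).re

/-! ### Responses to inputs and to the initial state in a shift model. -/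

section Response

open Polynomial ContinuousLinearMap

variable {H : Type*} [NormedAddCommGroup H] [InnerProductSpace ℂ H] [CompleteSpace H]
  {n : ℕ} {m : Type} (S : ShiftModel H)

omit [CompleteSpace H] in
theorem ShiftModel.norm_V (f : H) : ‖S.V f‖ = ‖f‖ := by
  rw [@norm_eq_sqrt_re_inner ℂ, @norm_eq_sqrt_re_inner ℂ, S.inner_V]

theorem isUnit_det_pencil {A : Matrix (Fin n) (Fin n) ℝ} (hA : Hurwitz A) :
    IsUnit (aeval S.V (pencil A).det) := by
  refine isUnit_aeval S.norm_V (fun h => ?_) fun r hr => ?_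
  · exact det_pencil_eval_ne_zero hA (c := 0) (by simp) (by simp [h])
  · by_contra h
    exact det_pencil_eval_ne_zero hA (not_lt.mp h) hr

/-- The inverse of the pencil. -/
noncomputable def solve (A : Matrix (Fin n) (Fin n) ℝ) : (Fin n → H) →L[ℂ] (Fin n → H) :=
  act S.V (pencil A).adjugate ∘L
    ContinuousLinearMap.pi fun i => Ring.inverse (aeval S.V (pencil A).det) ∘L proj i

theorem act_pencil_solve {A : Matrix (Fin n) (Fin n) ℝ} (hA : Hurwitz A) (g : Fin n → H) :
    act S.V (pencil A) (solve S A g) = g := by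
  ext i
  have h := Ring.mul_inverse_cancel _ (isUnit_det_pencil S hA)
  rw [solve, comp_apply, ← act_mul, Matrix.mul_adjugate, act_smul_one]
  exact DFunLike.congr_fun h (g i)

theorem act_pencil_injective {A : Matrix (Fin n) (Fin n) ℝ} (hA : Hurwitz A) :
    Function.Injective (act S.V (pencil A)) := by
  intro x y hxy
  have h := congrArg (act S.V (pencil A).adjugate) hxy
  rw [← act_mul, ← act_mul, Matrix.adjugate_mul] at h
  ext i
  have h1 := congrFun h i
  rw [act_smul_one, act_smul_one] at h1
  have h2 := Ring.inverse_mul_cancel _ (isUnit_det_pencil S hA)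
  have h3 := congrArg (fun f : H => (Ring.inverse (aeval S.V (pencil A).det) : H →L[ℂ] H) f) h1
  simp only [← mul_apply_eq_comp, h2] at h3
  exact h3

/-- State and input as a function of the input, for the initial state `0`. -/
noncomputable def response [Fintype m] (A : Matrix (Fin n) (Fin n) ℝ) (B : Matrix (Fin n) m ℝ) :
    (m → H) →L[ℂ] (Fin n ⊕ m → H) :=
  ContinuousLinearMap.pi (Sum.elim (fun i => proj i ∘L solve S A ∘L act S.V (inputMat B))
    (fun j => proj j))

omit [CompleteSpace H] in
theorem response_apply [Fintype m] (A : Matrix (Fin n) (Fin n) ℝ) (B : Matrix (Fin n) m ℝ)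
    (u : m → H) : response S A B u = Sum.elim (solve S A (act S.V (inputMat B) u)) u := by
  ext (i | i) <;> simp [response]

/-- The free response to the initial state `a`. -/
noncomputable def freeState (A : Matrix (Fin n) (Fin n) ℝ) (a : Fin n → ℝ) : Fin n → H :=
  solve S A fun i => (2 * a i) • S.e

/-- Cramer's rule: multiplying the input by the determinant clears the denominator of the transfer
matrix. Together with `exists_eq_act_det` this writes every response as a polynomial matrix in `V`
applied to some vector, so that the symbol calculus applies. -/
theorem response_det_smul [Fintype m] [DecidableEq m] {A : Matrix (Fin n) (Fin n) ℝ}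
    (hA : Hurwitz A) (B : Matrix (Fin n) m ℝ) (u : m → H) :
    response S A B (act S.V ((pencil A).det • (1 : Matrix m m ℂ[X])) u)
      = act S.V (fullMat A B) u := by
  have h1 : act S.V (fullMat A B) u = Sum.elim (act S.V ((pencil A).adjugate * inputMat B) u)
      (act S.V ((pencil A).det • (1 : Matrix m m ℂ[X])) u) := by
    ext (i | i) <;> simp [act_apply, fullMat]
  rw [h1, response_apply]
  congr 1
  apply act_pencil_injective S hA
  rw [act_pencil_solve S hA, ← act_mul, ← act_mul, ← Matrix.mul_assoc, Matrix.mul_adjugate,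
    Matrix.mul_smul, Matrix.smul_mul, Matrix.mul_one, Matrix.one_mul]

theorem exists_eq_act_det [Fintype m] [DecidableEq m] {A : Matrix (Fin n) (Fin n) ℝ}
    (hA : Hurwitz A) (u : m → H) :
    ∃ u', act S.V ((pencil A).det • (1 : Matrix m m ℂ[X])) u' = u := by
  have h := Ring.mul_inverse_cancel _ (isUnit_det_pencil S hA)
  refine ⟨fun i => Ring.inverse (aeval S.V (pencil A).det) (u i), ?_⟩
  ext i
  rw [act_smul_one]
  exact DFunLike.congr_fun h (u i)

/-- The span of the components of the free response is invariant under `V*`. -/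
theorem adjoint_mem_span_freeState {A : Matrix (Fin n) (Fin n) ℝ} (hA : Hurwitz A)
    (a : Fin n → ℝ) : ∀ x ∈ Submodule.span ℂ (Set.range (freeState S A a)),
      adjoint S.V x ∈ Submodule.span ℂ (Set.range (freeState S A a)) := by
  set x := freeState S A a with hx
  set F := Submodule.span ℂ (Set.range x)
  have hVV : ∀ f, adjoint S.V (S.V f) = f := fun f =>
    ext_inner_left ℂ fun g => by rw [adjoint_inner_right, S.inner_V]
  have hVe : adjoint S.V S.e = 0 := by
    refine ext_inner_right ℂ fun g => ?_
    rw [adjoint_inner_left, S.inner_e_V, inner_zero_left]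
  -- Applying `V*` to the state equation removes `e`, which is orthogonal to the range of `V`, and
  -- leaves `(1 - A) V* x = -x - A x`. The matrix `1 - A` is invertible because `s = 1` is in the
  -- right half-plane.
  have heq : ∀ i, ∑ j, ((1 : Matrix (Fin n) (Fin n) ℂ) - toC A) i j • adjoint S.V (x j) ∈ F := by
    intro i
    have h1 := congrArg (adjoint S.V) (congrFun (act_pencil_solve S hA
      fun i => (2 * a i) • S.e) i)
    change adjoint S.V (act S.V (pencil A) x i) = _ at h1
    rw [act_pencil_apply, ← Complex.coe_smul, map_smul, hVe, smul_zero] at h1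
    simp only [map_sub, map_add, map_sum, hVV, ← Complex.coe_smul, map_smul] at h1
    have h2 : ∑ j, ((1 : Matrix (Fin n) (Fin n) ℂ) - toC A) i j • adjoint S.V (x j)
        = - x i - ∑ j, (A i j : ℂ) • x j := by
      simp only [Matrix.sub_apply, sub_smul, Finset.sum_sub_distrib, Matrix.one_apply, ite_smul,
        one_smul, zero_smul, Finset.sum_ite_eq, Finset.mem_univ, if_true, Matrix.map_apply]
      simp only [smul_sub, Finset.sum_sub_distrib] at h1
      rw [← sub_eq_zero, ← h1]
      abel
    rw [h2]
    refine F.sub_mem (F.neg_mem (Submodule.subset_span ⟨i, rfl⟩)) (F.sum_mem fun j _ =>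
      F.smul_mem _ (Submodule.subset_span ⟨j, rfl⟩))
  have hunit : IsUnit ((1 : Matrix (Fin n) (Fin n) ℂ) - toC A).det := by
    have := hA 1 (by simp)
    rw [one_smul] at this
    exact (Matrix.isUnit_iff_isUnit_det _).mp this
  have hgen : ∀ i, adjoint S.V (x i) ∈ F := by
    intro i
    have h1 : adjoint S.V (x i) = ∑ l, ((1 : Matrix (Fin n) (Fin n) ℂ) - toC A)⁻¹ i l •
        ∑ j, ((1 : Matrix (Fin n) (Fin n) ℂ) - toC A) l j • adjoint S.V (x j) := by
      simp_rw [Finset.smul_sum, smul_smul]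
      rw [Finset.sum_comm]
      simp_rw [← Finset.sum_smul, ← Matrix.mul_apply, Matrix.nonsing_inv_mul _ hunit]
      simp [Matrix.one_apply]
    rw [h1]
    exact F.sum_mem fun l _ => F.smul_mem _ (heq l)
  intro y hy
  have hle : F ≤ F.comap ((adjoint S.V : H →L[ℂ] H) : H →ₗ[ℂ] H) :=
    Submodule.span_le.mpr (by rintro _ ⟨i, rfl⟩; exact hgen i)
  exact hle hy

end Response

/-! ### Bounds for the quadratic form from the frequency condition. -/

section FrequencyBounds

open Polynomial ContinuousLinearMap

variable {H : Type*} [NormedAddCommGroup H] [InnerProductSpace ℂ H] [CompleteSpace H]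
  {n k q : ℕ} (S : ShiftModel H)

/-- Inputs of the first kind. -/
noncomputable def inputL : (Fin k → H) →L[ℂ] (Fin k ⊕ Fin q → H) :=
  ContinuousLinearMap.pi (Sum.elim (fun i => proj i) fun _ => 0)

/-- Inputs of the second kind. -/
noncomputable def inputR : (Fin q → H) →L[ℂ] (Fin k ⊕ Fin q → H) :=
  ContinuousLinearMap.pi (Sum.elim (fun _ => 0) fun i => proj i)

omit [CompleteSpace H] in
theorem inputL_add_inputR (v : Fin k → H) (w : Fin q → H) :
    inputL v + inputR w = Sum.elim v w := by
  ext (i | i) <;> simp [inputL, inputR]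

/-- The response to inputs of the first kind. -/
noncomputable def respL (A : Matrix (Fin n) (Fin n) ℝ) (B₁ : Matrix (Fin n) (Fin k) ℝ)
    (B₂ : Matrix (Fin n) (Fin q) ℝ) : (Fin k → H) →L[ℝ] (Fin n ⊕ (Fin k ⊕ Fin q) → H) :=
  (response S A (Matrix.fromCols B₁ B₂) ∘L inputL).restrictScalars ℝ

/-- The response to inputs of the second kind. -/
noncomputable def respR (A : Matrix (Fin n) (Fin n) ℝ) (B₁ : Matrix (Fin n) (Fin k) ℝ)
    (B₂ : Matrix (Fin n) (Fin q) ℝ) : (Fin q → H) →L[ℝ] (Fin n ⊕ (Fin k ⊕ Fin q) → H) :=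
  (response S A (Matrix.fromCols B₁ B₂) ∘L inputR).restrictScalars ℝ

theorem exists_respL_eq_act {A : Matrix (Fin n) (Fin n) ℝ} (hA : Hurwitz A)
    (B₁ : Matrix (Fin n) (Fin k) ℝ) (B₂ : Matrix (Fin n) (Fin q) ℝ) (v : Fin k → H) :
    ∃ v', respL S A B₁ B₂ v =
      act S.V ((fullMat A (Matrix.fromCols B₁ B₂)).submatrix id Sum.inl) v' := by
  obtain ⟨v', rfl⟩ := exists_eq_act_det S hA v
  refine ⟨v', ?_⟩
  have h1 : (inputL (q := q) (act S.V ((pencil A).det • (1 : Matrix (Fin k) (Fin k) ℂ[X])) v'))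
      = act S.V ((pencil A).det • (1 : Matrix (Fin k ⊕ Fin q) (Fin k ⊕ Fin q) ℂ[X]))
        (Sum.elim v' 0) := by
    ext (i | i) <;> simp [inputL, act_smul_one]
  have h2 : respL S A B₁ B₂ (act S.V ((pencil A).det • (1 : Matrix (Fin k) (Fin k) ℂ[X])) v')
      = response S A (Matrix.fromCols B₁ B₂) (inputL (q := q)
        (act S.V ((pencil A).det • (1 : Matrix (Fin k) (Fin k) ℂ[X])) v')) := rfl
  rw [h2, h1, response_det_smul S hA]
  ext i
  simp [act_apply]

theorem exists_respR_eq_act {A : Matrix (Fin n) (Fin n) ℝ} (hA : Hurwitz A)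
    (B₁ : Matrix (Fin n) (Fin k) ℝ) (B₂ : Matrix (Fin n) (Fin q) ℝ) (w : Fin q → H) :
    ∃ w', respR S A B₁ B₂ w =
      act S.V ((fullMat A (Matrix.fromCols B₁ B₂)).submatrix id Sum.inr) w' := by
  obtain ⟨w', rfl⟩ := exists_eq_act_det S hA w
  refine ⟨w', ?_⟩
  have h1 : (inputR (k := k) (act S.V ((pencil A).det • (1 : Matrix (Fin q) (Fin q) ℂ[X])) w'))
      = act S.V ((pencil A).det • (1 : Matrix (Fin k ⊕ Fin q) (Fin k ⊕ Fin q) ℂ[X]))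
        (Sum.elim 0 w') := by
    ext (i | i) <;> simp [inputR, act_smul_one]
  have h2 : respR S A B₁ B₂ (act S.V ((pencil A).det • (1 : Matrix (Fin q) (Fin q) ℂ[X])) w')
      = response S A (Matrix.fromCols B₁ B₂) (inputR (k := k)
        (act S.V ((pencil A).det • (1 : Matrix (Fin q) (Fin q) ℂ[X])) w')) := rfl
  rw [h2, h1, response_det_smul S hA]
  ext i
  simp [act_apply]

variable {A : Matrix (Fin n) (Fin n) ℝ} (hA : Hurwitz A) (B₁ : Matrix (Fin n) (Fin k) ℝ)
  (B₂ : Matrix (Fin n) (Fin q) ℝ)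
  {Q : Matrix (Fin n ⊕ (Fin k ⊕ Fin q)) (Fin n ⊕ (Fin k ⊕ Fin q)) ℝ}

omit [CompleteSpace H] in
theorem realForm_neg {ι : Type*} [Fintype ι] (Q : Matrix ι ι ℝ) (z z' : ι → H) :
    realForm H (-Q) z z' = -realForm H Q z z' := by
  simp [realForm_apply]

theorem symbol_neg {ι m : Type*} [Fintype ι] (Q : Matrix ι ι ℝ) (M : Matrix ι m ℂ[X]) (c : ℂ) :
    symbol (-Q) M c = -symbol Q M c := by
  ext i j
  simp [symbol_apply]

theorem cayley_inverse {s : ℂ} (hs : s.re = 0) :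
    ∃ c : ℂ, ‖c‖ = 1 ∧ c ≠ 1 ∧ (1 + c) / (1 - c) = s := by
  have h1 : s + 1 ≠ 0 := by
    intro h
    have := congrArg Complex.re h
    simp [hs] at this
  have h2 : 1 - (s - 1) / (s + 1) = 2 / (s + 1) := by field_simp; ring
  refine ⟨(s - 1) / (s + 1), ?_, ?_, ?_⟩
  · rw [norm_div, div_eq_one_iff_eq (norm_ne_zero_iff.mpr h1),
      ← sq_eq_sq₀ (norm_nonneg _) (norm_nonneg _), ← Complex.normSq_eq_norm_sq,
      ← Complex.normSq_eq_norm_sq, Complex.normSq_apply, Complex.normSq_apply]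
    simp [hs]
  · intro h
    rw [h, sub_self] at h2
    exact div_ne_zero two_ne_zero h1 h2.symm
  · rw [h2]
    field_simp
    ring

include hA in
/-- The consequences of the frequency condition for the quadratic forms. -/
theorem frequency_bounds (hQ : Q.IsSymm) (hfreq : MinimaxFrequencyCondition A B₁ B₂ Q)
    (a : Fin n → ℝ) :
    ∃ K : ℝ, 0 ≤ K ∧
      (∀ v, 0 ≤ realForm H Q (respL S A B₁ B₂ v) (respL S A B₁ B₂ v)) ∧
      (∀ w, 0 ≤ -realForm H Q (respR S A B₁ B₂ w) (respR S A B₁ B₂ w)) ∧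
      (∀ v w, |realForm H Q (respL S A B₁ B₂ v) (respR S A B₁ B₂ w)| ≤
        K * √(realForm H Q (respL S A B₁ B₂ v) (respL S A B₁ B₂ v)) *
          √(-realForm H Q (respR S A B₁ B₂ w) (respR S A B₁ B₂ w))) ∧
      (∀ v, |realForm H Q (Sum.elim (freeState S A a) 0) (respL S A B₁ B₂ v)| ≤
        K * √(realForm H Q (respL S A B₁ B₂ v) (respL S A B₁ B₂ v))) ∧
      (∀ w, |realForm H Q (Sum.elim (freeState S A a) 0) (respR S A B₁ B₂ w)| ≤
        K * √(-realForm H Q (respR S A B₁ B₂ w) (respR S A B₁ B₂ w))) := by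
  obtain ⟨ε, hε, s₀, hs₀, hpsd, hpd₁, hpd₂⟩ := hfreq
  set M := fullMat A (Matrix.fromCols B₁ B₂) with hM
  obtain ⟨c₀, hc₀, hc₀1, hcs⟩ := cayley_inverse hs₀
  have hχ : ∀ c : ℂ, ‖c‖ = 1 → (0 : ℂ) < ((‖(pencil A).det.eval c‖ ^ 2 : ℝ) : ℂ) := fun c hc => by
    have := norm_pos_iff.mpr (det_pencil_eval_ne_zero hA hc.le)
    exact Complex.zero_lt_real.mpr (by positivity)
  have hre : ∀ c : ℂ, ‖c‖ = 1 → ((1 + c) / (1 - c)).re = 0 := fun c hc => by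
    rw [cayley_re, hc]; simp
  have hsym : ∀ c : ℂ, ‖c‖ = 1 → c ≠ 1 → symbol Q M c = _ := fun c hc hc1 =>
    symbol_fullMat hA B₁ B₂ Q hc.le hc1
  have hblock : ∀ c, ‖c‖ = 1 → c ≠ 1 → (Matrix.fromBlocks (symbol Q M c).toBlocks₁₁
      ((ε : ℂ) • (symbol Q M c).toBlocks₁₂) ((ε : ℂ) • (symbol Q M c).toBlocks₂₁)
      (-(symbol Q M c).toBlocks₂₂)).PosSemidef := by
    intro c hc hc1
    have h := (hpsd _ (hre c hc)).smul (hχ c hc).le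
    convert h using 1
    rw [hsym c hc hc1]
    ext (i | i) (j | j) <;> simp [Matrix.toBlocks₁₁, Matrix.toBlocks₁₂, Matrix.toBlocks₂₁,
      Matrix.toBlocks₂₂, mul_left_comm]
  have hL : ∀ c, ‖c‖ = 1 → c ≠ 1 → (symbol Q (M.submatrix id Sum.inl) c).PosSemidef := by
    intro c hc hc1
    exact symbol_submatrix Q M Sum.inl c ▸ (hblock c hc hc1).submatrix Sum.inl
  have hR : ∀ c, ‖c‖ = 1 → c ≠ 1 → (symbol (-Q) (M.submatrix id Sum.inr) c).PosSemidef := by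
    intro c hc hc1
    rw [symbol_neg]
    exact symbol_submatrix Q M Sum.inr c ▸ (hblock c hc hc1).submatrix Sum.inr
  have hL0 : (symbol Q (M.submatrix id Sum.inl) c₀).PosDef := by
    rw [symbol_submatrix, hsym c₀ hc₀ hc₀1, hcs]
    exact hpd₁.smul (hχ c₀ hc₀)
  have hR0 : (symbol (-Q) (M.submatrix id Sum.inr) c₀).PosDef := by
    rw [symbol_neg, symbol_submatrix, hsym c₀ hc₀ hc₀1, hcs]
    have := hpd₂.smul (hχ c₀ hc₀)
    rw [smul_neg] at this
    exact this
  set F := Submodule.span ℂ (Set.range (freeState S A a))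
  have hFfin : FiniteDimensional ℂ F := FiniteDimensional.span_of_finite ℂ (Set.finite_range _)
  have hFinv := adjoint_mem_span_freeState S hA a
  have hz : ∀ i, (Sum.elim (freeState S A a) 0 : Fin n ⊕ (Fin k ⊕ Fin q) → H) i ∈ F := by
    rintro (i | i)
    · exact Submodule.subset_span ⟨i, rfl⟩
    · exact F.zero_mem
  obtain ⟨K₁, hK₁, h₁⟩ := exists_cross_bound S.inner_V S.eigen Q _ hL hc₀ hL0 hFinv _ hz
  obtain ⟨K₂, hK₂, h₂⟩ := exists_cross_bound S.inner_V S.eigen (-Q) _ hR hc₀ hR0 hFinv _ hz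
  simp only [realForm_neg, abs_neg] at h₂
  -- The block matrix of the frequency condition, transferred to `V` with weights `1`, `ε`, `-1` and
  -- `d = 0`.
  have hsum : ∀ v w, 0 ≤ realForm H Q (respL S A B₁ B₂ v) (respL S A B₁ B₂ v) +
      2 * (ε * realForm H Q (respL S A B₁ B₂ v) (respR S A B₁ B₂ w)) -
      realForm H Q (respR S A B₁ B₂ w) (respR S A B₁ B₂ w) := by
    intro v w
    have hsy := realForm_symm hQ (respL S A B₁ B₂ v) (respR S A B₁ B₂ w)
    obtain ⟨v', hv'⟩ := exists_respL_eq_act S hA B₁ B₂ v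
    obtain ⟨w', hw'⟩ := exists_respR_eq_act S hA B₁ B₂ w
    have h := weighted_form_ge_of_symbol S.inner_V Q M
      (Sum.elim (fun _ => Sum.elim (fun _ => 1) fun _ => ε)
        fun _ => Sum.elim (fun _ => ε) fun _ => -1) 0 (fun c hc hc1 => by
          convert hblock c hc hc1 using 1
          ext (i | i) (j | j) <;> simp [Matrix.toBlocks₁₁, Matrix.toBlocks₁₂, Matrix.toBlocks₂₁,
            Matrix.toBlocks₂₂]) (Sum.elim v' w')
    simp only [Fintype.sum_sum_type (α₁ := Fin k) (α₂ := Fin q), Sum.elim_inl, Sum.elim_inr,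
      ← Finset.mul_sum, Finset.sum_add_distrib, one_mul, neg_mul, Finset.sum_neg_distrib] at h
    have e1 := realForm_act (V := S.V) Q (M.submatrix id Sum.inl) (M.submatrix id Sum.inl) v' v'
    have e2 := realForm_act (V := S.V) Q (M.submatrix id Sum.inl) (M.submatrix id Sum.inr) v' w'
    have e3 := realForm_act (V := S.V) Q (M.submatrix id Sum.inr) (M.submatrix id Sum.inl) w' v'
    have e4 := realForm_act (V := S.V) Q (M.submatrix id Sum.inr) (M.submatrix id Sum.inr) w' w'
    simp only [Matrix.submatrix_apply, id] at e1 e2 e3 e4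
    rw [← e1, ← e2, ← e3, ← e4, ← hv', ← hw', ← hsy] at h
    have h0 : (0 : ℝ) ≤ ∑ i, ‖aeval S.V (0 : ℂ[X]) (v' i)‖ ^ 2 +
      ∑ i, ‖aeval S.V (0 : ℂ[X]) (w' i)‖ ^ 2 := by positivity
    linarith
  have hp : ∀ v, 0 ≤ realForm H Q (respL S A B₁ B₂ v) (respL S A B₁ B₂ v) := fun v => by
    simpa using hsum v 0
  have hr : ∀ w, 0 ≤ -realForm H Q (respR S A B₁ B₂ w) (respR S A B₁ B₂ w) := fun w => by
    simpa using hsum 0 w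
  refine ⟨ε⁻¹ + K₁ + K₂, by positivity, hp, hr, fun v w => ?_, fun v => ?_, fun w => ?_⟩
  · set P := realForm H Q (respL S A B₁ B₂ v) (respL S A B₁ B₂ v) with hPdef
    set R := -realForm H Q (respR S A B₁ B₂ w) (respR S A B₁ B₂ w) with hRdef
    set b := realForm H Q (respL S A B₁ B₂ v) (respR S A B₁ B₂ w) with hbdef
    -- Cauchy–Schwarz for the form weighted by `ε`: scaling `v` gives a nonnegative quadratic
    -- polynomial in `t`, whence `ε |b| ≤ √P √R`.
    have hd := discrim_le_zero (a := P) (b := 2 * (ε * b)) (c := R) fun t => by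
      have := hsum (t • v) w
      simp only [map_smul, LinearMap.smul_apply, smul_eq_mul, ← hPdef, ← hbdef] at this
      rw [hRdef]
      linarith
    have h1 : (ε * |b|) ^ 2 ≤ P * R := by
      rw [discrim] at hd
      rw [mul_pow, sq_abs]
      nlinarith
    have h2 : ε * |b| ≤ √P * √R := by
      rw [← Real.sqrt_mul (hp v)]
      exact Real.le_sqrt_of_sq_le h1
    have h3 : |b| ≤ ε⁻¹ * (√P * √R) := by
      rw [← div_eq_inv_mul, le_div_iff₀ hε]; linarith
    have h4 : 0 ≤ √P * √R := by positivity
    nlinarith [mul_nonneg hK₁ h4, mul_nonneg hK₂ h4]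
  · obtain ⟨v', hv'⟩ := exists_respL_eq_act S hA B₁ B₂ v
    have h := h₁ v'
    rw [← hv'] at h
    refine h.trans ?_
    gcongr
    linarith [inv_pos.mpr hε]
  · obtain ⟨w', hw'⟩ := exists_respR_eq_act S hA B₁ B₂ w
    have h := h₂ w'
    rw [← hw'] at h
    refine h.trans ?_
    gcongr
    linarith [inv_pos.mpr hε]

end FrequencyBounds

/-! ### Domination by the output and minimum phase systems. -/

section Robust

open Polynomial ContinuousLinearMap

variable {H : Type*} [NormedAddCommGroup H] [InnerProductSpace ℂ H]

/-- The value on `z` of the linear map with real matrix `F`. -/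
noncomputable def output {κ ι : Type*} [Fintype ι] (F : Matrix κ ι ℝ) (z : ι → H) (l : κ) : H :=
  ∑ i, F l i • z i

theorem realForm_transpose_mul_self {κ ι : Type*} [Fintype ι] [Fintype κ] (F : Matrix κ ι ℝ)
    (z : ι → H) : realForm H (Fᵀ * F) z z = ∑ l, ‖output F z l‖ ^ 2 := by
  have h : ∀ l, ‖output F z l‖ ^ 2 = ∑ i, ∑ j, F l i * F l j * (inner ℂ (z i) (z j)).re := by
    intro l
    rw [@norm_sq_eq_re_inner ℂ]
    simp only [output, ← Complex.coe_smul, sum_inner, inner_sum, inner_smul_left,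
      inner_smul_right, Complex.conj_ofReal, RCLike.re_to_complex, Complex.re_sum,
      Complex.re_ofReal_mul, Finset.mul_sum]
    rw [Finset.sum_comm]
    refine Finset.sum_congr rfl fun i _ => Finset.sum_congr rfl fun j _ => by ring
  simp_rw [h]
  rw [realForm_apply]
  simp only [Matrix.mul_apply, Matrix.transpose_apply, Finset.sum_mul]
  rw [Finset.sum_congr rfl fun i _ => Finset.sum_comm, Finset.sum_comm]

/-- Only the symmetric part of `N` contributes. It factors as `Bᴴ * B` over the reals, and the same
factorization gives a sum of squared norms over `H`. -/
theorem realForm_nonneg {ι : Type*} [Fintype ι] {N : Matrix ι ι ℝ}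
    (hN : ∀ y : ι → ℝ, 0 ≤ y ⬝ᵥ N *ᵥ y) (z : ι → H) : 0 ≤ realForm H N z z := by
  classical
  have hpsd : (N + Nᵀ).PosSemidef := by
    refine Matrix.PosSemidef.of_dotProduct_mulVec_nonneg ?_ fun y => ?_
    · rw [Matrix.IsHermitian, Matrix.conjTranspose_eq_transpose_of_trivial, Matrix.transpose_add,
        Matrix.transpose_transpose, add_comm]
    · have h1 : y ⬝ᵥ Nᵀ *ᵥ y = y ⬝ᵥ N *ᵥ y := by
        rw [Matrix.mulVec_transpose, dotProduct_comm, ← Matrix.dotProduct_mulVec]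
      rw [star_trivial, Matrix.add_mulVec, dotProduct_add, h1]
      linarith [hN y]
  obtain ⟨B, hB⟩ : ∃ B : Matrix ι ι ℝ, N + Nᵀ = Bᴴ * B := by
    open scoped MatrixOrder in
    exact CStarAlgebra.nonneg_iff_eq_star_mul_self.mp hpsd.nonneg
  have h1 : realForm H Nᵀ z z = realForm H N z z := by
    rw [realForm_apply, realForm_apply, Finset.sum_comm]
    refine Finset.sum_congr rfl fun i _ => Finset.sum_congr rfl fun j _ => ?_
    rw [Matrix.transpose_apply, ← inner_conj_symm, Complex.conj_re]
  have h2 : realForm H (N + Nᵀ) z z = realForm H N z z + realForm H Nᵀ z z := by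
    simp [realForm_apply, add_mul, Finset.sum_add_distrib]
  have h3 : realForm H (N + Nᵀ) z z = ∑ l, ‖output B z l‖ ^ 2 := by
    rw [hB, Matrix.conjTranspose_eq_transpose_of_trivial, realForm_transpose_mul_self]
  have h4 : 0 ≤ realForm H (N + Nᵀ) z z := h3 ▸ by positivity
  linarith

theorem realForm_le_output {κ ι : Type*} [Fintype ι] [Fintype κ] {Q : Matrix ι ι ℝ}
    {F : Matrix κ ι ℝ} (hF : ∀ y : ι → ℝ, y ⬝ᵥ Q *ᵥ y ≤ (F *ᵥ y) ⬝ᵥ (F *ᵥ y)) (z : ι → H) :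
    realForm H Q z z ≤ ∑ l, ‖output F z l‖ ^ 2 := by
  have h1 := realForm_nonneg (N := Fᵀ * F - Q) (fun y => by
    have h2 : y ⬝ᵥ (Fᵀ * F) *ᵥ y = (F *ᵥ y) ⬝ᵥ (F *ᵥ y) := by
      rw [← Matrix.mulVec_mulVec, Matrix.dotProduct_mulVec, Matrix.vecMul_transpose]
    rw [Matrix.sub_mulVec, dotProduct_sub, h2]
    linarith [hF y]) z
  have h2 : realForm H (Fᵀ * F - Q) z z = realForm H (Fᵀ * F) z z - realForm H Q z z := by
    simp [realForm_apply, sub_mul, Finset.sum_sub_distrib]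
  linarith [realForm_transpose_mul_self F z]

variable [CompleteSpace H] {n k q : ℕ} (S : ShiftModel H)

/-- The Rosenbrock matrix of the outer factor, with `1 / (s + 1)` in terms of `X`. -/
noncomputable def rosenbrock (A : Matrix (Fin n) (Fin n) ℝ) (B₁ : Matrix (Fin n) (Fin k) ℝ)
    (C₁ : Matrix (Fin k) (Fin n) ℝ) (D₁ : Matrix (Fin k) (Fin k) ℝ) :
    Matrix (Fin n ⊕ Fin k) (Fin n ⊕ Fin k) ℂ[X] :=
  Matrix.fromBlocks (-pencil A) (inputMat B₁) ((toC C₁).map C) ((toC D₁).map C)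

/-- At `c` in the open disc the matrix equals the Rosenbrock matrix at `s = (1 + c)/(1 - c)`, `Re s
> 0`, with its state rows multiplied by `1 - c ≠ 0`. -/
theorem one_le_norm_of_isRoot_rosenbrock {A : Matrix (Fin n) (Fin n) ℝ}
    {B₁ : Matrix (Fin n) (Fin k) ℝ} {C₁ : Matrix (Fin k) (Fin n) ℝ}
    {D₁ : Matrix (Fin k) (Fin k) ℝ}
    (hdet : ∀ s : ℂ, 0 < s.re →
        (Matrix.fromBlocks (toC A - s • (1 : Matrix (Fin n) (Fin n) ℂ)) (toC B₁)
          (toC C₁) (toC D₁)).det ≠ 0) {c : ℂ} (hc : (rosenbrock A B₁ C₁ D₁).det.IsRoot c) :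
    1 ≤ ‖c‖ := by
  by_contra h
  push Not at h
  have hc1 : c ≠ 1 := by rintro rfl; simp at h
  have hsub : 1 - c ≠ 0 := sub_ne_zero.mpr hc1.symm
  set s := (1 + c) / (1 - c) with hs
  have hre : 0 < s.re := by
    rw [hs, cayley_re]
    exact div_pos (by nlinarith [norm_nonneg c]) (Complex.normSq_pos.mpr hsub)
  have h1 : evalMat (rosenbrock A B₁ C₁ D₁) c =
      Matrix.fromBlocks ((1 - c) • (1 : Matrix (Fin n) (Fin n) ℂ)) 0 0
        (1 : Matrix (Fin k) (Fin k) ℂ) *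
      Matrix.fromBlocks (toC A - s • (1 : Matrix (Fin n) (Fin n) ℂ)) (toC B₁)
          (toC C₁) (toC D₁) := by
    rw [Matrix.fromBlocks_multiply]
    simp only [Matrix.smul_mul, Matrix.one_mul, Matrix.zero_mul, add_zero, zero_add]
    rw [← evalMat_inputMat, ← neg_sub (s • 1) (toC A), smul_neg, ← evalMat_pencil A hc1]
    ext (i | i) (j | j) <;> simp [rosenbrock, evalMat]
  have h2 := congrArg Matrix.det h1
  rw [det_evalMat, Matrix.det_mul, Matrix.det_fromBlocks_zero₂₁, Matrix.det_one, mul_one,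
    Matrix.det_smul, Matrix.det_one, mul_one, hc.eq_zero] at h2
  exact mul_ne_zero (pow_ne_zero _ hsub) (hdet s hre) h2.symm

/-- The output of a minimum phase system can be made to approximate any given signal. -/
theorem exists_output_approx {A : Matrix (Fin n) (Fin n) ℝ} (hA : Hurwitz A)
    (B₁ : Matrix (Fin n) (Fin k) ℝ) (C₁ : Matrix (Fin k) (Fin n) ℝ) (D₁ : Matrix (Fin k) (Fin k) ℝ)
    (hdet : ∀ s : ℂ, 0 < s.re →
        (Matrix.fromBlocks (toC A - s • (1 : Matrix (Fin n) (Fin n) ℂ)) (toC B₁)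
          (toC C₁) (toC D₁)).det ≠ 0) (y : Fin k → H) {η : ℝ} (hη : 0 < η) :
    ∃ v : Fin k → H, ∀ l,
      ‖output C₁ (solve S A (act S.V (inputMat B₁) v)) l + output D₁ v l - y l‖ < η := by
  set δ := (rosenbrock A B₁ C₁ D₁).det with hδ
  have hroot : ∀ r, δ.IsRoot r → 1 ≤ ‖r‖ := fun r hr => one_le_norm_of_isRoot_rosenbrock hdet hr
  have hδ0 : δ ≠ 0 := fun h => by
    have := hroot 0 (by simp [h])
    norm_num at this
  have happ := fun l => dense_range_of_adjoint_injective (T := aeval S.V δ)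
    (fun g hg => adjoint_aeval_injective S.norm_V S.eigen hδ0 hroot hg) (y l) hη
  choose y' hy' using happ
  -- Cramer's rule again: the upper rows of the resulting system are the state equation from rest,
  -- the lower rows say that the output is `δ(V) y'`, which was chosen close to `y`.
  set xv := act S.V (rosenbrock A B₁ C₁ D₁).adjugate (Sum.elim 0 y') with hxv
  have h1 : act S.V (rosenbrock A B₁ C₁ D₁) xv =
      act S.V (δ • (1 : Matrix (Fin n ⊕ Fin k) (Fin n ⊕ Fin k) ℂ[X])) (Sum.elim 0 y') := by
    rw [hxv, ← act_mul, Matrix.mul_adjugate]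
  set x : Fin n → H := fun i => xv (Sum.inl i)
  set v : Fin k → H := fun i => xv (Sum.inr i)
  have h2 : act S.V (pencil A) x = act S.V (inputMat B₁) v := by
    ext i
    have h3 := congrFun h1 (Sum.inl i)
    rw [act_smul_one, act_apply, Fintype.sum_sum_type] at h3
    simp only [rosenbrock, Matrix.fromBlocks_apply₁₁, Matrix.fromBlocks_apply₁₂,
      Sum.elim_inl, Pi.zero_apply, map_zero, Matrix.neg_apply, map_neg, neg_apply,
      Finset.sum_neg_distrib] at h3
    rw [act_apply, act_apply]
    exact neg_add_eq_zero.mp h3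
  have h3 : solve S A (act S.V (inputMat B₁) v) = x := by
    apply act_pencil_injective S hA
    rw [act_pencil_solve S hA, h2]
  refine ⟨v, fun l => ?_⟩
  have h4 := congrFun h1 (Sum.inr l)
  rw [act_smul_one, act_apply, Fintype.sum_sum_type] at h4
  simp only [rosenbrock, Matrix.fromBlocks_apply₂₁, Matrix.fromBlocks_apply₂₂,
    Sum.elim_inr, Matrix.map_apply, aeval_C, Algebra.algebraMap_eq_smul_one, smul_apply,
    one_apply_eq_self, Complex.coe_smul] at h4
  rw [h3, output, output, h4]
  exact hy' l

end Robust

/-! ### The robust input in an abstract shift model. -/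

section Core

open Polynomial ContinuousLinearMap

variable {H : Type*} [NormedAddCommGroup H] [InnerProductSpace ℂ H] {n k q : ℕ}
  (S : ShiftModel H)

/-- The state equation `ẋ = A x + B₁ v + B₂ w`, `x(0) = a`, multiplied by `2 / (s + 1)`. -/
def StateEq (A : Matrix (Fin n) (Fin n) ℝ) (B₁ : Matrix (Fin n) (Fin k) ℝ)
    (B₂ : Matrix (Fin n) (Fin q) ℝ) (a : Fin n → ℝ) (v : Fin k → H) (w : Fin q → H)
    (x : Fin n → H) : Prop :=
  ∀ i, x i + S.V (x i) - ∑ j, A i j • (x j - S.V (x j)) =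
    ∑ j, B₁ i j • (v j - S.V (v j)) + ∑ j, B₂ i j • (w j - S.V (w j)) + (2 * a i) • S.e

theorem stateEq_iff {A : Matrix (Fin n) (Fin n) ℝ} {B₁ : Matrix (Fin n) (Fin k) ℝ}
    {B₂ : Matrix (Fin n) (Fin q) ℝ} {a : Fin n → ℝ} {v : Fin k → H} {w : Fin q → H}
    {x : Fin n → H} : StateEq S A B₁ B₂ a v w x ↔ act S.V (pencil A) x =
      act S.V (inputMat (Matrix.fromCols B₁ B₂)) (Sum.elim v w) +
        fun i => (2 * a i) • S.e := by
  simp [StateEq, funext_iff, act_pencil_apply, act_inputMat_apply]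

theorem StateEq.conj {A : Matrix (Fin n) (Fin n) ℝ} {B₁ : Matrix (Fin n) (Fin k) ℝ}
    {B₂ : Matrix (Fin n) (Fin q) ℝ} {a : Fin n → ℝ} {v : Fin k → H} {w : Fin q → H}
    {x : Fin n → H} (h : StateEq S A B₁ B₂ a v w x) :
    StateEq S A B₁ B₂ a (fun i => S.conj (v i)) (fun i => S.conj (w i))
      (fun i => S.conj (x i)) := by
  intro i
  have := congrArg S.conj (h i)
  simpa only [map_add, map_sub, map_sum, map_smul, S.conj_V, S.conj_e] using this

variable [CompleteSpace H]

theorem exists_stateEq {A : Matrix (Fin n) (Fin n) ℝ} (hA : Hurwitz A)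
    (B₁ : Matrix (Fin n) (Fin k) ℝ) (B₂ : Matrix (Fin n) (Fin q) ℝ) (a : Fin n → ℝ)
    (v : Fin k → H) (w : Fin q → H) : ∃ x, StateEq S A B₁ B₂ a v w x :=
  ⟨_, (stateEq_iff S).mpr (act_pencil_solve S hA _)⟩

theorem StateEq.unique {A : Matrix (Fin n) (Fin n) ℝ} (hA : Hurwitz A)
    {B₁ : Matrix (Fin n) (Fin k) ℝ} {B₂ : Matrix (Fin n) (Fin q) ℝ} {a : Fin n → ℝ}
    {v : Fin k → H} {w : Fin q → H} {x x' : Fin n → H} (h : StateEq S A B₁ B₂ a v w x)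
    (h' : StateEq S A B₁ B₂ a v w x') : x = x' :=
  act_pencil_injective S hA (((stateEq_iff S).mp h).trans ((stateEq_iff S).mp h').symm)

/-- Superposition. It turns the value of the form along a trajectory into the functional treated by
`quadratic_minimax`. -/
theorem StateEq.eq_response {A : Matrix (Fin n) (Fin n) ℝ} (hA : Hurwitz A)
    {B₁ : Matrix (Fin n) (Fin k) ℝ} {B₂ : Matrix (Fin n) (Fin q) ℝ} {a : Fin n → ℝ}
    {v : Fin k → H} {w : Fin q → H} {x : Fin n → H} (h : StateEq S A B₁ B₂ a v w x) :
    Sum.elim x (Sum.elim v w) =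
      respL S A B₁ B₂ v + respR S A B₁ B₂ w + Sum.elim (freeState S A a) 0 := by
  have h1 : x = solve S A (act S.V (inputMat (Matrix.fromCols B₁ B₂)) (Sum.elim v w)) +
      freeState S A a := by
    apply act_pencil_injective S hA
    rw [(stateEq_iff S).mp h, map_add, act_pencil_solve S hA, freeState, act_pencil_solve S hA]
  have h2 : respL S A B₁ B₂ v + respR S A B₁ B₂ w =
      response S A (Matrix.fromCols B₁ B₂) (Sum.elim v w) := by
    rw [← inputL_add_inputR, map_add]; rfl
  rw [h2, response_apply]
  ext (i | i)
  · simp [h1]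
  · simp

omit [CompleteSpace H] in
theorem output_add {κ ι : Type*} [Fintype ι] (F : Matrix κ ι ℝ) (z z' : ι → H) (l : κ) :
    output F (z + z') l = output F z l + output F z' l := by
  simp [output, Finset.sum_add_distrib]

theorem exists_form_le {A : Matrix (Fin n) (Fin n) ℝ} (hA : Hurwitz A)
    (B₁ : Matrix (Fin n) (Fin k) ℝ) (B₂ : Matrix (Fin n) (Fin q) ℝ)
    {Q : Matrix (Fin n ⊕ (Fin k ⊕ Fin q)) (Fin n ⊕ (Fin k ⊕ Fin q)) ℝ}
    (C₁ : Matrix (Fin k) (Fin n) ℝ) (D₁ : Matrix (Fin k) (Fin k) ℝ) (D₂ : Matrix (Fin k) (Fin q) ℝ)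
    (hle : ∀ (x : Vec n) (v : Vec k) (w : Vec q),
        quadForm Q x v w ≤ ‖mv C₁ x + mv D₁ v + mv D₂ w‖ ^ 2)
    (hdet : ∀ s : ℂ, 0 < s.re →
        (Matrix.fromBlocks (toC A - s • (1 : Matrix (Fin n) (Fin n) ℂ)) (toC B₁)
          (toC C₁) (toC D₁)).det ≠ 0)
    (y : Fin n ⊕ (Fin k ⊕ Fin q) → H) {δ : ℝ} (hδ : 0 < δ) :
    ∃ v, realForm H Q (respL S A B₁ B₂ v + y) (respL S A B₁ B₂ v + y) ≤ δ := by
  set F := Matrix.fromCols C₁ (Matrix.fromCols D₁ D₂) with hF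
  have hF' : ∀ y : Fin n ⊕ (Fin k ⊕ Fin q) → ℝ, y ⬝ᵥ Q *ᵥ y ≤ (F *ᵥ y) ⬝ᵥ (F *ᵥ y) := by
    intro y
    have h1 := hle (WithLp.toLp 2 (y ∘ Sum.inl)) (WithLp.toLp 2 (y ∘ Sum.inr ∘ Sum.inl))
      (WithLp.toLp 2 (y ∘ Sum.inr ∘ Sum.inr))
    have h2 : (Sum.elim (y ∘ Sum.inl) (Sum.elim (y ∘ Sum.inr ∘ Sum.inl)
        (y ∘ Sum.inr ∘ Sum.inr)) : Fin n ⊕ (Fin k ⊕ Fin q) → ℝ) = y := by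
      ext (i | i | i) <;> rfl
    rw [quadForm, h2, EuclideanSpace.norm_sq_eq] at h1
    refine h1.trans (le_of_eq ?_)
    rw [dotProduct]
    refine Finset.sum_congr rfl fun l _ => ?_
    simp only [hF, Real.norm_eq_abs, sq_abs, Matrix.fromCols_mulVec, PiLp.add_apply, Pi.add_apply]
    simp only [Function.comp_assoc]
    ring
  -- Each of the `k` outputs contributes at most `δ / (k + 1)`; the `+ 1` covers `k = 0`.
  set η := √(δ / (k + 1)) with hη
  have hη0 : 0 < η := by positivity
  -- The input steers the output to nearly cancel the contribution of `y`, that is, of the second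
  -- input and the initial state.
  obtain ⟨v, hv⟩ := exists_output_approx S hA B₁ C₁ D₁ hdet (fun l => -output F y l) hη0
  refine ⟨v, (realForm_le_output hF' _).trans ?_⟩
  have h1 : ∀ l, output F (respL S A B₁ B₂ v) l =
      output C₁ (solve S A (act S.V (inputMat B₁) v)) l + output D₁ v l := by
    intro l
    have h2 : respL S A B₁ B₂ v = Sum.elim (solve S A (act S.V (inputMat B₁) v))
        (Sum.elim v 0) := by
      have h3 : respL S A B₁ B₂ v = response S A (Matrix.fromCols B₁ B₂) (inputL v) := rfl
      have h4 : (inputL v : Fin k ⊕ Fin q → H) = Sum.elim v 0 := by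
        ext (i | i) <;> simp [inputL]
      rw [h3, response_apply, h4]
      congr 2
      ext i
      simp [act_inputMat_apply]
    rw [h2]
    simp [output, hF]
  have h2 : ∀ l, ‖output F (respL S A B₁ B₂ v + y) l‖ ^ 2 ≤ δ / (k + 1) := by
    intro l
    rw [output_add, h1, ← sub_neg_eq_add, ← Real.sq_sqrt (by positivity : 0 ≤ δ / (k + 1))]
    exact pow_le_pow_left₀ (norm_nonneg _) (hv l).le 2
  refine (Finset.sum_le_sum fun l _ => h2 l).trans ?_
  rw [Finset.sum_const, Finset.card_univ, Fintype.card_fin, nsmul_eq_mul, mul_div_assoc',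
    div_le_iff₀ (by positivity)]
  nlinarith

omit [CompleteSpace H] in
theorem realForm_conj {ι : Type*} [Fintype ι] (Q : Matrix ι ι ℝ) (z z' : ι → H) :
    realForm H Q (fun i => S.conj (z i)) (fun i => S.conj (z' i)) = realForm H Q z z' := by
  simp only [realForm_apply, S.inner_conj]

/-- From every state there is a real input `v`, such that for all inputs near `v` the
value of the quadratic functional is at most `δ`, whatever the other input. -/
theorem exists_robust_input {A : Matrix (Fin n) (Fin n) ℝ} (hA : Hurwitz A)
    (B₁ : Matrix (Fin n) (Fin k) ℝ) (B₂ : Matrix (Fin n) (Fin q) ℝ)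
    {Q : Matrix (Fin n ⊕ (Fin k ⊕ Fin q)) (Fin n ⊕ (Fin k ⊕ Fin q)) ℝ} (hQ : Q.IsSymm)
    (hfreq : MinimaxFrequencyCondition A B₁ B₂ Q)
    (C₁ : Matrix (Fin k) (Fin n) ℝ) (D₁ : Matrix (Fin k) (Fin k) ℝ) (D₂ : Matrix (Fin k) (Fin q) ℝ)
    (hle : ∀ (x : Vec n) (v : Vec k) (w : Vec q),
        quadForm Q x v w ≤ ‖mv C₁ x + mv D₁ v + mv D₂ w‖ ^ 2)
    (hdet : ∀ s : ℂ, 0 < s.re →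
        (Matrix.fromBlocks (toC A - s • (1 : Matrix (Fin n) (Fin n) ℂ)) (toC B₁)
          (toC C₁) (toC D₁)).det ≠ 0)
    (a : Fin n → ℝ) {δ : ℝ} (hδ : 0 < δ) :
    ∃ v : Fin k → H, (∀ i, S.conj (v i) = v i) ∧ ∃ ρ : ℝ, 0 < ρ ∧ ∀ v' w x,
      (∀ i, S.conj (v' i) = v' i) → (∀ i, S.conj (w i) = w i) → ‖v' - v‖ ≤ ρ →
      StateEq S A B₁ B₂ a v' w x →
      realForm H Q (Sum.elim x (Sum.elim v' w)) (Sum.elim x (Sum.elim v' w)) ≤ δ := by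
  obtain ⟨K, hK, hp, hr, hb, hl₁, hl₂⟩ := frequency_bounds S hA B₁ B₂ hQ hfreq a
  set Φ := realForm H Q
  set L := respL S A B₁ B₂
  set R := respR S A B₁ B₂
  set zf : Fin n ⊕ (Fin k ⊕ Fin q) → H := Sum.elim (freeState S A a) 0
  set J : (Fin k → H) → (Fin q → H) → ℝ := fun v w => Φ (L v + R w + zf) (L v + R w + zf) with hJ
  have hΦ : ∀ z z', Φ z z' = Φ z' z := realForm_symm hQ
  have hexp : ∀ v w, Φ (L v) (L v) + 2 * Φ (L v) (R w) - -Φ (R w) (R w) + 2 * Φ zf (L v) +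
      2 * Φ zf (R w) + Φ zf zf = J v w := by
    intro v w
    simp only [hJ, map_add, LinearMap.add_apply]
    rw [hΦ (R w) (L v), hΦ (L v) zf, hΦ (R w) zf]
    ring
  obtain ⟨v₀, ρ, hρ, hv₀⟩ : ∃ (v₀ : Fin k → H) (ρ : ℝ), 0 < ρ ∧
      ∀ v, ‖v - v₀‖ ≤ ρ → ∀ w, J v w ≤ δ := by
    set K' := max K ((∑ i, ∑ j, |Q i j|) * ‖L‖ ^ 2)
    have hKK : K ≤ K' := le_max_left _ _
    obtain ⟨v₀, ρ, hρ, h⟩ := quadratic_minimax (U := Fin k → H) (W := Fin q → H)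
      (Φ.compl₁₂ L.toLinearMap L.toLinearMap) (-Φ.compl₁₂ R.toLinearMap R.toLinearMap)
      (Φ.compl₁₂ L.toLinearMap R.toLinearMap) (Φ zf ∘ₗ L.toLinearMap) (Φ zf ∘ₗ R.toLinearMap)
      (Φ zf zf) (K := K') (hK.trans hKK) (fun _ _ => hΦ _ _) hp
      (fun _ _ => congrArg Neg.neg (hΦ _ _)) hr
      (fun v => by
        refine (le_abs_self _).trans ((abs_realForm_le Q _ _).trans ?_)
        have h1 : ‖L v‖ * ‖L v‖ ≤ (‖L‖ * ‖v‖) * (‖L‖ * ‖v‖) :=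
          mul_le_mul (L.le_opNorm v) (L.le_opNorm v) (norm_nonneg _) (by positivity)
        calc _ ≤ (∑ i, ∑ j, |Q i j|) * ((‖L‖ * ‖v‖) * (‖L‖ * ‖v‖)) :=
            mul_le_mul_of_nonneg_left h1 (Finset.sum_nonneg fun _ _ =>
              Finset.sum_nonneg fun _ _ => abs_nonneg _)
          _ = ((∑ i, ∑ j, |Q i j|) * ‖L‖ ^ 2) * ‖v‖ ^ 2 := by ring
          _ ≤ _ := by gcongr; exact le_max_right _ _)
      (fun v w => (hb v w).trans (by gcongr; exact le_rfl; exact le_rfl))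
      (fun v => (hl₁ v).trans (by gcongr; exact le_rfl))
      (fun w => (hl₂ w).trans (by gcongr; exact le_rfl))
      (fun w ε hε => by
        obtain ⟨v, hv⟩ := exists_form_le S hA B₁ B₂ C₁ D₁ D₂ hle hdet (R w + zf) hε
        refine ⟨v, le_trans (le_of_eq ?_) hv⟩
        rw [← add_assoc]
        exact hexp v w) hδ
    exact ⟨v₀, ρ, hρ, fun v hv w => (hexp v w).symm.le.trans (h v hv w)⟩
  have hJx : ∀ {v w x}, StateEq S A B₁ B₂ a v w x →
      Φ (Sum.elim x (Sum.elim v w)) (Sum.elim x (Sum.elim v w)) = J v w := by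
    intro v w x h
    rw [h.eq_response S hA]
  have hJconj : ∀ v w, J (fun i => S.conj (v i)) (fun i => S.conj (w i)) = J v w := by
    intro v w
    obtain ⟨x, hx⟩ := exists_stateEq S hA B₁ B₂ a v w
    rw [← hJx hx, ← hJx (hx.conj S)]
    refine Eq.trans ?_ (realForm_conj S Q _ _)
    congr 2 <;> ext (i | i | i) <;> rfl
  have hconv : ∀ v v' w, J ((2 : ℝ)⁻¹ • (v + v')) w ≤ 2⁻¹ * (J v w + J v' w) := by
    intro v v' w
    have h1 := hp (v - v')
    simp only [hJ, map_add, map_sub, map_smul, LinearMap.add_apply, LinearMap.sub_apply,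
      LinearMap.smul_apply, smul_eq_mul] at h1 ⊢
    linarith
  -- The minimax input may be complex. The functional is convex in `v` and invariant under
  -- conjugation, so its real part, the mean of `v₀` and `v₁`, serves equally well for real
  -- perturbations and real `w`.
  set v₁ : Fin k → H := fun i => S.conj (v₀ i) with hv₁
  refine ⟨(2 : ℝ)⁻¹ • (v₀ + v₁), fun i => ?_, ρ, hρ, fun v' w x hv' hw hdist hx => ?_⟩
  · simp [hv₁, S.conj_conj, add_comm]
  · rw [hJx hx]
    set h := v' - (2 : ℝ)⁻¹ • (v₀ + v₁) with hh
    have hhc : ∀ i, S.conj (h i) = h i := by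
      intro i
      simp [hh, hv₁, hv', S.conj_conj, add_comm]
    have h1 : v' = (2 : ℝ)⁻¹ • ((v₀ + h) + (v₁ + h)) := by
      have h2 : (v₀ + h) + (v₁ + h) = (v₀ + v₁) + (2 : ℝ) • h := by rw [two_smul]; abel
      rw [h2, smul_add, smul_smul, hh]
      simp
    have h2 : J (v₀ + h) w ≤ δ := hv₀ _ (by simpa using hdist) w
    have h3 : J (v₁ + h) w = J (v₀ + h) w := by
      rw [← hJconj (v₀ + h) w]
      congr 1
      · ext i; simp [hv₁, hhc]
      · ext i; simp [hw]
    rw [h1]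
    linarith [hconv (v₀ + h) (v₁ + h) w]

end Core

/-! ### Lebesgue measure on the time axis and its translations. -/

section TimeAxis

theorem measurableEmbedding_coe : MeasurableEmbedding ((↑) : ℝ≥0 → ℝ) :=
  MeasurableEmbedding.subtype_coe measurableSet_Ici

theorem leb_apply (s : Set ℝ≥0) : leb s = volume (((↑) : ℝ≥0 → ℝ) '' s) :=
  measurableEmbedding_coe.comap_apply _ _

theorem map_coe_leb : leb.map ((↑) : ℝ≥0 → ℝ) = volume.restrict (Set.Ici 0) := by
  rw [leb, measurableEmbedding_coe.map_comap, NNReal.range_coe]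

theorem map_coe_leb_Iic (T : ℝ≥0) :
    (leb.restrict (Set.Iic T)).map ((↑) : ℝ≥0 → ℝ) = volume.restrict (Set.Icc 0 (T : ℝ)) := by
  have h : Set.Iic T = ((↑) : ℝ≥0 → ℝ) ⁻¹' Set.Iic (T : ℝ) := by ext; simp
  rw [h, ← measurableEmbedding_coe.restrict_map, map_coe_leb,
    Measure.restrict_restrict measurableSet_Iic, Set.inter_comm, Set.Ici_inter_Iic]

theorem leb_Iic (T : ℝ≥0) : leb (Set.Iic T) = ENNReal.ofReal T := by
  have h : ((↑) : ℝ≥0 → ℝ) '' Set.Iic T = Set.Icc 0 (T : ℝ) := by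
    ext x
    constructor
    · rintro ⟨y, hy, rfl⟩
      exact ⟨y.2, by exact_mod_cast hy⟩
    · rintro ⟨h0, h1⟩
      exact ⟨⟨x, h0⟩, h1, rfl⟩
  rw [leb_apply, h, Real.volume_Icc, sub_zero]

instance : NullSingletonClass leb where
  measure_singleton x := by rw [leb_apply, Set.image_singleton, Real.volume_singleton]

instance : SigmaFinite leb := by
  refine ⟨⟨⟨fun N => Set.Iic (N : ℝ≥0), fun _ => trivial, fun N => ?_, ?_⟩⟩⟩
  · rw [leb_Iic]; exact ENNReal.ofReal_lt_top
  · refine Set.iUnion_eq_univ_iff.mpr fun t => ?_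
    obtain ⟨N, hN⟩ := exists_nat_ge t
    exact ⟨N, hN⟩

instance (T : ℝ≥0) : IsFiniteMeasure (leb.restrict (Set.Iic T)) :=
  ⟨by rw [Measure.restrict_apply_univ, leb_Iic]; exact ENNReal.ofReal_lt_top⟩

theorem setIntegral_Iic_coe {E : Type*} [NormedAddCommGroup E] [NormedSpace ℝ E] (f : ℝ → E)
    (T : ℝ≥0) : ∫ τ in Set.Iic T, f τ ∂leb = ∫ τ in (0 : ℝ)..T, f τ := by
  rw [intervalIntegral.integral_of_le T.coe_nonneg, ← integral_Icc_eq_integral_Ioc,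
      ← map_coe_leb_Iic,
    measurableEmbedding_coe.integral_map]

/-- The future after time `T` is a copy of the time axis. -/
theorem map_add_leb (T : ℝ≥0) : leb.map (T + ·) = leb.restrict (Set.Ici T) := by
  ext s hs
  rw [Measure.map_apply (measurable_const_add T) hs, Measure.restrict_apply hs, leb_apply,
    leb_apply, ← measure_preimage_add volume (-(T : ℝ))]
  congr 1
  ext x
  simp only [Set.mem_preimage, Set.mem_image, Set.mem_inter_iff, Set.mem_Ici]
  constructor
  · rintro ⟨t, ht, h⟩
    exact ⟨T + t, ⟨ht, le_self_add⟩, by push_cast; linarith⟩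
  · rintro ⟨t, ⟨ht, hT⟩, rfl⟩
    refine ⟨t - T, by rwa [add_tsub_cancel_of_le hT], ?_⟩
    rw [NNReal.coe_sub hT]
    ring

theorem measurableEmbedding_add (T : ℝ≥0) : MeasurableEmbedding (T + ·) := by
  refine Topology.IsClosedEmbedding.measurableEmbedding ?_
  refine Isometry.isClosedEmbedding ?_
  exact Isometry.of_dist_eq fun x y => by simp [NNReal.dist_eq]

theorem map_add_leb_Iic (T t : ℝ≥0) :
    (leb.restrict (Set.Iic t)).map (T + ·) = leb.restrict (Set.Icc T (T + t)) := by
  have h : Set.Iic t = (T + ·) ⁻¹' Set.Iic (T + t) := by ext; simp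
  rw [h, ← (measurableEmbedding_add T).restrict_map, map_add_leb,
    Measure.restrict_restrict measurableSet_Iic, Set.inter_comm, Set.Ici_inter_Iic]

theorem integral_Ici_leb {E : Type*} [NormedAddCommGroup E] [NormedSpace ℝ E] (T : ℝ≥0)
    (f : ℝ≥0 → E) : ∫ τ in Set.Ici T, f τ ∂leb = ∫ τ, f (T + τ) ∂leb := by
  rw [← map_add_leb, (measurableEmbedding_add T).integral_map]

theorem setIntegral_Icc_leb {E : Type*} [NormedAddCommGroup E] [NormedSpace ℝ E] (T t : ℝ≥0)
    (f : ℝ≥0 → E) : ∫ τ in Set.Icc T (T + t), f τ ∂leb = ∫ τ in Set.Iic t, f (T + τ) ∂leb := by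
  rw [← map_add_leb_Iic, (measurableEmbedding_add T).integral_map]

end TimeAxis

/-! ### Calculus of primitives of locally integrable functions. -/

section Primitive

/-- `F` is the primitive of the locally integrable function `f` with `F 0 = a`. -/
structure IsPrimitive (a : ℂ) (f F : ℝ≥0 → ℂ) : Prop where
  integrableOn : ∀ t, IntegrableOn f (Set.Iic t) leb
  eq : ∀ t, F t = a + ∫ τ in Set.Iic t, f τ ∂leb

/-- Fubini on the square `[0, t]²` cut along its diagonal. This yields the product rule for
primitives of functions that are merely integrable. -/
theorem setIntegral_mul_setIntegral {f g : ℝ≥0 → ℂ} {t : ℝ≥0}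
    (hf : IntegrableOn f (Set.Iic t) leb) (hg : IntegrableOn g (Set.Iic t) leb) :
    IntegrableOn (fun τ => f τ * ∫ r in Set.Iic τ, g r ∂leb) (Set.Iic t) leb ∧
    IntegrableOn (fun τ => (∫ r in Set.Iic τ, f r ∂leb) * g τ) (Set.Iic t) leb ∧
    (∫ τ in Set.Iic t, f τ ∂leb) * (∫ τ in Set.Iic t, g τ ∂leb) =
      (∫ τ in Set.Iic t, f τ * ∫ r in Set.Iic τ, g r ∂leb ∂leb) +
        ∫ τ in Set.Iic t, (∫ r in Set.Iic τ, f r ∂leb) * g τ ∂leb := by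
  set μ := leb.restrict (Set.Iic t) with hμ
  have hfg : Integrable (fun z : ℝ≥0 × ℝ≥0 => f z.1 * g z.2) (μ.prod μ) := hf.mul_prod hg
  set s : Set (ℝ≥0 × ℝ≥0) := {z | z.2 ≤ z.1} with hs
  have hsm : MeasurableSet s := measurableSet_le measurable_snd measurable_fst
  have h1 := hfg.indicator hsm
  have h2 := hfg.indicator hsm.compl
  have key : ∀ τ ∈ Set.Iic t, ∀ h : ℝ≥0 → ℂ,
      ∫ r, (Set.Iic τ).indicator h r ∂μ = ∫ r in Set.Iic τ, h r ∂leb := by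
    intro τ hτ h
    rw [integral_indicator measurableSet_Iic, hμ, Measure.restrict_restrict measurableSet_Iic,
      Set.inter_eq_left.mpr (Set.Iic_subset_Iic.mpr hτ)]
  have key' : ∀ τ ∈ Set.Iic t, ∀ h : ℝ≥0 → ℂ,
      ∫ r, (Set.Iio τ).indicator h r ∂μ = ∫ r in Set.Iic τ, h r ∂leb := by
    intro τ hτ h
    rw [integral_indicator measurableSet_Iio, hμ, Measure.restrict_restrict measurableSet_Iio,
      Set.inter_eq_left.mpr (Set.Iio_subset_Iic_self.trans (Set.Iic_subset_Iic.mpr hτ)),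
      integral_Iic_eq_integral_Iio]
  have hmem : ∀ᵐ x ∂μ, x ∈ Set.Iic t := ae_restrict_mem measurableSet_Iic
  have e1 : (fun x => ∫ y, s.indicator (fun z => f z.1 * g z.2) (x, y) ∂μ) =ᵐ[μ]
      fun x => f x * ∫ r in Set.Iic x, g r ∂leb := by
    filter_upwards [hmem] with x hx
    rw [← key _ hx, ← integral_const_mul]
    refine integral_congr_ae (Eventually.of_forall fun y => ?_)
    by_cases hy : y ≤ x <;> simp [s, hy]
  have e2 : (fun y => ∫ x, sᶜ.indicator (fun z => f z.1 * g z.2) (x, y) ∂μ) =ᵐ[μ]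
      fun y => (∫ r in Set.Iic y, f r ∂leb) * g y := by
    filter_upwards [hmem] with y hy
    rw [← key' _ hy, ← integral_mul_const]
    refine integral_congr_ae (Eventually.of_forall fun x => ?_)
    by_cases hx : x < y
    · simp [s, hx]
    · simp [s, hx, not_lt.mp hx]
  refine ⟨h1.integral_prod_left.congr e1, h2.integral_prod_right.congr e2, ?_⟩
  rw [← integral_prod_mul, ← integral_congr_ae e1, ← integral_congr_ae e2, ← integral_prod _ h1,
    ← integral_prod_symm _ h2, ← integral_add h1 h2]
  refine integral_congr_ae (Eventually.of_forall fun z => ?_)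
  exact (Set.indicator_self_add_compl_apply s (fun z : ℝ≥0 × ℝ≥0 => f z.1 * g z.2) z).symm

namespace IsPrimitive

variable {a b : ℂ} {f g F G : ℝ≥0 → ℂ}

theorem mul (hF : IsPrimitive a f F) (hG : IsPrimitive b g G) :
    IsPrimitive (a * b) (fun t => f t * G t + F t * g t) (fun t => F t * G t) := by
  have h := fun t => setIntegral_mul_setIntegral (hF.integrableOn t) (hG.integrableOn t)
  have e1 : ∀ t, f t * G t = f t * b + f t * ∫ τ in Set.Iic t, g τ ∂leb := by
    intro t; rw [hG.eq]; ring
  have e2 : ∀ t, F t * g t = a * g t + (∫ τ in Set.Iic t, f τ ∂leb) * g t := by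
    intro t; rw [hF.eq]; ring
  have i1 : ∀ t, IntegrableOn (fun t => f t * G t) (Set.Iic t) leb := fun t => by
    simp only [e1]; exact ((hF.integrableOn t).mul_const b).add (h t).1
  have i2 : ∀ t, IntegrableOn (fun t => F t * g t) (Set.Iic t) leb := fun t => by
    simp only [e2]; exact ((hG.integrableOn t).const_mul a).add (h t).2.1
  refine ⟨fun t => (i1 t).add (i2 t), fun t => ?_⟩
  rw [integral_add (i1 t) (i2 t)]
  simp only [e1, e2]
  rw [integral_add ((hF.integrableOn t).mul_const b) (h t).1,
    integral_add ((hG.integrableOn t).const_mul a) (h t).2.1, integral_mul_const,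
    integral_const_mul, hF.eq, hG.eq]
  linear_combination (h t).2.2

theorem add (hF : IsPrimitive a f F) (hG : IsPrimitive b g G) :
    IsPrimitive (a + b) (fun t => f t + g t) (fun t => F t + G t) :=
  ⟨fun t => (hF.integrableOn t).add (hG.integrableOn t), fun t => by
    rw [integral_add (hF.integrableOn t) (hG.integrableOn t), hF.eq, hG.eq]; ring⟩

theorem const_mul (hF : IsPrimitive a f F) (c : ℂ) :
    IsPrimitive (c * a) (fun t => c * f t) (fun t => c * F t) :=
  ⟨fun t => (hF.integrableOn t).const_mul c, fun t => by
    rw [integral_const_mul, hF.eq]; ring⟩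

theorem star (hF : IsPrimitive a f F) :
    IsPrimitive (star a) (fun t => star (f t)) (fun t => star (F t)) := by
  refine ⟨fun t => ?_, fun t => ?_⟩
  · exact ((Complex.conjCLE : ℂ ≃L[ℝ] ℂ) : ℂ →L[ℝ] ℂ).integrable_comp (hF.integrableOn t)
  · rw [hF.eq, star_add]
    congr 1
    exact integral_conj.symm

theorem congr_deriv (hF : IsPrimitive a f F) (h : f =ᵐ[leb] g) : IsPrimitive a g F :=
  ⟨fun t => (hF.integrableOn t).congr (ae_restrict_of_ae h), fun t => by
    rw [hF.eq, integral_congr_ae (ae_restrict_of_ae h)]⟩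

theorem continuous (hF : IsPrimitive a f F) : Continuous F := by
  have h : Continuous fun t => ∫ τ in Set.Iic t, f τ ∂leb := by
    refine continuous_iff_continuousAt.mpr fun t => ?_
    have h1 : ∀ r, r ≤ t + 1 → ∫ τ in Set.Iic r, f τ ∂leb =
        ∫ τ in Set.Iic (t + 1), (Set.Iic r).indicator f τ ∂leb := by
      intro r hr
      rw [integral_indicator measurableSet_Iic, Measure.restrict_restrict measurableSet_Iic,
        Set.inter_eq_left.mpr (Set.Iic_subset_Iic.mpr hr)]
    have hev : ∀ᶠ r in 𝓝 t, r ≤ t + 1 := Iic_mem_nhds (by simp)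
    rw [ContinuousAt, h1 t (by simp)]
    refine Tendsto.congr' (hev.mono fun r hr => (h1 r hr).symm) ?_
    refine tendsto_integral_filter_of_dominated_convergence (fun τ => ‖f τ‖) ?_ ?_
      (hF.integrableOn _).norm ?_
    · exact Eventually.of_forall fun r =>
        (hF.integrableOn _).aestronglyMeasurable.indicator measurableSet_Iic
    · exact Eventually.of_forall fun r => Eventually.of_forall fun τ =>
        norm_indicator_le_norm_self _ _
    · have hne : ∀ᵐ τ ∂(leb.restrict (Set.Iic (t + 1))), τ ≠ t :=
        ae_restrict_of_ae (by simp [ae_iff])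
      filter_upwards [hne] with τ hτ
      refine tendsto_const_nhds.congr' ?_
      rcases lt_or_gt_of_ne hτ with h2 | h2
      · filter_upwards [Ioi_mem_nhds h2] with r hr
        rw [Set.indicator_of_mem (Set.mem_Iic.mpr h2.le),
          Set.indicator_of_mem (Set.mem_Iic.mpr (le_of_lt hr))]
      · filter_upwards [Iio_mem_nhds h2] with r hr
        rw [Set.indicator_of_notMem (by simpa using h2),
            Set.indicator_of_notMem (by simpa using hr)]
  have h2 : F = fun t => a + ∫ τ in Set.Iic t, f τ ∂leb := funext hF.eq
  rw [h2]
  exact continuous_const.add h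

theorem exp (c : ℂ) : IsPrimitive 1 (fun t => c * Complex.exp (c * (t : ℝ)))
    (fun t => Complex.exp (c * (t : ℝ))) := by
  have hd : ∀ x : ℝ, HasDerivAt (fun x : ℝ => Complex.exp (c * x)) (c * Complex.exp (c * x)) x := by
    intro x
    have h1 : HasDerivAt (fun x : ℝ => c * (x : ℂ)) c x := by
      simpa using (Complex.ofRealCLM.hasDerivAt (x := x)).const_mul c
    simpa [mul_comm] using h1.cexp
  refine ⟨fun t => ?_, fun t => ?_⟩
  · have hc : Continuous fun t : ℝ≥0 => c * Complex.exp (c * (t : ℝ)) := by fun_prop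
    have hb : ∃ C, ∀ x ∈ Set.Iic t, ‖c * Complex.exp (c * (x : ℝ))‖ ≤ C := by
      obtain ⟨C, hC⟩ :=
        (isCompact_Icc (a := 0) (b := t)).exists_bound_of_continuousOn hc.continuousOn
      exact ⟨C, fun x hx => hC x ⟨zero_le, hx⟩⟩
    obtain ⟨C, hC⟩ := hb
    exact Integrable.of_bound hc.aestronglyMeasurable C
      ((ae_restrict_mem measurableSet_Iic).mono hC)
  · rw [setIntegral_Iic_coe (fun x : ℝ => c * Complex.exp (c * x)),
      intervalIntegral.integral_eq_sub_of_hasDerivAt (fun x _ => hd x)]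
    · simp
    · exact Continuous.intervalIntegrable (by fun_prop) _ _

/-- An integrable primitive of an integrable function vanishes at infinity. -/
theorem add_integral_eq_zero (hF : IsPrimitive a f F) (hf : Integrable f leb)
    (hF' : Integrable F leb) : a + ∫ t, f t ∂leb = 0 := by
  have h1 : Tendsto F atTop (𝓝 (a + ∫ t, f t ∂leb)) := by
    have h2 : F = fun t => a + ∫ τ in Set.Iic t, f τ ∂leb := funext hF.eq
    rw [h2]
    exact tendsto_const_nhds.add
      ((aecover_Iic tendsto_id).integral_tendsto_of_countably_generated hf)
  by_contra hne
  have hpos := norm_pos_iff.mpr hne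
  obtain ⟨T, hT⟩ := eventually_atTop.mp (h1.norm.eventually_const_lt (half_lt_self hpos))
  have h3 := hF'.measure_norm_ge_lt_top (half_pos hpos)
  have h4 : leb (Set.Ici T) = ⊤ := by
    rw [← Measure.restrict_apply_univ, ← map_add_leb,
      Measure.map_apply (measurable_const_add T) MeasurableSet.univ, Set.preimage_univ,
      ← Set.preimage_univ (f := ((↑) : ℝ≥0 → ℝ)),
      ← Measure.map_apply measurableEmbedding_coe.measurable MeasurableSet.univ, map_coe_leb,
      Measure.restrict_apply_univ, Real.volume_Ici]
  exact (h4.symm.le.trans (measure_mono fun t ht => (hT t ht).le)).not_gt h3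

end IsPrimitive
end Primitive

/-! ### The first-order lag and its isometry. -/

section Lag

theorem leb_Icc_add (T t : ℝ≥0) : leb (Set.Icc T (T + t)) = ENNReal.ofReal t := by
  rw [← Measure.restrict_apply_univ, ← map_add_leb_Iic,
    Measure.map_apply (measurable_const_add T) MeasurableSet.univ, Set.preimage_univ,
    Measure.restrict_apply_univ, leb_Iic]

instance : leb.IsOpenPosMeasure where
  open_pos U hU := by
    rintro ⟨x, hx⟩ h0
    obtain ⟨y, hy, hyU⟩ := (mem_nhdsGE_iff_exists_Icc_subset).mp
      (mem_nhdsWithin_of_mem_nhds (hU.mem_nhds hx))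
    have h1 := measure_mono_null hyU h0
    rw [← add_tsub_cancel_of_le (le_of_lt hy), leb_Icc_add, ENNReal.ofReal_eq_zero] at h1
    exact (tsub_pos_of_lt hy).not_ge (by exact_mod_cast h1)

instance : IsFiniteMeasureOnCompacts leb where
  lt_top_of_isCompact K hK := by
    obtain ⟨T, hT⟩ := hK.bddAbove
    have hKT : K ⊆ Set.Iic T := fun x hx => hT hx
    exact (measure_mono hKT).trans_lt (by rw [leb_Iic]; exact ENNReal.ofReal_lt_top)

theorem isCompact_Iic_time (t : ℝ≥0) : IsCompact (Set.Iic t) := by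
  have h : Set.Iic t = Set.Icc 0 t := by ext; simp
  rw [h]
  exact isCompact_Icc

theorem integrableOn_of_memLp {E : Type*} [NormedAddCommGroup E] {f : ℝ≥0 → E}
    (hf : MemLp f 2 leb) (t : ℝ≥0) : IntegrableOn f (Set.Iic t) leb :=
  (hf.restrict _).integrable one_le_two

theorem eq_zero_of_setIntegral_Iic {f : ℝ≥0 → ℂ} (hf : ∀ t, IntegrableOn f (Set.Iic t) leb)
    (h : ∀ t, ∫ τ in Set.Iic t, f τ ∂leb = 0) : f =ᵐ[leb] 0 := by
  have hT : ∀ N : ℕ, f =ᵐ[leb.restrict (Set.Iic (N : ℝ≥0))] 0 := by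
    intro N
    refine Integrable.ae_eq_zero_of_forall_setIntegral_eq_zero (hf N) fun s hs _ => ?_
    refine MeasurableSpace.induction_on_inter
      (C := fun s _ => ∫ x in s, f x ∂leb.restrict (Set.Iic (N : ℝ≥0)) = 0)
      (borel_eq_generateFrom_Iic ℝ≥0 ▸ BorelSpace.measurable_eq) isPiSystem_Iic (by simp) ?_ ?_ ?_
      s hs
    · rintro _ ⟨t, rfl⟩
      rw [Measure.restrict_restrict measurableSet_Iic, Set.Iic_inter_Iic, h]
    · intro s hs h0
      rw [setIntegral_compl hs (hf N), h0, h, sub_zero]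
    · intro s hd hs h0
      rw [integral_iUnion hs hd (hf N).integrableOn]
      simp [h0]
  have hU : (⋃ N : ℕ, Set.Iic (N : ℝ≥0)) = Set.univ :=
    Set.iUnion_eq_univ_iff.mpr fun t => exists_nat_ge t
  rw [← Measure.restrict_univ (μ := leb), ← hU]
  exact ae_restrict_iUnion_iff _ _ |>.mpr hT

/-- The solution of `ż = f - z`, `z(0) = 0`. -/
noncomputable def lag (f : ℝ≥0 → ℂ) (t : ℝ≥0) : ℂ :=
  Complex.exp ((-1 : ℂ) * (t : ℝ)) * ∫ τ in Set.Iic t, Complex.exp ((1 : ℂ) * (τ : ℝ)) * f τ ∂leb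

variable {f g : ℝ≥0 → ℂ}

theorem integrableOn_exp_mul (hf : ∀ t, IntegrableOn f (Set.Iic t) leb) (t : ℝ≥0) :
    IntegrableOn (fun τ : ℝ≥0 => Complex.exp ((1 : ℂ) * (τ : ℝ)) * f τ) (Set.Iic t) leb :=
  IntegrableOn.continuousOn_mul (by fun_prop) (hf t) (isCompact_Iic_time t)

theorem isPrimitive_lag (hf : ∀ t, IntegrableOn f (Set.Iic t) leb) :
    IsPrimitive 0 (fun t => f t - lag f t) (lag f) := by
  have h1 : IsPrimitive 0 (fun τ : ℝ≥0 => Complex.exp ((1 : ℂ) * (τ : ℝ)) * f τ) _ :=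
    ⟨integrableOn_exp_mul hf, fun t => rfl⟩
  have h2 := (IsPrimitive.exp (-1)).mul h1
  simp only [zero_add, mul_zero] at h2
  have h3 : ∀ τ : ℝ≥0, -1 * Complex.exp (-1 * (τ : ℝ)) *
      ∫ r in Set.Iic τ, Complex.exp (1 * (r : ℝ)) * f r ∂leb +
      Complex.exp (-1 * (τ : ℝ)) * (Complex.exp (1 * (τ : ℝ)) * f τ) = f τ - lag f τ := by
    intro τ
    rw [← mul_assoc (Complex.exp _) (Complex.exp _), ← Complex.exp_add, lag]
    ring_nf
    simp
  simp only [h3] at h2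
  exact h2

theorem lag_congr (h : f =ᵐ[leb] g) : lag f = lag g := by
  ext t
  rw [lag, lag]
  congr 1
  refine integral_congr_ae (ae_restrict_of_ae ?_)
  filter_upwards [h] with τ hτ
  rw [hτ]

theorem lag_add (hf : ∀ t, IntegrableOn f (Set.Iic t) leb)
    (hg : ∀ t, IntegrableOn g (Set.Iic t) leb) : lag (f + g) = lag f + lag g := by
  ext t
  simp only [lag, Pi.add_apply, mul_add]
  rw [integral_add (integrableOn_exp_mul hf t) (integrableOn_exp_mul hg t), mul_add]

theorem lag_const_smul (c : ℂ) : lag (c • f) = c • lag f := by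
  ext t
  simp only [lag, Pi.smul_apply, smul_eq_mul, mul_left_comm _ c]
  rw [integral_const_mul]
  ring

theorem lag_star : lag (star f) = star (lag f) := by
  ext t
  have h : ∀ x : ℝ, star (Complex.exp x) = Complex.exp x := fun x => by
    rw [Complex.star_def, ← Complex.exp_conj, Complex.conj_ofReal]
  have h1 := h (-t)
  have h2 := fun τ : ℝ≥0 => h τ
  push_cast at h1
  simp only [lag, Pi.star_apply, star_mul', one_mul, neg_one_mul, h1]
  congr 1
  rw [Complex.star_def, ← integral_conj]
  refine integral_congr_ae (Eventually.of_forall fun τ => ?_)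
  simp only [map_mul, ← Complex.star_def, h2]

/-- An energy estimate: for `z = lag f` the derivative of `|z|²` is `2 Re (z̄ (f - z)) ≤ |f|² -
|z|²`, and `|z|²` starts at `0` and stays nonnegative. -/
theorem memLp_lag (hf : MemLp f 2 leb) : MemLp (lag f) 2 leb := by
  have hz := isPrimitive_lag (integrableOn_of_memLp hf)
  set z := lag f
  have hzc := hz.continuous
  refine (memLp_two_iff_integrable_sq_norm hzc.aestronglyMeasurable).mpr ?_
  have hf2 := (memLp_two_iff_integrable_sq_norm hf.1).mp hf
  have hz2 : ∀ t, IntegrableOn (fun τ => ‖z τ‖ ^ 2) (Set.Iic t) leb := fun t =>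
    (by fun_prop : ContinuousOn (fun τ => ‖z τ‖ ^ 2) (Set.Iic t)).integrableOn_compact
      (isCompact_Iic_time t)
  refine (aecover_Iic tendsto_id).integrable_of_integral_norm_bounded
    (∫ t, ‖f t‖ ^ 2 ∂leb) hz2 (Eventually.of_forall fun t => ?_)
  have h1 := hz.mul hz.star
  have h2 := congrArg Complex.re (h1.eq t)
  have h3 : (z t * star (z t)).re = ‖z t‖ ^ 2 := by
    rw [Complex.star_def, Complex.mul_conj, Complex.ofReal_re, Complex.normSq_eq_norm_sq]
  have h4 : ∀ τ, ((f τ - z τ) * star (z τ) + z τ * star (f τ - z τ)).re ≤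
      ‖f τ‖ ^ 2 - ‖z τ‖ ^ 2 := by
    intro τ
    simp only [← Complex.normSq_eq_norm_sq, Complex.normSq_apply, Complex.star_def,
      Complex.add_re, Complex.mul_re, Complex.sub_re, Complex.sub_im, Complex.conj_re,
      Complex.conj_im]
    nlinarith [sq_nonneg ((f τ).re - (z τ).re), sq_nonneg ((f τ).im - (z τ).im)]
  simp only [norm_pow, norm_norm, id]
  have h5 : 0 ≤ ∫ τ in Set.Iic t, (‖f τ‖ ^ 2 - ‖z τ‖ ^ 2) ∂leb := by
    refine le_trans ?_ (integral_mono (h1.integrableOn t).re (hf2.integrableOn.sub (hz2 t)) h4)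
    have h6 := integral_re (h1.integrableOn t)
    simp only [zero_mul, zero_add, star_zero] at h2
    have h7 : (∫ τ in Set.Iic t, ((f τ - z τ) * star (z τ) + z τ * star (f τ - z τ)).re ∂leb) =
        ‖z t‖ ^ 2 := h6.trans (h2.symm.trans h3)
    exact (sq_nonneg _).trans h7.ge
  rw [integral_sub hf2.integrableOn (hz2 t), sub_nonneg] at h5
  exact h5.trans (setIntegral_le_integral hf2 (Eventually.of_forall fun _ => sq_nonneg _))

/-- The two integrands differ by twice the derivative of `lag g * star (lag f)`, an integrable
function that vanishes at `0` and at infinity. -/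
theorem integral_lag (hf : MemLp f 2 leb) (hg : MemLp g 2 leb) :
    ∫ t, (g t - 2 * lag g t) * star (f t - 2 * lag f t) ∂leb = ∫ t, g t * star (f t) ∂leb := by
  have hzf := isPrimitive_lag (integrableOn_of_memLp hf)
  have hzg := isPrimitive_lag (integrableOn_of_memLp hg)
  have mf := memLp_lag hf
  have mg := memLp_lag hg
  set zf := lag f
  set zg := lag g
  have hp := hzg.mul hzf.star
  have hi : ∀ {u v : ℝ≥0 → ℂ}, MemLp u 2 leb → MemLp v 2 leb →
      Integrable (fun t => u t * star (v t)) leb := fun hu hv => hu.integrable_mul hv.star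
  have h1 : Integrable (fun t => (g t - zg t) * star (zf t) + zg t * star (f t - zf t)) leb :=
    (hi (hg.sub mg) mf).add (hi mg (hf.sub mf))
  have h2 := hp.add_integral_eq_zero h1 (hi mg mf)
  rw [star_zero, mul_zero, zero_add] at h2
  calc _ = ∫ t, g t * star (f t) -
        2 * ((g t - zg t) * star (zf t) + zg t * star (f t - zf t)) ∂leb := by
        refine integral_congr_ae (Eventually.of_forall fun t => ?_)
        simp only [star_sub, star_mul', star_ofNat]
        ring
    _ = _ := by rw [integral_sub (hi hg hf) (h1.const_mul 2), integral_const_mul, h2]; simp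

theorem eq_zero_of_lag_eigen (hf : MemLp f 2 leb) (c : ℂ)
    (h : ∀ᵐ t ∂leb, f t - 2 * lag f t = c * f t) : f =ᵐ[leb] 0 := by
  have hl := integrableOn_of_memLp hf
  have hz := isPrimitive_lag hl
  by_cases hc : c = 1
  · subst hc
    have h0 : lag f =ᵐ[leb] 0 := by
      filter_upwards [h] with t ht
      simpa using ht
    have h1 : lag f = 0 := (hz.continuous.ae_eq_iff_eq _ continuous_zero).mp h0
    refine eq_zero_of_setIntegral_Iic hl fun t => ?_
    have h2 := hz.eq t
    simp only [h1, Pi.zero_apply, sub_zero, zero_add] at h2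
    exact h2.symm
  · have hc' : 1 - c ≠ 0 := sub_ne_zero.mpr (Ne.symm hc)
    set l := 2 / (1 - c) with hl'
    have h1 : f =ᵐ[leb] fun t => l * lag f t := by
      filter_upwards [h] with t ht
      rw [hl', div_mul_eq_mul_div, eq_div_iff hc']
      linear_combination ht
    -- For `c ≠ 1` an eigenfunction is a multiple of its own lag, which then solves a homogeneous
    -- linear equation from the initial value `0`; the integrating factor below shows that it
    -- vanishes.
    have h2 : IsPrimitive 0 (fun t => (l - 1) * lag f t) (lag f) := by
      refine hz.congr_deriv ?_
      filter_upwards [h1] with t ht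
      linear_combination ht
    have h3 := h2.mul (IsPrimitive.exp (-(l - 1)))
    have h4 : ∀ t, lag f t = 0 := by
      intro t
      have h5 := h3.eq t
      have h6 : ∀ t : ℝ≥0, (l - 1) * lag f t * Complex.exp (-(l - 1) * (t : ℝ)) +
          lag f t * (-(l - 1) * Complex.exp (-(l - 1) * (t : ℝ))) = 0 := fun t => by ring
      simp only [h6, integral_zero, zero_mul, add_zero] at h5
      exact (mul_eq_zero.mp h5).resolve_right (Complex.exp_ne_zero _)
    filter_upwards [h1] with t ht
    rw [ht, h4]
    simp

theorem memLp_exp : MemLp (fun t : ℝ≥0 => Complex.exp (-1 * (t : ℝ))) 2 leb := by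
  rw [memLp_two_iff_integrable_sq_norm (by fun_prop)]
  have h := (integrableOn_Ici_iff_integrableOn_Ioi (b := (0:ℝ))).mpr
    (integrableOn_exp_mul_Ioi (a := (-2 : ℝ)) (by norm_num) 0)
  rw [IntegrableOn, ← map_coe_leb, measurableEmbedding_coe.integrable_map_iff] at h
  refine h.congr (Eventually.of_forall fun t => ?_)
  simp only [Function.comp_apply, Complex.norm_exp, ← Real.exp_nat_mul]
  simp

theorem integral_exp_lag (hf : MemLp f 2 leb) :
    ∫ t, (f t - 2 * lag f t) * star (Complex.exp (-1 * (t : ℝ))) ∂leb = 0 := by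
  have hz := isPrimitive_lag (integrableOn_of_memLp hf)
  have mf := memLp_lag hf
  have he : ∀ t : ℝ≥0, star (Complex.exp (-1 * (t : ℝ))) = Complex.exp (-1 * (t : ℝ)) := by
    intro t
    rw [Complex.star_def, ← Complex.exp_conj]; simp
  have hp := hz.mul (IsPrimitive.exp (-1))
  have hi : ∀ {u : ℝ≥0 → ℂ}, MemLp u 2 leb →
      Integrable (fun t => u t * Complex.exp (-1 * (t : ℝ))) leb :=
    fun hu => hu.integrable_mul memLp_exp
  have h1 : ∀ t : ℝ≥0, (f t - lag f t) * Complex.exp (-1 * (t : ℝ)) +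
      lag f t * (-1 * Complex.exp (-1 * (t : ℝ))) =
      (f t - 2 * lag f t) * Complex.exp (-1 * (t : ℝ)) := fun t => by ring
  simp only [h1] at hp
  have h2 := hp.add_integral_eq_zero (hi (hf.sub (mf.const_mul 2))) (hi mf)
  simpa only [he, zero_mul, zero_add] using h2

end Lag

/-! ### Square integrable functions on the time axis as a shift model. -/

section TimeModel

/-- Complex square integrable functions on the time axis. -/
abbrev LSq : Type := Lp ℂ 2 leb

theorem inner_lsq {f g : ℝ≥0 → ℂ} (F G : LSq) (hF : F =ᵐ[leb] f) (hG : G =ᵐ[leb] g) :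
    inner ℂ F G = ∫ t, g t * star (f t) ∂leb := by
  rw [L2.inner_def]
  refine integral_congr_ae ?_
  filter_upwards [hF, hG] with t h1 h2
  rw [RCLike.inner_apply, h1, h2]
  rfl

/-- The operator `lag` on classes of functions. -/
noncomputable def lagLinear : LSq →ₗ[ℂ] LSq where
  toFun f := (memLp_lag (Lp.memLp f)).toLp (lag f)
  map_add' f g := by
    rw [← MemLp.toLp_add]
    refine MemLp.toLp_congr _ _ ?_
    rw [lag_congr (Lp.coeFn_add f g), lag_add (integrableOn_of_memLp (Lp.memLp f))
      (integrableOn_of_memLp (Lp.memLp g))]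
  map_smul' c f := by
    rw [RingHom.id_apply, ← MemLp.toLp_const_smul]
    refine MemLp.toLp_congr _ _ ?_
    rw [lag_congr (Lp.coeFn_smul c f), lag_const_smul]

theorem coeFn_lagLinear {f : ℝ≥0 → ℂ} (F : LSq) (hF : F =ᵐ[leb] f) :
    lagLinear F =ᵐ[leb] lag f :=
  (memLp_lag (Lp.memLp F)).coeFn_toLp.trans (by rw [lag_congr hF])

/-- `f ↦ f - 2 lag f` as a linear map. -/
noncomputable def shiftLinear : LSq →ₗ[ℂ] LSq := LinearMap.id - (2 : ℂ) • lagLinear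

theorem shiftLinear_apply (F : LSq) : shiftLinear F = F - (2 : ℂ) • lagLinear F := rfl

theorem coeFn_shiftLinear {f : ℝ≥0 → ℂ} (F : LSq) (hF : F =ᵐ[leb] f) :
    shiftLinear F =ᵐ[leb] fun t => f t - 2 * lag f t := by
  rw [shiftLinear_apply]
  filter_upwards [Lp.coeFn_sub F ((2 : ℂ) • lagLinear F), Lp.coeFn_smul (2 : ℂ) (lagLinear F),
    coeFn_lagLinear F hF, hF] with t h1 h2 h3 h4
  rw [h1, Pi.sub_apply, h2, Pi.smul_apply, h3, h4, smul_eq_mul]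

theorem inner_shiftLinear (F G : LSq) :
    inner ℂ (shiftLinear F) (shiftLinear G) = inner ℂ F G := by
  rw [inner_lsq _ _ (coeFn_shiftLinear F .rfl) (coeFn_shiftLinear G .rfl),
    inner_lsq F G .rfl .rfl, integral_lag (Lp.memLp F) (Lp.memLp G)]

theorem star_lsq_add (F G : LSq) : star (F + G) = star F + star G := by
  apply Lp.ext
  filter_upwards [Lp.coeFn_star (F + G), Lp.coeFn_add F G, Lp.coeFn_add (star F) (star G),
    Lp.coeFn_star F, Lp.coeFn_star G] with t h1 h2 h3 h4 h5
  rw [h1, h3, Pi.star_apply, h2, Pi.add_apply, Pi.add_apply, h4, h5, Pi.star_apply,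
    Pi.star_apply, star_add]

theorem star_lsq_smul (c : ℝ) (F : LSq) : star (c • F) = c • star F := by
  apply Lp.ext
  filter_upwards [Lp.coeFn_star (c • F), Lp.coeFn_smul c F, Lp.coeFn_smul c (star F),
    Lp.coeFn_star F] with t h1 h2 h3 h4
  rw [h1, h3, Pi.star_apply, h2, Pi.smul_apply, Pi.smul_apply, h4, Pi.star_apply, star_smul,
    star_trivial]

/-- The model of square integrable functions on the time axis. -/
noncomputable def timeModel : ShiftModel LSq where
  V := shiftLinear.mkContinuous 1 fun F => by
    rw [@norm_eq_sqrt_re_inner ℂ, @norm_eq_sqrt_re_inner ℂ _ _ _ _ F, inner_shiftLinear, one_mul]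
  e := memLp_exp.toLp _
  conj :=
    { toFun := star
      map_add' := star_lsq_add
      map_smul' := star_lsq_smul }
  inner_V := inner_shiftLinear
  eigen c F h := by
    have h1 : shiftLinear F = c • F := h
    have h2 := coeFn_shiftLinear F .rfl
    rw [h1] at h2
    have h3 := eq_zero_of_lag_eigen (Lp.memLp F) c (by
      filter_upwards [h2, Lp.coeFn_smul c F] with t h4 h5
      rw [← h4, h5]; rfl)
    exact (Lp.eq_zero_iff_ae_eq_zero).mpr h3
  inner_e_V F := by
    change inner ℂ _ (shiftLinear F) = 0
    rw [inner_lsq _ _ memLp_exp.coeFn_toLp (coeFn_shiftLinear F .rfl)]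
    exact integral_exp_lag (Lp.memLp F)
  conj_conj := star_star
  conj_V F := by
    apply Lp.ext
    have h1 := Lp.coeFn_star F
    have h2 := coeFn_shiftLinear (star F) h1
    refine (Lp.coeFn_star _).trans (EventuallyEq.trans ?_ h2.symm)
    rw [lag_star]
    filter_upwards [coeFn_shiftLinear F .rfl] with t h3
    change star (shiftLinear F t) = _
    rw [h3]
    simp
  conj_e := by
    apply Lp.ext
    refine (Lp.coeFn_star _).trans ?_
    filter_upwards [memLp_exp.coeFn_toLp] with t h
    rw [Pi.star_apply, h, Complex.star_def, ← Complex.exp_conj]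
    simp
  inner_conj F G := by
    change (inner ℂ (star F) (star G)).re = _
    rw [inner_lsq _ _ (Lp.coeFn_star F) (Lp.coeFn_star G), inner_lsq F G .rfl .rfl]
    have h : ∀ t, (star ⇑G) t * star ((star ⇑F) t) = (starRingEnd ℂ) (G t * star (F t)) := by
      intro t
      rw [map_mul]
      rfl
    simp only [h]
    rw [integral_conj, Complex.conj_re]

end TimeModel

/-! ### Solutions of the state equation as trajectories. -/

section Trajectory

variable {n k q : ℕ}

/-- The class of a real function. -/
noncomputable def realClass {u : ℝ≥0 → ℝ} (h : MemLp u 2 leb) : LSq :=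
  (h.ofReal (K := ℂ)).toLp fun t => (u t : ℂ)

theorem coeFn_realClass {u : ℝ≥0 → ℝ} (h : MemLp u 2 leb) :
    realClass h =ᵐ[leb] fun t => (u t : ℂ) := MemLp.coeFn_toLp _

theorem conj_realClass {u : ℝ≥0 → ℝ} (h : MemLp u 2 leb) :
    timeModel.conj (realClass h) = realClass h := by
  change star (realClass h) = _
  apply Lp.ext
  filter_upwards [Lp.coeFn_star (realClass h), coeFn_realClass h] with t h1 h2
  rw [h1, Pi.star_apply, h2]
  exact Complex.conj_ofReal _

theorem realForm_realClass {ι : Type*} [Fintype ι] (Q : Matrix ι ι ℝ) {z : ι → ℝ≥0 → ℝ}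
    (hz : ∀ i, MemLp (z i) 2 leb) :
    realForm LSq Q (fun i => realClass (hz i)) (fun i => realClass (hz i)) =
      ∫ t, (fun i => z i t) ⬝ᵥ Q *ᵥ (fun i => z i t) ∂leb := by
  have hi : ∀ i j, Integrable (fun t => Q i j * (z i t * z j t)) leb := fun i j =>
    ((hz i).integrable_mul (hz j)).const_mul _
  have h1 : ∀ t, (fun i => z i t) ⬝ᵥ Q *ᵥ (fun i => z i t) =
      ∑ i, ∑ j, Q i j * (z i t * z j t) := by
    intro t
    simp only [dotProduct, Matrix.mulVec, Finset.mul_sum]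
    exact Finset.sum_congr rfl fun i _ => Finset.sum_congr rfl fun j _ => by ring
  simp_rw [h1, realForm_apply]
  rw [integral_finsetSum _ fun i _ => integrable_finsetSum _ fun j _ => hi i j]
  refine Finset.sum_congr rfl fun i _ => ?_
  rw [integral_finsetSum _ fun j _ => hi i j]
  refine Finset.sum_congr rfl fun j _ => ?_
  rw [integral_const_mul, inner_lsq _ _ (coeFn_realClass _) (coeFn_realClass _)]
  congr 1
  have h2 : ∀ t, (z j t : ℂ) * star (z i t : ℂ) = ((z i t * z j t : ℝ) : ℂ) := by
    intro t
    rw [Complex.star_def, Complex.conj_ofReal]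
    push_cast
    ring
  simp only [h2]
  rw [integral_complex_ofReal, Complex.ofReal_re]

theorem coeFn_lsq_sum {ι : Type*} (s : Finset ι) (c : ι → ℂ) {F : ι → LSq} {f : ι → ℝ≥0 → ℂ}
    (h : ∀ i, F i =ᵐ[leb] f i) :
    (∑ i ∈ s, c i • F i : LSq) =ᵐ[leb] fun t => ∑ i ∈ s, c i * f i t := by
  classical
  induction s using Finset.induction_on with
  | empty => simp only [Finset.sum_empty]; exact Lp.coeFn_zero ℂ 2 leb
  | insert i s hi ih =>
    rw [Finset.sum_insert hi]
    filter_upwards [Lp.coeFn_add (c i • F i) (∑ i ∈ s, c i • F i), Lp.coeFn_smul (c i) (F i), ih,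
      h i] with t h1 h2 h3 h4
    rw [h1, Pi.add_apply, h2, Pi.smul_apply, h3, h4, Finset.sum_insert hi, smul_eq_mul]

/-- With `V = 1 - 2 lag` the state equation is twice this identity, the form in which it can be
differentiated. -/
theorem eq_lagLinear_of_stateEq {A : Matrix (Fin n) (Fin n) ℝ}
    {B₁ : Matrix (Fin n) (Fin k) ℝ} {B₂ : Matrix (Fin n) (Fin q) ℝ} {a : Fin n → ℝ}
    {v : Fin k → LSq} {w : Fin q → LSq} {x : Fin n → LSq}
    (h : StateEq timeModel A B₁ B₂ a v w x) (i : Fin n) :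
    x i = lagLinear (x i + (∑ j, (A i j : ℂ) • x j + ∑ j, (B₁ i j : ℂ) • v j +
      ∑ j, (B₂ i j : ℂ) • w j)) + (a i : ℂ) • timeModel.e := by
  have h1 : ∀ F, timeModel.V F = F - (2 : ℂ) • lagLinear F := fun F => rfl
  have h2 := h i
  simp only [h1, sub_sub_cancel, ← Complex.coe_smul, smul_comm _ (2 : ℂ), ← Finset.smul_sum] at h2
  simp only [map_add, map_sum, map_smul]
  have h3 : (2 : ℂ) • x i = (2 : ℂ) • (lagLinear (x i) + (∑ j, (A i j : ℂ) • lagLinear (x j) +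
      ∑ j, (B₁ i j : ℂ) • lagLinear (v j) + ∑ j, (B₂ i j : ℂ) • lagLinear (w j)) +
      (a i : ℂ) • timeModel.e) := by
    rw [Complex.ofReal_mul, mul_smul, Complex.ofReal_ofNat] at h2
    simp only [smul_add, two_smul ℂ (x i)]
    rw [← sub_eq_zero] at h2 ⊢
    rw [← h2]
    abel
  exact smul_right_injective _ (two_ne_zero' ℂ) h3

theorem exists_realClass_eq {F : LSq} (hF : timeModel.conj F = F) :
    ∃ (u : ℝ≥0 → ℝ) (h : MemLp u 2 leb), realClass h = F := by
  refine ⟨fun t => (F t).re, (Lp.memLp F).re, ?_⟩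
  apply Lp.ext
  have h1 : star F = F := hF
  have h2 := Lp.coeFn_star F
  rw [h1] at h2
  filter_upwards [coeFn_realClass (Lp.memLp F).re, h2] with t h3 h4
  rw [h3]
  exact Complex.conj_eq_iff_re.mp h4.symm

/-- Solutions of the state equation are trajectories. -/
theorem exists_trajectory {A : Matrix (Fin n) (Fin n) ℝ} (hA : Hurwitz A)
    (B₁ : Matrix (Fin n) (Fin k) ℝ) (B₂ : Matrix (Fin n) (Fin q) ℝ) (a : Fin n → ℝ)
    {v : Fin k → ℝ≥0 → ℝ} {w : Fin q → ℝ≥0 → ℝ} (hv : ∀ j, MemLp (v j) 2 leb)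
    (hw : ∀ j, MemLp (w j) 2 leb) :
    ∃ (x : Fin n → ℝ≥0 → ℝ) (hx : ∀ i, MemLp (x i) 2 leb),
      StateEq timeModel A B₁ B₂ a (fun j => realClass (hv j)) (fun j => realClass (hw j))
        (fun i => realClass (hx i)) ∧
      ∀ i t, x i t = a i + ∫ τ in Set.Iic t, (∑ j, A i j * x j τ + ∑ j, B₁ i j * v j τ +
        ∑ j, B₂ i j * w j τ) ∂leb := by
  obtain ⟨X, hX⟩ := exists_stateEq timeModel hA B₁ B₂ a (fun j => realClass (hv j))
    (fun j => realClass (hw j))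
  have hconj : ∀ i, timeModel.conj (X i) = X i := by
    have h1 := hX.conj
    simp only [conj_realClass] at h1
    exact congrFun (h1.unique timeModel hA hX)
  choose u hu huX using fun i => exists_realClass_eq (hconj i)
  have huX' : ∀ i, X i =ᵐ[leb] fun t => (u i t : ℂ) := fun i => by
    rw [← huX i]; exact coeFn_realClass _
  set g : Fin n → ℝ≥0 → ℝ := fun i τ => ∑ j, A i j * u j τ + ∑ j, B₁ i j * v j τ +
    ∑ j, B₂ i j * w j τ with hg
  have hgL : ∀ i, MemLp (g i) 2 leb := fun i =>
    ((memLp_finsetSum _ fun j _ => (hu j).const_mul _).add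
      (memLp_finsetSum _ fun j _ => (hv j).const_mul _)).add
      (memLp_finsetSum _ fun j _ => (hw j).const_mul _)
  have hgX : ∀ i, (∑ j, (A i j : ℂ) • X j + ∑ j, (B₁ i j : ℂ) • realClass (hv j) +
      ∑ j, (B₂ i j : ℂ) • realClass (hw j)) = realClass (hgL i) := by
    intro i
    apply Lp.ext
    filter_upwards [Lp.coeFn_add (∑ j, (A i j : ℂ) • X j + ∑ j, (B₁ i j : ℂ) • realClass (hv j))
        (∑ j, (B₂ i j : ℂ) • realClass (hw j)),
      Lp.coeFn_add (∑ j, (A i j : ℂ) • X j) (∑ j, (B₁ i j : ℂ) • realClass (hv j)),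
      coeFn_lsq_sum Finset.univ (fun j => (A i j : ℂ)) huX',
      coeFn_lsq_sum Finset.univ (fun j => (B₁ i j : ℂ)) fun j => coeFn_realClass (hv j),
      coeFn_lsq_sum Finset.univ (fun j => (B₂ i j : ℂ)) fun j => coeFn_realClass (hw j),
      coeFn_realClass (hgL i)] with t h1 h2 h3 h4 h5 h6
    rw [h1, Pi.add_apply, h2, Pi.add_apply, h3, h4, h5, h6]
    simp only [hg]
    push_cast
    rfl
  -- A pointwise defined representative of the class `X i`. Its derivative is `u + g - y`, which
  -- equals `g` almost everywhere.
  set y : Fin n → ℝ≥0 → ℂ := fun i t => lag (fun τ => ((u i τ + g i τ : ℝ) : ℂ)) t +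
    a i * Complex.exp (-1 * (t : ℝ)) with hy
  have hyX : ∀ i, y i =ᵐ[leb] X i := by
    intro i
    have h1 : (X i + realClass (hgL i) : LSq) =ᵐ[leb] fun τ => ((u i τ + g i τ : ℝ) : ℂ) := by
      filter_upwards [Lp.coeFn_add (X i) (realClass (hgL i)), huX' i, coeFn_realClass (hgL i)]
        with t h1 h2 h3
      rw [h1, Pi.add_apply, h2, h3]
      push_cast
      rfl
    have h2 := eq_lagLinear_of_stateEq hX i
    rw [hgX] at h2
    rw [h2]
    filter_upwards [Lp.coeFn_add (lagLinear (X i + realClass (hgL i))) ((a i : ℂ) • timeModel.e),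
      coeFn_lagLinear _ h1, Lp.coeFn_smul (a i : ℂ) timeModel.e, memLp_exp.coeFn_toLp]
      with t h3 h4 h5 h6
    have h7 : timeModel.e t = Complex.exp (-1 * (t : ℝ)) := h6
    rw [h3, Pi.add_apply, h4, h5, Pi.smul_apply, h7, smul_eq_mul]
  have hyu : ∀ i, y i =ᵐ[leb] fun t => (u i t : ℂ) := fun i => (hyX i).trans (huX' i)
  have hyp : ∀ i, IsPrimitive (a i) (fun t => (g i t : ℂ)) (y i) := by
    intro i
    have h0 : MemLp (fun τ => ((u i τ + g i τ : ℝ) : ℂ)) 2 leb := ((hu i).add (hgL i)).ofReal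
    have h1 := (isPrimitive_lag (integrableOn_of_memLp h0)).add
      ((IsPrimitive.exp (-1)).const_mul (a i))
    rw [zero_add, mul_one] at h1
    refine h1.congr_deriv ?_
    filter_upwards [hyu i] with t ht
    simp only [hy] at ht
    linear_combination Complex.ofReal_add (u i t) (g i t) - ht
  have hyx : ∀ i t, y i t = ((a i + ∫ τ in Set.Iic t, g i τ ∂leb : ℝ) : ℂ) := by
    intro i t
    rw [(hyp i).eq, integral_complex_ofReal]
    push_cast
    rfl
  set x : Fin n → ℝ≥0 → ℝ := fun i t => a i + ∫ τ in Set.Iic t, g i τ ∂leb with hxdef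
  have hux : ∀ i, u i =ᵐ[leb] x i := by
    intro i
    filter_upwards [hyu i] with t ht
    rw [hyx] at ht
    exact_mod_cast ht.symm
  have hxL : ∀ i, MemLp (x i) 2 leb := fun i => (hu i).ae_eq (hux i)
  refine ⟨x, hxL, ?_, fun i t => ?_⟩
  · have h1 : (fun i => realClass (hxL i)) = X := by
      ext1 i
      rw [← huX i]
      refine MemLp.toLp_congr _ _ ?_
      filter_upwards [hux i] with t ht
      rw [ht]
    rwa [h1]
  · simp only [hxdef, hg]
    congr 1
    refine integral_congr_ae (ae_restrict_of_ae ?_)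
    filter_upwards [ae_all_iff.mpr hux] with τ hτ
    simp only [hτ, hxdef, hg]

end Trajectory

/-! ### Concatenation of signals and trajectories. -/

section Splice

variable {E : Type*} {n k q : ℕ}

/-- The function that follows `f` up to time `T` and `g`, started at time `T`, afterwards. -/
noncomputable def splice (T : ℝ≥0) (f g : ℝ≥0 → E) (t : ℝ≥0) : E := if t ≤ T then f t else g (t - T)

theorem splice_of_le {T t : ℝ≥0} (h : t ≤ T) (f g : ℝ≥0 → E) : splice T f g t = f t := if_pos h

theorem splice_add {T t : ℝ≥0} (h : t ≠ 0) (f g : ℝ≥0 → E) : splice T f g (T + t) = g t := by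
  rw [splice, if_neg (by simpa using h), add_tsub_cancel_left]

theorem ae_ne_zero_time : ∀ᵐ t ∂leb, t ≠ 0 := by simp [ae_iff]

variable [NormedAddCommGroup E]

theorem memLp_shift {f : ℝ≥0 → E} (hf : MemLp f 2 leb) (T : ℝ≥0) :
    MemLp (fun t => f (T + t)) 2 leb := by
  refine (measurableEmbedding_add T).memLp_map_measure_iff.mp ?_
  rw [map_add_leb]
  exact hf.restrict _

theorem memLp_splice {T : ℝ≥0} {f g : ℝ≥0 → E} (hf : MemLp f 2 (leb.restrict (Set.Iic T)))
    (hg : MemLp g 2 leb) : MemLp (splice T f g) 2 leb := by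
  classical
  have h1 : splice T f g = (Set.Iic T).piecewise f (splice T f g) := by
    ext t
    by_cases h : t ≤ T
    · rw [Set.piecewise_eq_of_mem _ _ _ (Set.mem_Iic.mpr h), splice_of_le h]
    · rw [Set.piecewise_eq_of_notMem _ _ _ (mt Set.mem_Iic.mp h)]
  rw [h1]
  refine MemLp.piecewise measurableSet_Iic hf ?_
  rw [Set.compl_Iic, Measure.restrict_congr_set Ioi_ae_eq_Ici, ← map_add_leb,
    (measurableEmbedding_add T).memLp_map_measure_iff]
  refine hg.ae_eq ?_
  filter_upwards [ae_ne_zero_time] with t ht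
  exact (splice_add ht f g).symm

variable [NormedSpace ℝ E]

theorem integral_split {f : ℝ≥0 → E} (hf : Integrable f leb) (T : ℝ≥0) :
    ∫ t, f t ∂leb = ∫ t in Set.Iic T, f t ∂leb + ∫ t, f (T + t) ∂leb := by
  rw [← integral_Ici_leb, integral_Ici_eq_integral_Ioi, ← Set.compl_Iic,
    integral_add_compl measurableSet_Iic hf]

theorem setIntegral_split {f : ℝ≥0 → E} {T t : ℝ≥0} (hf : IntegrableOn f (Set.Iic (T + t)) leb) :
    ∫ τ in Set.Iic (T + t), f τ ∂leb =
      ∫ τ in Set.Iic T, f τ ∂leb + ∫ τ in Set.Iic t, f (T + τ) ∂leb := by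
  rw [← setIntegral_Icc_leb, integral_Icc_eq_integral_Ioc,
    ← Set.Iic_union_Ioc_eq_Iic (le_self_add : T ≤ T + t), setIntegral_union
    (Set.Iic_disjoint_Ioc le_rfl) measurableSet_Ioc]
  · exact hf.mono_set (Set.Iic_subset_Iic.mpr le_self_add)
  · exact hf.mono_set Set.Ioc_subset_Iic_self

theorem memLp_mv {m p : ℕ} (M : Matrix (Fin p) (Fin m) ℝ) {u : Signal m} {μ : Measure ℝ≥0}
    (hu : MemLp u 2 μ) : MemLp (fun t => mv M (u t)) 2 μ :=
  (Matrix.toLpLin 2 2 M).toContinuousLinearMap.comp_memLp' hu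

theorem IsTrajectory.splice {A : Matrix (Fin n) (Fin n) ℝ}
    {B₁ : Matrix (Fin n) (Fin k) ℝ} {B₂ : Matrix (Fin n) (Fin q) ℝ} {x₀ : Vec n}
    {v v' : Signal k} {w w' : Signal q} {x ξ : Signal n} {T : ℝ≥0}
    (h : IsTrajectory A B₁ B₂ x₀ v w x) (hv : ∀ t ≤ T, v' t = v t) (hw : ∀ t ≤ T, w' t = w t)
    (hv' : v' ∈ LTwo k) (hw' : w' ∈ LTwo q) (hξ : ξ ∈ LTwo n)
    (hξ' : ∀ t, ξ t = x T +
      ∫ τ in Set.Iic t, (mv A (ξ τ) + mv B₁ (v' (T + τ)) + mv B₂ (w' (T + τ))) ∂leb) :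
    IsTrajectory A B₁ B₂ x₀ v' w' (splice T x ξ) := by
  have hy : MemLp (CTIQC.splice T x ξ) 2 leb := memLp_splice (h.1 T) hξ
  have hi := integrableOn_of_memLp (((memLp_mv A hy).add (memLp_mv B₁ hv')).add (memLp_mv B₂ hw'))
  have hle : ∀ t ≤ T, ∫ τ in Set.Iic t, (mv A (CTIQC.splice T x ξ τ) + mv B₁ (v' τ) +
      mv B₂ (w' τ)) ∂leb = ∫ τ in Set.Iic t, (mv A (x τ) + mv B₁ (v τ) + mv B₂ (w τ)) ∂leb := by
    intro t ht
    refine setIntegral_congr_fun measurableSet_Iic fun τ hτ => ?_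
    have h1 : τ ≤ T := le_trans hτ ht
    simp only [splice_of_le h1, hv τ h1, hw τ h1]
  refine ⟨fun t => hy.restrict _, fun t => ?_⟩
  by_cases ht : t ≤ T
  · rw [splice_of_le ht, h.2 t, hle t ht]
  · obtain ⟨r, rfl⟩ := exists_add_of_le (not_le.mp ht).le
    have hr : r ≠ 0 := by rintro rfl; simp at ht
    rw [splice_add hr, hξ', h.2 T, add_assoc]
    congr 1
    refine Eq.trans ?_ (setIntegral_split (hi (T + r))).symm
    congr 1
    · exact (hle T le_rfl).symm
    · refine integral_congr_ae (ae_restrict_of_ae ?_)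
      filter_upwards [ae_ne_zero_time] with τ hτ
      simp only [Pi.add_apply, splice_add hτ]

theorem integrable_quadForm (Q : Matrix (Fin n ⊕ (Fin k ⊕ Fin q)) (Fin n ⊕ (Fin k ⊕ Fin q)) ℝ)
    {x : Signal n} {v : Signal k} {w : Signal q} (hx : x ∈ LTwo n) (hv : v ∈ LTwo k)
    (hw : w ∈ LTwo q) : Integrable (fun t => quadForm Q (x t) (v t) (w t)) leb := by
  have h1 : ∀ i, MemLp (fun t => (Sum.elim (x t).ofLp (Sum.elim (v t).ofLp (w t).ofLp) :
      Fin n ⊕ (Fin k ⊕ Fin q) → ℝ) i) 2 leb := by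
    rintro (i | i | i)
    · exact hx.eval_piLp i
    · exact hv.eval_piLp i
    · exact hw.eval_piLp i
  simp only [quadForm, dotProduct, Matrix.mulVec, Finset.mul_sum]
  refine integrable_finsetSum _ fun i _ => integrable_finsetSum _ fun j _ => ?_
  exact (h1 i).integrable_mul ((h1 j).const_mul (Q i j))

end Splice

/-! ### The future input and the complete IQC. -/

section Future

variable {n k q : ℕ}

/-- From every state there is an input `u`, such that for all inputs near `u` the integral of
`σ` is at most `δ`, whatever the other input. -/
theorem exists_future {A : Matrix (Fin n) (Fin n) ℝ} (hA : Hurwitz A)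
    (B₁ : Matrix (Fin n) (Fin k) ℝ) (B₂ : Matrix (Fin n) (Fin q) ℝ)
    {Q : Matrix (Fin n ⊕ (Fin k ⊕ Fin q)) (Fin n ⊕ (Fin k ⊕ Fin q)) ℝ} (hQ : Q.IsSymm)
    (hfreq : MinimaxFrequencyCondition A B₁ B₂ Q)
    (C₁ : Matrix (Fin k) (Fin n) ℝ) (D₁ : Matrix (Fin k) (Fin k) ℝ) (D₂ : Matrix (Fin k) (Fin q) ℝ)
    (hle : ∀ (x : Vec n) (v : Vec k) (w : Vec q),
        quadForm Q x v w ≤ ‖mv C₁ x + mv D₁ v + mv D₂ w‖ ^ 2)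
    (hdet : ∀ s : ℂ, 0 < s.re →
        (Matrix.fromBlocks (toC A - s • (1 : Matrix (Fin n) (Fin n) ℂ)) (toC B₁)
          (toC C₁) (toC D₁)).det ≠ 0)
    (a : Vec n) {δ : ℝ} (hδ : 0 < δ) :
    ∃ u ∈ LTwo k, ∃ ρ : ℝ, 0 < ρ ∧ ∀ v ∈ LTwo k, ∀ w ∈ LTwo q,
      eLpNorm (fun t => v t - u t) 2 leb ≤ ENNReal.ofReal ρ →
      ∃ ξ ∈ LTwo n, (∀ t, ξ t = a +
        ∫ τ in Set.Iic t, (mv A (ξ τ) + mv B₁ (v τ) + mv B₂ (w τ)) ∂leb) ∧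
        ∫ t, quadForm Q (ξ t) (v t) (w t) ∂leb ≤ δ := by
  obtain ⟨U, hU, ρ, hρ, h⟩ := exists_robust_input timeModel hA B₁ B₂ hQ hfreq C₁ D₁ D₂ hle hdet
    a.ofLp hδ
  choose u hu huU using fun j => exists_realClass_eq (hU j)
  refine ⟨fun t => WithLp.toLp 2 fun j => u j t, MemLp.of_eval_piLp hu, ρ, hρ,
    fun v hv w hw hd => ?_⟩
  have hv' : ∀ j, MemLp (fun t => v t j) 2 leb := fun j => hv.eval_piLp j
  have hw' : ∀ j, MemLp (fun t => w t j) 2 leb := fun j => hw.eval_piLp j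
  obtain ⟨x, hx, hstate, hxeq⟩ := exists_trajectory hA B₁ B₂ a.ofLp hv' hw'
  have hξ : MemLp (fun t => WithLp.toLp 2 fun i => x i t : Signal n) 2 leb := MemLp.of_eval_piLp hx
  refine ⟨fun t => WithLp.toLp 2 fun i => x i t, hξ, fun t => ?_, ?_⟩
  · ext i
    have hi := integrableOn_of_memLp (((memLp_mv A hξ).add (memLp_mv B₁ hv)).add (memLp_mv B₂ hw)) t
    exact (hxeq i t).trans (congrArg (a i + ·)
      (eval_integral_piLp (fun i => Integrable.eval_piLp hi i) i).symm)
  · have h1 := h (fun j => realClass (hv' j)) (fun j => realClass (hw' j))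
      (fun i => realClass (hx i)) (fun j => conj_realClass _) (fun j => conj_realClass _) ?_ hstate
    · have hz : ∀ i, MemLp ((Sum.elim x (Sum.elim (fun j t => v t j) fun j t => w t j) :
          Fin n ⊕ (Fin k ⊕ Fin q) → ℝ≥0 → ℝ) i) 2 leb := by
        rintro (i | i | i)
        · exact hx i
        · exact hv' i
        · exact hw' i
      have h2 : (Sum.elim (fun i => realClass (hx i)) (Sum.elim (fun j => realClass (hv' j))
          fun j => realClass (hw' j)) : Fin n ⊕ (Fin k ⊕ Fin q) → LSq) =
          fun i => realClass (hz i) := by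
        ext1 (i | i | i) <;> rfl
      rw [h2, realForm_realClass] at h1
      refine le_trans (le_of_eq (integral_congr_ae (Eventually.of_forall fun t => ?_))) h1
      have h3 : (fun i => (Sum.elim x (Sum.elim (fun j t => v t j) fun j t => w t j) :
          Fin n ⊕ (Fin k ⊕ Fin q) → ℝ≥0 → ℝ) i t) =
          Sum.elim (fun i => x i t) (Sum.elim (v t).ofLp (w t).ofLp) := by
        ext (i | i | i) <;> rfl
      simp only [h3, quadForm]
    · refine (pi_norm_le_iff_of_nonneg hρ.le).mpr fun j => ?_
      rw [Pi.sub_apply, ← huU j]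
      have h2 : realClass (hv' j) - realClass (hu j) = realClass ((hv' j).sub (hu j)) := by
        rw [realClass, realClass, ← MemLp.toLp_sub]
        exact MemLp.toLp_congr _ _ (Eventually.of_forall fun t => by simp)
      rw [h2, realClass, Lp.norm_toLp]
      refine ENNReal.toReal_le_of_le_ofReal hρ.le (le_trans (eLpNorm_mono fun t => ?_) hd)
      rw [Complex.norm_real]
      exact PiLp.norm_apply_le (v t - WithLp.toLp 2 fun j => u j t) j

theorem completeIQC_of_isSymm (Δ : Set (Signal k × Signal q)) (hΔ : Δ ⊆ LLoc k ×ˢ LLoc q)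
    {A : Matrix (Fin n) (Fin n) ℝ} (hA : Hurwitz A)
    (B₁ : Matrix (Fin n) (Fin k) ℝ) (B₂ : Matrix (Fin n) (Fin q) ℝ)
    {Q : Matrix (Fin n ⊕ (Fin k ⊕ Fin q)) (Fin n ⊕ (Fin k ⊕ Fin q)) ℝ} (hQ : Q.IsSymm)
    (X₀ : Set (Vec n)) (hstab : WeaklyCausallyStable Δ) (hcond : ConditionalIQC Δ A B₁ B₂ Q X₀)
    (hfreq : MinimaxFrequencyCondition A B₁ B₂ Q)
    (C₁ : Matrix (Fin k) (Fin n) ℝ) (D₁ : Matrix (Fin k) (Fin k) ℝ) (D₂ : Matrix (Fin k) (Fin q) ℝ)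
    (hle : ∀ (x : Vec n) (v : Vec k) (w : Vec q),
        quadForm Q x v w ≤ ‖mv C₁ x + mv D₁ v + mv D₂ w‖ ^ 2)
    (hdet : ∀ s : ℂ, 0 < s.re →
        (Matrix.fromBlocks (toC A - s • (1 : Matrix (Fin n) (Fin n) ℂ)) (toC B₁)
          (toC C₁) (toC D₁)).det ≠ 0) :
    CompleteIQC Δ A B₁ B₂ Q X₀ := by
  obtain ⟨κ, hκ, hκΔ⟩ := hcond
  refine ⟨κ, hκ, fun v w hvw x₀ hx₀ x hx T => le_of_forall_pos_le_add fun δ hδ => ?_⟩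
  obtain ⟨u, hu, ρ, hρ, h⟩ := exists_future hA B₁ B₂ hQ hfreq C₁ D₁ D₂ hle hdet (x T) hδ
  have hvs : splice T v u ∈ LTwo k := memLp_splice ((hΔ hvw).1 T) hu
  obtain ⟨vi, wi, hi, hlim⟩ := hstab T v w (splice T v u) hvw hvs fun t ht =>
    (splice_of_le ht _ _).symm
  obtain ⟨N, hN⟩ := (hlim.eventually_lt_const (ENNReal.ofReal_pos.mpr hρ)).exists
  obtain ⟨hmem, hv', hw', hag⟩ := hi N
  -- Restricting to the future only decreases the norm. At the instant `T` itself the splice follows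
  -- `v` and not `u`, hence the comparison almost everywhere.
  have hd : eLpNorm (fun t => vi N (T + t) - u t) 2 leb ≤ ENNReal.ofReal ρ := by
    have h1 : (fun t => vi N (T + t) - u t) =ᵐ[leb]
        (fun t => vi N t - splice T v u t) ∘ (T + ·) := by
      filter_upwards [ae_ne_zero_time] with t ht
      rw [Function.comp_apply, splice_add ht]
    rw [eLpNorm_congr_ae h1, ← (measurableEmbedding_add T).eLpNorm_map_measure, map_add_leb]
    exact (eLpNorm_mono_measure _ Measure.restrict_le_self).trans hN.le
  obtain ⟨ξ, hξ, hξeq, hξδ⟩ := h _ (memLp_shift hv' T) _ (memLp_shift hw' T) hd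
  have htraj := hx.splice (fun t ht => (hag t ht).1) (fun t ht => (hag t ht).2) hv' hw' hξ hξeq
  have h1 := hκΔ _ _ hmem hv' hw' x₀ hx₀ _ htraj
  -- The approximating signals agree with `v` and `w` at time `0 ≤ T`, so `κ` is evaluated at the
  -- same point.
  rw [(hag 0 zero_le).1, (hag 0 zero_le).2, integral_split
    (integrable_quadForm Q (memLp_splice (hx.1 T) hξ) hv' hw') T] at h1
  refine h1.trans (add_le_add (le_of_eq ?_) ?_)
  · refine setIntegral_congr_fun measurableSet_Iic fun t ht => ?_
    simp only [splice_of_le (Set.mem_Iic.mp ht), (hag t ht).1, (hag t ht).2]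
  · refine le_trans (le_of_eq (integral_congr_ae ?_)) hξδ
    filter_upwards [ae_ne_zero_time] with t ht
    rw [splice_add ht]

end Future

/-! ### Reduction to symmetric `Q`. -/

section Symmetrization

variable {n k q : ℕ}

theorem quadForm_symmetrize (Q : Matrix (Fin n ⊕ (Fin k ⊕ Fin q)) (Fin n ⊕ (Fin k ⊕ Fin q)) ℝ) :
    quadForm ((2 : ℝ)⁻¹ • (Q + Qᵀ)) = quadForm Q := by
  ext x v w
  rw [quadForm, quadForm, Matrix.smul_mulVec, dotProduct_smul, Matrix.add_mulVec, dotProduct_add,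
    Matrix.mulVec_transpose, dotProduct_comm _ (_ ᵥ* Q), ← Matrix.dotProduct_mulVec, smul_eq_mul]
  ring

theorem MinimaxFrequencyCondition.symmetrize {A : Matrix (Fin n) (Fin n) ℝ}
    {B₁ : Matrix (Fin n) (Fin k) ℝ} {B₂ : Matrix (Fin n) (Fin q) ℝ}
    {Q : Matrix (Fin n ⊕ (Fin k ⊕ Fin q)) (Fin n ⊕ (Fin k ⊕ Fin q)) ℝ}
    (h : MinimaxFrequencyCondition A B₁ B₂ Q) :
    MinimaxFrequencyCondition A B₁ B₂ ((2 : ℝ)⁻¹ • (Q + Qᵀ)) := by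
  obtain ⟨ε, hε, s₀, hs₀, hpsd, h1, h2⟩ := h
  -- Semidefiniteness includes that the block matrix is Hermitian. Since `ε ≠ 0`, `Π(s)` itself is
  -- then Hermitian on the imaginary axis, and replacing `Q` by its symmetric part does not change
  -- it there.
  have key : ∀ s : ℂ, s.re = 0 →
      freqMatrix A B₁ B₂ ((2 : ℝ)⁻¹ • (Q + Qᵀ)) s = freqMatrix A B₁ B₂ Q s := by
    intro s hs
    have hherm : (freqMatrix A B₁ B₂ Q s)ᴴ = freqMatrix A B₁ B₂ Q s := by
      have h3 := (hpsd s hs).isHermitian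
      rw [Matrix.isHermitian_fromBlocks_iff] at h3
      obtain ⟨h11, h12, h21, h22⟩ := h3
      have hε' : (ε : ℂ) ≠ 0 := by exact_mod_cast hε.ne'
      rw [Matrix.conjTranspose_smul, Complex.star_def, Complex.conj_ofReal] at h12 h21
      have h12' := smul_right_injective _ hε' h12
      have h21' := smul_right_injective _ hε' h21
      have h22' := h22.neg
      rw [neg_neg] at h22'
      rw [← Matrix.fromBlocks_toBlocks (freqMatrix A B₁ B₂ Q s), Matrix.fromBlocks_conjTranspose,
        h11.eq, h22'.eq, h12', h21']
    have hQ : toC ((2 : ℝ)⁻¹ • (Q + Qᵀ)) = (2 : ℂ)⁻¹ • (toC Q + (toC Q)ᴴ) := by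
      ext i j
      simp [Matrix.conjTranspose_apply, mul_add]
    have h3 : (freqMatrix A B₁ B₂ Q s)ᴴ =
        (freqColumn A B₁ B₂ s)ᴴ * (toC Q)ᴴ * freqColumn A B₁ B₂ s := by
      rw [freqMatrix, Matrix.conjTranspose_mul, Matrix.conjTranspose_mul,
        Matrix.conjTranspose_conjTranspose, Matrix.mul_assoc]
    rw [freqMatrix, hQ, Matrix.mul_smul, Matrix.smul_mul, Matrix.mul_add, Matrix.add_mul, ← h3,
      hherm, ← freqMatrix, ← two_smul ℂ, smul_smul]
    norm_num
  refine ⟨ε, hε, s₀, hs₀, fun s hs => ?_, ?_, ?_⟩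
  · rw [key s hs]; exact hpsd s hs
  · rw [key s₀ hs₀]; exact h1
  · rw [key s₀ hs₀]; exact h2

end Symmetrization
end CTIQC

theorem mainTheorem10 {n k q : ℕ} (Δ : Set (CTIQC.Signal k × CTIQC.Signal q))
    (hΔ : Δ ⊆ CTIQC.LLoc k ×ˢ CTIQC.LLoc q)
    (A : Matrix (Fin n) (Fin n) ℝ) (B₁ : Matrix (Fin n) (Fin k) ℝ)
    (B₂ : Matrix (Fin n) (Fin q) ℝ)
    (Q : Matrix (Fin n ⊕ (Fin k ⊕ Fin q)) (Fin n ⊕ (Fin k ⊕ Fin q)) ℝ)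
    (X₀ : Set (CTIQC.Vec n))
    (hA : CTIQC.Hurwitz A)
    (hstab : CTIQC.WeaklyCausallyStable Δ)
    (hcond : CTIQC.ConditionalIQC Δ A B₁ B₂ Q X₀)
    (hfreq : CTIQC.MinimaxFrequencyCondition A B₁ B₂ Q)
    (hsquare : ∃ (C : Matrix (Fin k) (Fin n) ℝ) (D₁ : Matrix (Fin k) (Fin k) ℝ)
      (D₂ : Matrix (Fin k) (Fin q) ℝ),
      (∀ (x : CTIQC.Vec n) (v : CTIQC.Vec k) (w : CTIQC.Vec q),
        CTIQC.quadForm Q x v w ≤ ‖CTIQC.mv C x + CTIQC.mv D₁ v + CTIQC.mv D₂ w‖ ^ 2) ∧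
      ∀ s : ℂ, 0 < s.re →
        (Matrix.fromBlocks (CTIQC.toC A - s • (1 : Matrix (Fin n) (Fin n) ℂ)) (CTIQC.toC B₁)
          (CTIQC.toC C) (CTIQC.toC D₁)).det ≠ 0) :
    CTIQC.CompleteIQC Δ A B₁ B₂ Q X₀ := by
  obtain ⟨C, D₁, D₂, hle, hdet⟩ := hsquare
  have hQ := CTIQC.quadForm_symmetrize Q
  have hsymm : ((2 : ℝ)⁻¹ • (Q + Qᵀ)).IsSymm := by
    rw [Matrix.IsSymm, Matrix.transpose_smul, Matrix.transpose_add, Matrix.transpose_transpose,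
      add_comm]
  have h := CTIQC.completeIQC_of_isSymm Δ hΔ hA B₁ B₂ hsymm X₀ hstab
    (by simpa only [CTIQC.ConditionalIQC, hQ] using hcond) hfreq.symmetrize C D₁ D₂
    (by simpa only [hQ] using hle) hdet
  simpa only [CTIQC.CompleteIQC, hQ] using h
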